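/- **Small model property of Array Folds Logic (AFL).** There is a constant $c\in\mathbb N$ such that every AFL formula $\phi$ is satisfiable if and only if it has a model $\sigma$ such that (a) $|\sigma(x)|\le 2^{|\phi|^c}$ for each integer variable $x$ of $\phi$, and (b) for each array variable $a$ of $\phi$, the sequence $\sigma(a)$ has length at most $2^{|\phi|^c}$ and every entry $z$ of it satisfies $|z|\le 2^{|\phi|^c}$. *Syntax.* Array terms, integer terms, formulas and vector terms ($m\ge1$) are given by $$A::=a\mid A\{T\leftarrow T\},\qquad T::=n\mid x\mid T+T\mid A[T]\mid |A|,$$ $$B::=A=A\mid T=T\mid T<T\mid \neg B\mid B\wedge B\mid V^m=V^m,\qquad V^m::=(T;\dots;T)\mid \mathit{fold}_A\,V^m\,F^m,$$ where $a$ is an array variable, $x$ an integer variable and $n\in\mathbb Z$. A function $F^m$ is a finite list of branches $\mathit{grd}\Rightarrow\mathit{upd}$. A guard is a conjunction of comparisons $\mathbf e\approx T$, $\mathbf i\approx T$, $\mathbf c_j\approx T$ ($1\le j<m$), $\mathbf s\approx n$ with ${\approx}\in\{>,<,=,\ne\}$; an update is a list of $\mathbf c_j\mathrel{+}=n$, $\mathbf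 s\leftarrow n$, $\mathit{skip}$, $\mathit{break}$. Here $\mathbf e$ is the current array element, $\mathbf i$ the current index, $\mathbf c_1,\dots,\mathbf c_{m-1}$ are counters and $\mathbf s$ is the state. It is required that * the guards of different branches are mutually exclusive (for all values of all variables), and each branch has at most one update of each $\mathbf c_j$ and of $\mathbf s$; * consider the graph whose vertices are $0$ and all $n$ with $\mathbf s\leftarrow n$ in some branch, and in which each branch gives an edge from every vertex $s_1$ satisfying the comparisons of $\mathbf s$ in its guard to $n$ if the branch contains $\mathbf s\leftarrow n$, and to $s_1$ otherwise. Within each strongly connected component, for each counter, the constants added to it on the edges are all $\ge0$ or all $\le0$. *Semantics.* A model maps integer variables to $\mathbb Z$ and array variables to finite sequences over $\mathbb Z$ (indexed from $0$) and makes $\phi$ true. A read outside an array yields $0$ and a write outside an array leaves it unchanged; array and vector equality are equality of sequences. To evaluate $\mathit{fold}_A\,v\,f$, start with $(\mathbf i,\mathbf c_1,\dots,\mathbf c_{m-1})=v$ and $\mathbf s=0$. As long as $0\le\mathbf i<|A|$, set $\mathbf e=A[\mathbf i]$ and look for the branch whose guard holds. If there is none, or if it contains $\mathit{break}$, stop;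 otherwise apply its updates and increase $\mathbf i$ by $1$. The value is the final $(\mathbf i,\mathbf c_1,\dots,\mathbf c_{m-1})$. *Size.* $|\phi|$ is the number of symbols of $\phi$, where each integer constant counts as the length of its binary representation (with sign). -/

import Mathlib

namespace AFL

/-! Syntax.  Integer variables and array variables are named by natural numbers. -/

mutual
/-- Integer terms `T ::= n | x | T + T | A[T] | |A|`. -/
inductive IntTerm : Type
  | const : ℤ → IntTerm
  | var : ℕ → IntTerm
  | add : IntTerm → IntTerm → IntTerm
  | read : ArrTerm → IntTerm → IntTerm
  | length : ArrTerm → IntTerm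
/-- Array terms `A ::= a | A{T ← T}`. -/
inductive ArrTerm : Type
  | var : ℕ → ArrTerm
  | write : ArrTerm → IntTerm → IntTerm → ArrTerm
end

/-- The comparison symbols `>`, `<`, `=`, `≠`. -/
inductive CmpOp : Type
  | gt
  | lt
  | eq
  | ne

/-- Atomic guards of a function with `k` counters: comparisons of the current array element `e`,
the index `i`, or a counter `c_j` with an integer term, and of the state `s` with a constant. -/
inductive AtomicGuard (k : ℕ) : Type
  | elem : CmpOp → IntTerm → AtomicGuard k
  | index : CmpOp → IntTerm → AtomicGuard k
  | counter : Fin k → CmpOp → IntTerm → AtomicGuard k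
  | state : CmpOp → ℤ → AtomicGuard k

/-- Atomic updates `c_j += n`, `s ← n`, `skip`, `break`. -/
inductive AtomicUpdate (k : ℕ) : Type
  | incr : Fin k → ℤ → AtomicUpdate k
  | setState : ℤ → AtomicUpdate k
  | skip : AtomicUpdate k
  | brk : AtomicUpdate k

/-- A branch `grd ⇒ upd`: a conjunction of atomic guards and a list of atomic updates. -/
structure Branch (k : ℕ) : Type where
  guard : List (AtomicGuard k)
  upd : List (AtomicUpdate k)

/-! Semantics of terms, guards and updates. -/

/-- An interpretation: integers for the integer variables, finite integer sequences for the
array variables. -/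
structure Interp : Type where
  int : ℕ → ℤ
  arr : ℕ → List ℤ

/-- `a[i]`; a read outside of the array yields `0`. -/
def readAt (a : List ℤ) (i : ℤ) : ℤ := if i < 0 then 0 else a.getD i.toNat 0

/-- `a{i ← x}`; a write outside of the array has no effect. -/
def writeAt (a : List ℤ) (i x : ℤ) : List ℤ := if i < 0 then a else a.set i.toNat x

mutual
def IntTerm.eval (σ : Interp) : IntTerm → ℤ
  | .const n => n
  | .var x => σ.int x
  | .add t u => t.eval σ + u.eval σ
  | .read a t => readAt (a.eval σ) (t.eval σ)
  | .length a => ((a.eval σ).length : ℤ)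
def ArrTerm.eval (σ : Interp) : ArrTerm → List ℤ
  | .var a => σ.arr a
  | .write a t u => writeAt (a.eval σ) (t.eval σ) (u.eval σ)
end

def CmpOp.eval : CmpOp → ℤ → ℤ → Bool
  | .gt, x, y => decide (x > y)
  | .lt, x, y => decide (x < y)
  | .eq, x, y => decide (x = y)
  | .ne, x, y => decide (x ≠ y)

/-- Truth of an atomic guard when the current array element is `e`, the index and the counters
are `v 0` and `v 1, …, v k`, and the state is `s`. -/
def AtomicGuard.eval {k : ℕ} (σ : Interp) (e : ℤ) (v : Fin (k + 1) → ℤ) (s : ℤ) :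
    AtomicGuard k → Bool
  | .elem op t => op.eval e (t.eval σ)
  | .index op t => op.eval (v 0) (t.eval σ)
  | .counter j op t => op.eval (v j.succ) (t.eval σ)
  | .state op n => op.eval s n

/-- The guard of the branch is true. -/
def Branch.holds {k : ℕ} (b : Branch k) (σ : Interp) (e : ℤ) (v : Fin (k + 1) → ℤ) (s : ℤ) :
    Bool :=
  b.guard.all (AtomicGuard.eval σ e v s)

/-- The constants `n` of the updates `c_j += n` in the branch. -/
def Branch.increments {k : ℕ} (b : Branch k) (j : Fin k) : List ℤ :=
  b.upd.filterMap fun u => match u with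
    | .incr j' n => if j' = j then some n else none
    | _ => none

/-- The constants `n` of the updates `s ← n` in the branch. -/
def Branch.stateUpdates {k : ℕ} (b : Branch k) : List ℤ :=
  b.upd.filterMap fun u => match u with
    | .setState n => some n
    | _ => none

/-- The branch contains `break`. -/
def Branch.breaks {k : ℕ} (b : Branch k) : Bool :=
  b.upd.any fun u => match u with
    | .brk => true
    | _ => false

/-- The state after the branch, entered in state `s`. -/
def Branch.nextState {k : ℕ} (b : Branch k) (s : ℤ) : ℤ := b.stateUpdates.head?.getD s

/-- The index and the counters after the branch; the index is always incremented by one. -/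
def Branch.nextVec {k : ℕ} (b : Branch k) (v : Fin (k + 1) → ℤ) : Fin (k + 1) → ℤ :=
  Fin.cons (v 0 + 1) fun j => v j.succ + (b.increments j).head?.getD 0

/-! The control flow graph of a list of branches. -/

/-- The state `s` satisfies all comparisons of the state variable in the guard of the branch. -/
def Branch.admitsState {k : ℕ} (b : Branch k) (s : ℤ) : Prop :=
  ∀ (op : CmpOp) (n : ℤ), AtomicGuard.state op n ∈ b.guard → op.eval s n = true

/-- The states: `0` and all constants assigned to the state variable. -/
def states {k : ℕ} (br : List (Branch k)) : Set ℤ :=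
  {n | n = 0 ∨ ∃ b ∈ br, n ∈ b.stateUpdates}

/-- The branch `b` gives rise to an edge from `s` to `t`. -/
def EdgeVia {k : ℕ} (br : List (Branch k)) (b : Branch k) (s t : ℤ) : Prop :=
  b ∈ br ∧ s ∈ states br ∧ b.admitsState s ∧ t = b.nextState s

def Edge {k : ℕ} (br : List (Branch k)) (s t : ℤ) : Prop := ∃ b, EdgeVia br b s t

/-- `s` and `t` lie in the same strongly connected component. -/
def SameSCC {k : ℕ} (br : List (Branch k)) (s t : ℤ) : Prop :=
  Relation.ReflTransGen (Edge br) s t ∧ Relation.ReflTransGen (Edge br) t s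

/-- Functional constants of sort `F^m`, where `m = k + 1`. -/
structure FoldFun (k : ℕ) : Type where
  branches : List (Branch k)
  /-- The guards of distinct branches are mutually exclusive. -/
  exclusive : branches.Pairwise fun b b' => ∀ (σ : Interp) (e : ℤ) (v : Fin (k + 1) → ℤ) (s : ℤ),
    ¬ (b.holds σ e v s = true ∧ b'.holds σ e v s = true)
  /-- A branch contains at most one update of each counter, -/
  increments_le_one : ∀ b ∈ branches, ∀ j : Fin k, (b.increments j).length ≤ 1
  /-- and at most one update of the state. -/
  stateUpdates_le_one : ∀ b ∈ branches, b.stateUpdates.length ≤ 1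
  /-- In each strongly connected component (here that of `r`) of the control flow graph, the
  updates of a counter on the edges are all non-decreasing or all non-increasing. -/
  monotone : ∀ r ∈ states branches, ∀ j : Fin k,
    (∀ b s t, EdgeVia branches b s t → SameSCC branches r s → SameSCC branches r t →
      ∀ n ∈ b.increments j, 0 ≤ n) ∨
    (∀ b s t, EdgeVia branches b s t → SameSCC branches r s → SameSCC branches r t →
      ∀ n ∈ b.increments j, n ≤ 0)

/-- Vector terms of sort `V^m`, where `m = k + 1`. -/
inductive VecTerm (k : ℕ) : Type
  | tuple : (Fin (k + 1) → IntTerm) → VecTerm k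
  | fold : ArrTerm → VecTerm k → FoldFun k → VecTerm k

/-- Boolean terms, that is, formulas. -/
inductive Formula : Type
  | arrEq : ArrTerm → ArrTerm → Formula
  | intEq : IntTerm → IntTerm → Formula
  | intLt : IntTerm → IntTerm → Formula
  | vecEq {k : ℕ} : VecTerm k → VecTerm k → Formula
  | neg : Formula → Formula
  | conj : Formula → Formula → Formula

/-! Semantics of folds and formulas. -/

/-- One application of `f` to the array element `e`. The result is `none` if `f` executes `break`,
explicitly or through the implicit catch-all branch. Since guards are mutually exclusive, the
branch that is found is the only one whose guard holds. -/
def FoldFun.step {k : ℕ} (f : FoldFun k) (σ : Interp) (e : ℤ) (v : Fin (k + 1) → ℤ) (s : ℤ) :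
    Option ((Fin (k + 1) → ℤ) × ℤ) :=
  match f.branches.find? fun b => b.holds σ e v s with
  | none => none
  | some b => if b.breaks then none else some (b.nextVec v, b.nextState s)

/-- Fold `f` from the current position on; the list holds the array elements from there. -/
def FoldFun.run {k : ℕ} (f : FoldFun k) (σ : Interp) :
    List ℤ → (Fin (k + 1) → ℤ) → ℤ → (Fin (k + 1) → ℤ)
  | [], v, _ => v
  | e :: es, v, s =>
    match f.step σ e v s with
    | none => v
    | some (v', s') => f.run σ es v' s'

/-- The value of `fold_a v f`: start at index `v 0` of `a` in state `0`; if that index is out of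
bounds, return `v`. -/
def FoldFun.eval {k : ℕ} (f : FoldFun k) (σ : Interp) (a : List ℤ) (v : Fin (k + 1) → ℤ) :
    Fin (k + 1) → ℤ :=
  if v 0 < 0 then v else f.run σ (a.drop (v 0).toNat) v 0

def VecTerm.eval {k : ℕ} (σ : Interp) : VecTerm k → (Fin (k + 1) → ℤ)
  | .tuple t => fun j => (t j).eval σ
  | .fold a v f => f.eval σ (a.eval σ) (v.eval σ)

/-- `σ` is a model of the formula. -/
def Formula.Sat (σ : Interp) : Formula → Prop
  | .arrEq a b => a.eval σ = b.eval σ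
  | .intEq t u => t.eval σ = u.eval σ
  | .intLt t u => t.eval σ < u.eval σ
  | .vecEq u v => u.eval σ = v.eval σ
  | .neg φ => ¬ φ.Sat σ
  | .conj φ ψ => φ.Sat σ ∧ ψ.Sat σ

def Formula.Satisfiable (φ : Formula) : Prop := ∃ σ : Interp, φ.Sat σ

/-! Variables that occur: `Sum.inl x` is an integer variable, `Sum.inr a` an array variable. -/

mutual
def IntTerm.vars : IntTerm → Set (ℕ ⊕ ℕ)
  | .const _ => ∅
  | .var x => {Sum.inl x}
  | .add t u => t.vars ∪ u.vars
  | .read a t => a.vars ∪ t.vars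
  | .length a => a.vars
def ArrTerm.vars : ArrTerm → Set (ℕ ⊕ ℕ)
  | .var a => {Sum.inr a}
  | .write a t u => a.vars ∪ t.vars ∪ u.vars
end

def AtomicGuard.vars {k : ℕ} : AtomicGuard k → Set (ℕ ⊕ ℕ)
  | .elem _ t => t.vars
  | .index _ t => t.vars
  | .counter _ _ t => t.vars
  | .state _ _ => ∅

def FoldFun.vars {k : ℕ} (f : FoldFun k) : Set (ℕ ⊕ ℕ) :=
  {y | ∃ b ∈ f.branches, ∃ g ∈ b.guard, y ∈ g.vars}

def VecTerm.vars {k : ℕ} : VecTerm k → Set (ℕ ⊕ ℕ)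
  | .tuple t => {y | ∃ j, y ∈ (t j).vars}
  | .fold a v f => a.vars ∪ v.vars ∪ f.vars

def Formula.vars : Formula → Set (ℕ ⊕ ℕ)
  | .arrEq a b => a.vars ∪ b.vars
  | .intEq t u => t.vars ∪ u.vars
  | .intLt t u => t.vars ∪ u.vars
  | .vecEq u v => u.vars ∪ v.vars
  | .neg φ => φ.vars
  | .conj φ ψ => φ.vars ∪ ψ.vars

/-! The size of a formula: the number of its symbols, with integer constants in binary. -/

/-- A sign and the binary digits of the absolute value. -/
def constSize (n : ℤ) : ℕ := 1 + Nat.size n.natAbs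

mutual
def IntTerm.size : IntTerm → ℕ
  | .const n => constSize n
  | .var _ => 1
  | .add t u => 1 + t.size + u.size
  | .read a t => 1 + a.size + t.size
  | .length a => 1 + a.size
def ArrTerm.size : ArrTerm → ℕ
  | .var _ => 1
  | .write a t u => 1 + a.size + t.size + u.size
end

def AtomicGuard.size {k : ℕ} : AtomicGuard k → ℕ
  | .elem _ t => 2 + t.size
  | .index _ t => 2 + t.size
  | .counter _ _ t => 2 + t.size
  | .state _ n => 2 + constSize n

def AtomicUpdate.size {k : ℕ} : AtomicUpdate k → ℕ
  | .incr _ n => 2 + constSize n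
  | .setState n => 2 + constSize n
  | .skip => 1
  | .brk => 1

def Branch.size {k : ℕ} (b : Branch k) : ℕ :=
  1 + (b.guard.map AtomicGuard.size).sum + (b.upd.map AtomicUpdate.size).sum

def FoldFun.size {k : ℕ} (f : FoldFun k) : ℕ := 1 + (f.branches.map Branch.size).sum

def VecTerm.size {k : ℕ} : VecTerm k → ℕ
  | .tuple t => 1 + ∑ j, (t j).size
  | .fold a v f => 1 + a.size + v.size + f.size

def Formula.size : Formula → ℕ
  | .arrEq a b => 1 + a.size + b.size
  | .intEq t u => 1 + t.size + u.size
  | .intLt t u => 1 + t.size + u.size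
  | .vecEq u v => 1 + u.size + v.size
  | .neg φ => 1 + φ.size
  | .conj φ ψ => 1 + φ.size + ψ.size

end AFL

/-!
Every model of a formula is turned into a small one by surgery on a common timeline. All arrays of
the formula are aligned at index `0`, and all of its folds are run in parallel along the indices
`0, …, N`, each of them resting before it starts and after it has stopped
(`AFL.FoldFun.traj`). Let `V` be the set of the values of all integer terms and of the positions
that witness that two arrays differ, with an entry there. Only polynomially many indices are
*events*: those in `V`, and those where a fold starts, stops or leaves a strongly connected
component of its control flow graph, or where a counter changes its position relative to `V`. The
bound on their number is where monotonicity within the components is used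
(`AFL.card_changes_le`, `AFL.Formula.card_events_le`).

Between events all guards that do not speak about the array element or the state are constant.
The array columns there form a walk through the product of the control flow graphs, with
exponentially many vertices. Such a walk can be replaced by any other walk with the same end points
that uses the same columns, in any order and with repetitions, as long as the total change of each
counter is adjusted: since the changes of a counter have constant sign between events, its position
relative to `V` is determined by the two ends. The possible total changes contain a small vector
plus all nonnegative integer combinations of certain small vectors, the effects of short closed
walks, and the original change is one of these (`AFL.exists_pumping`).

It remains to choose new values for the elements of `V`, the events, and the values of the counters
at events, and new multiplicities for the closed walks. The values have to respect order, addition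
and small constants, and the pumping equations; this is a system of linear equations and
inequalities that has polynomially many rows, exponentially many columns and coefficients with
polynomially many digits, and the original model is a solution. Such a system has a solution of
single exponential size (`AFL.exists_small_nonneg_solution`): large coordinates at linearly
dependent columns can be decreased along a bounded kernel vector, and at independent columns
Cramer's rule bounds them. The result is a *warp* of the timeline (`AFL.Warp`, `AFL.exists_warp`).
Folds (`AFL.FoldFun.eval_warp`) and then formulas (`AFL.Formula.sat_warp`) keep their meaning
along a warp, which yields the small model (`AFL.Formula.exists_small_model`).
-/

/-! ### Small solutions of linear systems -/

namespace AFL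

open Matrix Finset

section SmallSolutions

set_option linter.unusedSectionVars false

variable {m n : Type*} [Fintype m] [Fintype n] [DecidableEq n]

/-- The columns of `A` with index in `L` are linearly independent over `ℤ`. -/
def ColIndep (A : Matrix m n ℤ) (L : Finset n) : Prop :=
  ∀ z : n → ℤ, (∀ j ∉ L, z j = 0) → A *ᵥ z = 0 → z = 0

/-- The submatrix of the columns with index in `L`. -/
def cols (A : Matrix m n ℤ) (L : Finset n) : Matrix m L ℤ := A.submatrix id Subtype.val

/-- Extension by zero of a vector indexed by `L`. -/
def extendZero (L : Finset n) (z : L → ℤ) : n → ℤ := fun j => if h : j ∈ L then z ⟨j, h⟩ else 0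

lemma mulVec_of_support (A : Matrix m n ℤ) (L : Finset n) (z : n → ℤ) (hz : ∀ j ∉ L, z j = 0) :
    A *ᵥ z = cols A L *ᵥ fun j => z j := by
  ext i
  simp only [mulVec, dotProduct, cols, submatrix_apply, id]
  rw [Finset.sum_coe_sort L (fun j => A i j * z j)]
  refine (Finset.sum_subset (Finset.subset_univ L) fun j _ hj => ?_).symm
  rw [hz j hj, mul_zero]

lemma mulVec_extendZero (A : Matrix m n ℤ) (L : Finset n) (z : L → ℤ) :
    A *ᵥ extendZero L z = cols A L *ᵥ z := by
  rw [mulVec_of_support A L _ fun j hj => by simp [extendZero, hj]]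
  congr 1
  ext j
  simp [extendZero]

/-- Independent columns have a nonsingular Gram matrix. -/
lemma ColIndep.gram_det_ne_zero {A : Matrix m n ℤ} {L : Finset n} (h : ColIndep A L) :
    ((cols A L)ᵀ * cols A L).det ≠ 0 := by
  intro h0
  obtain ⟨z, hz0, hz⟩ := Matrix.exists_mulVec_eq_zero_iff.mpr h0
  apply hz0
  have h1 : cols A L *ᵥ z = 0 := by
    have h2 : (cols A L *ᵥ z) ⬝ᵥ (cols A L *ᵥ z) = 0 := by
      rw [← mulVec_mulVec] at hz
      have := congrArg (fun w => z ⬝ᵥ w) hz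
      simp only [dotProduct_zero] at this
      rwa [dotProduct_mulVec, vecMul_transpose] at this
    exact dotProduct_self_eq_zero.mp h2
  have h3 := h (extendZero L z) (fun j hj => by simp [extendZero, hj])
    (by rw [mulVec_extendZero, h1])
  ext j
  have := congrFun h3 j
  simpa [extendZero] using this

lemma ColIndep.card_le {A : Matrix m n ℤ} {L : Finset n} (h : ColIndep A L) :
    L.card ≤ Fintype.card m := by
  have : Function.Injective (cols A L).mulVecLin := by
    rw [← LinearMap.ker_eq_bot, LinearMap.ker_eq_bot']
    intro z hz
    have h3 := h (extendZero L z) (fun j hj => by simp [extendZero, hj])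
      (by rw [mulVec_extendZero]; exact hz)
    ext j
    have := congrFun h3 j
    simpa [extendZero] using this
  simpa using card_le_of_injective (R := ℤ) (cols A L).mulVecLin this

lemma abs_det_le {r : Type*} [Fintype r] [DecidableEq r] (G : Matrix r r ℤ) {β : ℤ} {d : ℕ}
    (hβ : 1 ≤ β) (hr : Fintype.card r ≤ d) (hG : ∀ i j, |G i j| ≤ β) :
    |G.det| ≤ (d * β) ^ d := by
  have h := Matrix.det_le (A := G) (abv := AbsoluteValue.abs) (x := β) hG
  have h1 : ((Fintype.card r).factorial : ℤ) ≤ (d : ℤ) ^ d := by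
    exact_mod_cast (Nat.factorial_le hr).trans (Nat.factorial_le_pow d)
  have h2 : β ^ Fintype.card r ≤ β ^ d := pow_le_pow_right₀ hβ hr
  calc |G.det| ≤ ((Fintype.card r).factorial : ℤ) * β ^ Fintype.card r := by
        simpa [nsmul_eq_mul] using h
    _ ≤ (d : ℤ) ^ d * β ^ d := by gcongr
    _ = _ := (mul_pow _ _ _).symm

/-- Cramer's rule for the normal equations of a matrix with few rows has a bounded right side. -/
lemma abs_cramer_gram_le (A : Matrix m n ℤ) (L : Finset n) (b : m → ℤ) {d : ℕ} {Δ β : ℤ}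
    (hΔ : 1 ≤ Δ) (hΔβ : Δ ≤ β) (hL : L.card ≤ d) (hm : Fintype.card m ≤ d) (hd : 1 ≤ d)
    (hA : ∀ i j, |A i j| ≤ Δ) (hb : ∀ i, |b i| ≤ β) (j : L) :
    |cramer ((cols A L)ᵀ * cols A L) ((cols A L)ᵀ *ᵥ b) j| ≤ (d * (d * (Δ * β))) ^ d := by
  have key : ∀ u w : m → ℤ, (∀ i, |u i| ≤ Δ) → (∀ i, |w i| ≤ β) → |u ⬝ᵥ w| ≤ d * (Δ * β) := by
    intro u w hu hw
    calc |u ⬝ᵥ w| ≤ ∑ i, |u i * w i| := Finset.abs_sum_le_sum_abs _ _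
      _ ≤ ∑ _i : m, Δ * β := by
          refine Finset.sum_le_sum fun i _ => ?_
          rw [abs_mul]
          exact mul_le_mul (hu i) (hw i) (abs_nonneg _) (by omega)
      _ = Fintype.card m * (Δ * β) := by simp
      _ ≤ _ := by
          have : (0 : ℤ) ≤ Δ * β := mul_nonneg (by omega) (by omega)
          gcongr
  rw [cramer_apply]
  refine abs_det_le _ ?_ (by simpa using hL) ?_
  · have : 1 ≤ Δ * β := one_le_mul_of_one_le_of_one_le hΔ (hΔ.trans hΔβ)
    exact one_le_mul_of_one_le_of_one_le (by exact_mod_cast hd) this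
  · intro i k
    rw [updateCol_apply]
    split_ifs
    · exact key (fun l => A l i) b (fun l => hA l i) hb
    · exact key (fun l => A l i) (fun l => A l k) (fun l => hA l i) fun l => (hA l k).trans hΔβ

/-- A linearly dependent set of columns satisfies a nontrivial relation with bounded
coefficients: Cramer's rule expresses a further column by a maximal independent subset. -/
lemma exists_small_kernel (A : Matrix m n ℤ) (L : Finset n) (hL : ¬ ColIndep A L) {d : ℕ} {Δ : ℤ}
    (hΔ : 1 ≤ Δ) (hm : Fintype.card m ≤ d) (hd : 1 ≤ d) (hA : ∀ i j, |A i j| ≤ Δ) :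
    ∃ y : n → ℤ, y ≠ 0 ∧ (∀ j ∉ L, y j = 0) ∧ A *ᵥ y = 0 ∧
      ∀ j, |y j| ≤ (d * (d * (Δ * Δ))) ^ d := by
  classical
  obtain ⟨L0, hL0, hmax⟩ := (L.powerset.filter (ColIndep A)).exists_max_image Finset.card
    ⟨∅, by simp only [mem_filter, mem_powerset, empty_subset, true_and]
           intro z hz _; ext j; exact hz j (by simp)⟩
  simp only [mem_filter, mem_powerset] at hL0 hmax
  obtain ⟨hsub, hind⟩ := hL0
  have hne : ∃ k ∈ L, k ∉ L0 := by
    by_contra! h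
    exact hL (by rwa [Finset.Subset.antisymm hsub h] at hind)
  obtain ⟨k, hkL, hk⟩ := hne
  have hnot : ¬ ColIndep A (insert k L0) := fun h => by
    have := hmax (insert k L0) ⟨Finset.insert_subset hkL hsub, h⟩
    rw [Finset.card_insert_of_notMem hk] at this
    omega
  unfold ColIndep at hnot
  push Not at hnot
  obtain ⟨z, hzs, hz, hz0⟩ := hnot
  have hzk : z k ≠ 0 := fun h => hz0 <| hind z (fun j hj => by
    by_cases hjk : j = k
    · rw [hjk, h]
    · exact hzs j (by simp [hj, hjk])) hz
  set B := cols A L0 with hB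
  set G := Bᵀ * B with hG
  set v : m → ℤ := fun i => A i k with hv
  have hdet : G.det ≠ 0 := hind.gram_det_ne_zero
  set w := cramer G (Bᵀ *ᵥ v) with hw
  let z' : n → ℤ := fun j => if j = k then 0 else z j
  have hzz : z = z' + z k • Pi.single k 1 := by
    ext j
    by_cases hjk : j = k
    · subst hjk; simp [z']
    · simp [z', hjk]
  have hz's : ∀ j ∉ L0, z' j = 0 := fun j hj => by
    by_cases hjk : j = k
    · simp [z', hjk]
    · simp only [z', hjk, if_false]; exact hzs j (by simp [hj, hjk])
  have hAv : A *ᵥ Pi.single k 1 = v := by ext i; simp [hv]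
  have h1 : B *ᵥ (fun j : L0 => z' j) = - z k • v := by
    rw [← mulVec_of_support A L0 z' hz's]
    rw [hzz, mulVec_add, mulVec_smul, hAv] at hz
    have h := eq_neg_of_add_eq_zero_left hz
    rw [h]; ext i; simp
  have h2 : G *ᵥ (fun j : L0 => z' j) = - z k • (Bᵀ *ᵥ v) := by
    rw [hG, ← mulVec_mulVec, h1, mulVec_smul]
  have h3 : G.det • (fun j : L0 => z' j) = - z k • w := by
    have h := congrArg (fun u => adjugate G *ᵥ u) h2
    simp only [mulVec_mulVec, adjugate_mul, smul_mulVec, one_mulVec, mulVec_smul] at h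
    rw [h, hw, cramer_eq_adjugate_mulVec, ← mulVec_mulVec]
  have h4 : B *ᵥ w = G.det • v := by
    have h : - z k • (B *ᵥ w) = - z k • (G.det • v) := by
      rw [← mulVec_smul, ← h3, mulVec_smul, h1, smul_comm]
    exact smul_right_injective _ (neg_ne_zero.mpr hzk) h
  refine ⟨extendZero L0 w - G.det • Pi.single k 1, ?_, ?_, ?_, ?_⟩
  · intro h
    have := congrFun h k
    simp [extendZero, hk] at this
    exact hdet this
  · intro j hj
    have h1 : j ∉ L0 := fun h => hj (hsub h)
    have h2 : j ≠ k := fun h => hj (h ▸ hkL)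
    simp [extendZero, h1, h2]
  · rw [mulVec_sub, mulVec_extendZero, mulVec_smul, hAv, h4, sub_self]
  · have hw_le : ∀ j, |w j| ≤ (d * (d * (Δ * Δ))) ^ d := fun j =>
      abs_cramer_gram_le A L0 v hΔ le_rfl (hind.card_le.trans hm) hm hd hA (fun i => hA i k) j
    have hdet_le : |G.det| ≤ (d * (d * (Δ * Δ))) ^ d := by
      refine abs_det_le _ ?_ (by simpa using hind.card_le.trans hm) ?_
      · have : 1 ≤ Δ * Δ := one_le_mul_of_one_le_of_one_le hΔ hΔ
        exact one_le_mul_of_one_le_of_one_le (by exact_mod_cast hd) this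
      · intro i j
        calc |G i j| ≤ ∑ l, |A l i * A l j| := Finset.abs_sum_le_sum_abs _ _
          _ ≤ ∑ _l : m, Δ * Δ := by
              refine Finset.sum_le_sum fun l _ => ?_
              rw [abs_mul]
              exact mul_le_mul (hA _ _) (hA _ _) (abs_nonneg _) (by omega)
          _ = Fintype.card m * (Δ * Δ) := by simp
          _ ≤ _ := by
              have : (0 : ℤ) ≤ Δ * Δ := mul_nonneg (by omega) (by omega)
              gcongr
    intro j
    by_cases hjk : j = k
    · subst hjk; simpa [extendZero, hk] using hdet_le
    · by_cases hj : j ∈ L0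
      · simpa [extendZero, hj, hjk] using hw_le ⟨j, hj⟩
      · simp only [extendZero, hj, hjk, Pi.sub_apply, Pi.smul_apply, Pi.single_apply, if_false,
          dif_neg, not_false_iff, smul_zero, sub_zero, abs_zero]
        exact (abs_nonneg _).trans hdet_le

/-- Moving a solution along a bounded kernel vector, up to the first time that one of its large
coordinates stops being large. -/
lemma shrink_along_kernel (A : Matrix m n ℤ) (x y : n → ℤ) (M : ℤ) (hx : ∀ j, 0 ≤ x j)
    (hy0 : ∃ j, 0 < y j) (hyL : ∀ j, x j ≤ M → y j = 0) (hAy : A *ᵥ y = 0)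
    (hyM : ∀ j, |y j| ≤ M) :
    ∃ x' : n → ℤ, (∀ j, 0 ≤ x' j) ∧ A *ᵥ x' = A *ᵥ x ∧
      #{j | M < x' j} < #{j | M < x j} := by
  classical
  have hex : ∃ t : ℕ, ∃ j, M < x j ∧ x j - t * y j ≤ M := by
    obtain ⟨j, hj⟩ := hy0
    have hM : M < x j := by
      by_contra h
      have := hyL j (by omega)
      omega
    have hM0 : 0 ≤ M := (abs_nonneg _).trans (hyM j)
    refine ⟨(x j).toNat, j, hM, ?_⟩
    rw [Int.toNat_of_nonneg (hx j)]
    nlinarith [hx j]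
  set t := Nat.find hex with ht
  obtain ⟨j0, hj0, hj0'⟩ := Nat.find_spec hex
  rw [← ht] at hj0'
  have ht0 : t ≠ 0 := by
    intro h
    rw [h] at hj0'
    simp at hj0'
    omega
  have hprev : ∀ j, M < x j → M < x j - (t - 1 : ℤ) * y j := by
    intro j hj
    have := Nat.find_min hex (m := t - 1) (by omega)
    push Not at this
    have := this j hj
    rwa [Nat.cast_sub (by omega), Nat.cast_one] at this
  refine ⟨x - (t : ℤ) • y, fun j => ?_, by rw [mulVec_sub, mulVec_smul, hAy]; simp, ?_⟩
  · simp only [Pi.sub_apply, Pi.smul_apply, smul_eq_mul]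
    rcases le_or_gt (x j) M with h | h
    · rw [hyL j h]; simpa using hx j
    · have h1 := hprev j h
      have h2 := (abs_le.mp (hyM j)).2
      have : (t : ℤ) * y j = (t - 1 : ℤ) * y j + y j := by ring
      omega
  · refine Finset.card_lt_card ⟨fun j hj => ?_, fun h => ?_⟩
    · simp only [mem_filter, mem_univ, true_and, Pi.sub_apply, Pi.smul_apply, smul_eq_mul] at hj ⊢
      by_contra h
      rw [hyL j (by omega)] at hj
      omega
    · have := h (show j0 ∈ _ by simpa using hj0)
      simp only [mem_filter, mem_univ, true_and, Pi.sub_apply, Pi.smul_apply, smul_eq_mul] at this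
      omega

/-- If the large coordinates of a solution belong to independent columns, Cramer's rule bounds
them. -/
lemma le_of_colIndep_large (A : Matrix m n ℤ) (b : m → ℤ) (x : n → ℤ) (hx : ∀ j, 0 ≤ x j)
    (hAx : A *ᵥ x = b) {d : ℕ} {Δ M : ℤ} (hΔ : 1 ≤ Δ) (hM : 0 ≤ M) (hm : Fintype.card m ≤ d)
    (hd : 1 ≤ d) (hA : ∀ i j, |A i j| ≤ Δ) (hb : ∀ i, |b i| ≤ Δ)
    (hind : ColIndep A {j | M < x j}) (j : n) :
    x j ≤ max M ((d * (d * (Δ * (Δ + Fintype.card n * (Δ * M))))) ^ d) := by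
  classical
  rcases le_or_gt (x j) M with h | h
  · exact le_max_of_le_left h
  refine le_max_of_le_right ?_
  set L : Finset n := {j | M < x j} with hL
  let xL : n → ℤ := fun j => if M < x j then x j else 0
  let xS : n → ℤ := fun j => if M < x j then 0 else x j
  have hsum : x = xL + xS := by
    ext j; by_cases hj : M < x j <;> simp [xL, xS, hj]
  set b' := b - A *ᵥ xS with hb'
  have h1 : cols A L *ᵥ (fun j : L => xL j) = b' := by
    rw [← mulVec_of_support A L xL (fun j hj => by
      simp only [hL, mem_filter, mem_univ, true_and] at hj; simp [xL, hj])]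
    rw [hb', ← hAx]
    conv_rhs => rw [hsum, mulVec_add]
    simp
  set B := cols A L with hB
  set G := Bᵀ * B with hG
  have hdet : G.det ≠ 0 := hind.gram_det_ne_zero
  have h2 : G *ᵥ (fun j : L => xL j) = Bᵀ *ᵥ b' := by
    rw [hG, ← mulVec_mulVec, h1]
  have h3 : G.det • (fun j : L => xL j) = cramer G (Bᵀ *ᵥ b') := by
    rw [cramer_eq_adjugate_mulVec, ← h2, mulVec_mulVec, adjugate_mul, smul_mulVec, one_mulVec]
  have hb'_le : ∀ i, |b' i| ≤ Δ + Fintype.card n * (Δ * M) := by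
    intro i
    have h4 : |(A *ᵥ xS) i| ≤ Fintype.card n * (Δ * M) := by
      calc |(A *ᵥ xS) i| ≤ ∑ j, |A i j * xS j| := Finset.abs_sum_le_sum_abs _ _
        _ ≤ ∑ _j : n, Δ * M := by
            refine Finset.sum_le_sum fun k _ => ?_
            rw [abs_mul]
            refine mul_le_mul (hA _ _) ?_ (abs_nonneg _) (by omega)
            by_cases hk : M < x k
            · simp [xS, hk, hM]
            · simp only [xS, hk, if_false]
              rw [abs_of_nonneg (hx k)]; omega
        _ = _ := by simp
    calc |b' i| ≤ |b i| + |(A *ᵥ xS) i| := abs_sub _ _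
      _ ≤ _ := add_le_add (hb i) h4
  have h5 := congrFun h3 ⟨j, by simpa [hL] using h⟩
  have hc := abs_cramer_gram_le A L b' hΔ
    (show Δ ≤ Δ + Fintype.card n * (Δ * M) by
      have : 0 ≤ (Fintype.card n : ℤ) * (Δ * M) :=
        mul_nonneg (by positivity) (mul_nonneg (by omega) hM)
      omega) (hind.card_le.trans hm) hm hd hA hb'_le ⟨j, by simpa [hL] using h⟩
  rw [← hB, ← hG, ← h5] at hc
  simp only [Pi.smul_apply, smul_eq_mul, xL, h, if_true, abs_mul] at hc
  refine le_trans ?_ hc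
  calc x j ≤ |x j| := le_abs_self _
    _ = 1 * |x j| := (one_mul _).symm
    _ ≤ |G.det| * |x j| := by
        gcongr
        exact Int.one_le_abs hdet

/-- **Small solutions of linear systems over the natural numbers.** The number of unknowns and
the coefficients may be exponential in the parameter `P`; only the number of equations has to be
at most `P`. A solution with the least number of large coordinates has these at independent
columns. -/
theorem exists_small_nonneg_solution (A : Matrix m n ℤ) (b : m → ℤ) (x : n → ℤ)
    (hx : ∀ j, 0 ≤ x j) (hAx : A *ᵥ x = b) (P : ℕ) (hP : 1 ≤ P) (hm : Fintype.card m ≤ P)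
    (hn : Fintype.card n ≤ 2 ^ P) (hA : ∀ i j, |A i j| ≤ 2 ^ P) (hb : ∀ i, |b i| ≤ 2 ^ P) :
    ∃ y : n → ℤ, (∀ j, 0 ≤ y j) ∧ A *ᵥ y = b ∧ ∀ j, y j ≤ 2 ^ (12 * P ^ 3) := by
  classical
  have hΔ : (1 : ℤ) ≤ 2 ^ P := one_le_pow₀ (by norm_num)
  set M : ℤ := (P * (P * (2 ^ P * 2 ^ P))) ^ P with hM
  have hM0 : 0 ≤ M := by positivity
  let sols : Set (n → ℤ) := {y | (∀ j, 0 ≤ y j) ∧ A *ᵥ y = b}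
  obtain ⟨y, ⟨hy, hAy⟩, hmin⟩ := WellFounded.has_min
    (InvImage.wf (fun y : n → ℤ => #{j | M < y j}) Nat.lt_wfRel.wf) sols ⟨x, hx, hAx⟩
  have hind : ColIndep A {j | M < y j} := by
    by_contra hdep
    obtain ⟨z, hz0, hzL, hAz, hzM⟩ := exists_small_kernel A _ hdep hΔ hm hP hA
    have hzL' : ∀ j, y j ≤ M → z j = 0 := fun j hj => hzL j (by simp; omega)
    obtain ⟨j, hj⟩ := Function.ne_iff.mp hz0
    rcases lt_or_gt_of_ne hj with hneg | hpos
    · obtain ⟨x', h1, h2, h3⟩ := shrink_along_kernel A y (-z) M hy ⟨j, by simpa using hneg⟩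
        (fun j hj => by simp [hzL' j hj]) (by rw [mulVec_neg, hAz, neg_zero])
        (fun j => by simpa using hzM j)
      exact hmin x' ⟨h1, h2.trans hAy⟩ h3
    · obtain ⟨x', h1, h2, h3⟩ := shrink_along_kernel A y z M hy ⟨j, hpos⟩ hzL' hAz hzM
      exact hmin x' ⟨h1, h2.trans hAy⟩ h3
  refine ⟨y, hy, hAy, fun j =>
    (le_of_colIndep_large A b y hy hAy hΔ hM0 hm hP hA hb hind j).trans ?_⟩
  have hP2 : (P : ℤ) ≤ 2 ^ P := by exact_mod_cast (Nat.lt_two_pow_self).le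
  have hP1 : P ≤ P ^ 2 := Nat.le_self_pow (by norm_num) P
  have hP3 : P ^ 2 ≤ P ^ 3 := Nat.pow_le_pow_right hP (by norm_num)
  have hM_le : M ≤ 2 ^ (4 * P ^ 2) := by
    calc M ≤ (2 ^ P * (2 ^ P * (2 ^ P * 2 ^ P))) ^ P := by rw [hM]; gcongr
      _ = 2 ^ (4 * P ^ 2) := by rw [← pow_add, ← pow_add, ← pow_add, ← pow_mul]; congr 1; ring
  refine max_le (hM_le.trans (pow_le_pow_right₀ (by norm_num) (by omega))) ?_
  have hn' : (Fintype.card n : ℤ) ≤ 2 ^ P := by exact_mod_cast hn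
  have h1 : (2 : ℤ) ^ P + Fintype.card n * (2 ^ P * M) ≤ 2 ^ (7 * P ^ 2) := by
    calc (2 : ℤ) ^ P + Fintype.card n * (2 ^ P * M)
        ≤ 2 ^ P + 2 ^ P * (2 ^ P * 2 ^ (4 * P ^ 2)) := by gcongr
      _ ≤ 2 ^ (6 * P ^ 2) + 2 ^ (6 * P ^ 2) := by
          rw [← pow_add, ← pow_add]
          gcongr <;> omega
      _ = 2 ^ (6 * P ^ 2 + 1) := by ring
      _ ≤ _ := pow_le_pow_right₀ (by norm_num) (by nlinarith)
  calc ((P : ℤ) * (P * (2 ^ P * (2 ^ P + Fintype.card n * (2 ^ P * M))))) ^ P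
      ≤ (2 ^ P * (2 ^ P * (2 ^ P * 2 ^ (7 * P ^ 2)))) ^ P := by gcongr
    _ = 2 ^ ((3 * P + 7 * P ^ 2) * P) := by
        rw [← pow_add, ← pow_add, ← pow_add, ← pow_mul]; congr 1; ring
    _ ≤ _ := pow_le_pow_right₀ (by norm_num) (by nlinarith)

/-- The same for systems of equations and inequalities in integer unknowns, indexed by `I`, and
natural unknowns, indexed by `J`. -/
theorem exists_small_mixed_solution {I J R Q : Type*} [Fintype I] [Fintype J] [Fintype R]
    [Fintype Q] (A : R → I → ℤ) (A' : R → J → ℤ) (b : R → ℤ) (G : Q → I → ℤ) (h : Q → ℤ)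
    (y : I → ℤ) (x : J → ℤ) (hx : ∀ j, 0 ≤ x j) (hA : ∀ r, A r ⬝ᵥ y + A' r ⬝ᵥ x = b r)
    (hG : ∀ q, h q ≤ G q ⬝ᵥ y) (P : ℕ) (hP : 1 ≤ P)
    (hrows : Fintype.card R + Fintype.card Q ≤ P)
    (hcols : 2 * Fintype.card I + Fintype.card J + Fintype.card Q ≤ 2 ^ P)
    (hAP : ∀ r i, |A r i| ≤ 2 ^ P) (hA'P : ∀ r j, |A' r j| ≤ 2 ^ P) (hbP : ∀ r, |b r| ≤ 2 ^ P)
    (hGP : ∀ q i, |G q i| ≤ 2 ^ P) (hhP : ∀ q, |h q| ≤ 2 ^ P) :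
    ∃ (y' : I → ℤ) (x' : J → ℤ), (∀ j, 0 ≤ x' j) ∧ (∀ r, A r ⬝ᵥ y' + A' r ⬝ᵥ x' = b r) ∧
      (∀ q, h q ≤ G q ⬝ᵥ y') ∧ ∀ i, |y' i| ≤ 2 ^ (12 * P ^ 3) := by
  classical
  let rowR : R → (I ⊕ I) ⊕ (J ⊕ Q) → ℤ := fun r =>
    Sum.elim (Sum.elim (A r) (-A r)) (Sum.elim (A' r) 0)
  let rowQ : Q → (I ⊕ I) ⊕ (J ⊕ Q) → ℤ := fun q =>
    Sum.elim (Sum.elim (G q) (-G q)) (Sum.elim 0 (-Pi.single q 1))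
  let AA : Matrix (R ⊕ Q) ((I ⊕ I) ⊕ (J ⊕ Q)) ℤ := Sum.elim rowR rowQ
  have hAA1 : ∀ (z : (I ⊕ I) ⊕ (J ⊕ Q) → ℤ) (r : R), (AA *ᵥ z) (Sum.inl r) =
      A r ⬝ᵥ (fun i => z (.inl (.inl i)) - z (.inl (.inr i))) +
        A' r ⬝ᵥ fun j => z (.inr (.inl j)) := by
    intro z r
    simp only [mulVec, dotProduct, AA, Sum.elim_inl, rowR, Fintype.sum_sum_type, Sum.elim_inr,
      Pi.neg_apply, Pi.zero_apply, zero_mul, Finset.sum_const_zero, add_zero, mul_sub,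
      Finset.sum_sub_distrib, neg_mul, Finset.sum_neg_distrib]
    ring
  have hAA2 : ∀ (z : (I ⊕ I) ⊕ (J ⊕ Q) → ℤ) (q : Q), (AA *ᵥ z) (Sum.inr q) =
      G q ⬝ᵥ (fun i => z (.inl (.inl i)) - z (.inl (.inr i))) - z (.inr (.inr q)) := by
    intro z q
    simp only [mulVec, dotProduct, AA, Sum.elim_inl, rowQ, Fintype.sum_sum_type, Sum.elim_inr,
      Pi.neg_apply, Pi.zero_apply, zero_mul, Finset.sum_const_zero, zero_add, mul_sub,
      Finset.sum_sub_distrib, neg_mul, Finset.sum_neg_distrib, Pi.single_apply, ite_mul, one_mul,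
      Finset.sum_ite_eq', Finset.mem_univ, if_true]
    ring
  let x0 : (I ⊕ I) ⊕ (J ⊕ Q) → ℤ := Sum.elim (Sum.elim (fun i => max (y i) 0)
    fun i => max (-y i) 0) (Sum.elim x fun q => G q ⬝ᵥ y - h q)
  have hmax : (fun i => max (y i) 0 - max (-y i) 0) = y := by
    ext i
    rcases le_total 0 (y i) with h | h
    · rw [max_eq_left h, max_eq_right (by omega)]; omega
    · rw [max_eq_right h, max_eq_left (by omega)]; omega
  have h2P : (1 : ℤ) ≤ 2 ^ P := one_le_pow₀ (by norm_num)
  have h0 : ∀ j, 0 ≤ x0 j := by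
    rintro ((i | i) | (j | q))
    · exact le_max_right _ _
    · exact le_max_right _ _
    · exact hx j
    · simpa [x0] using hG q
  have h1 : AA *ᵥ x0 = Sum.elim b h := by
    ext (r | q)
    · rw [hAA1]
      simp only [x0, Sum.elim_inl, Sum.elim_inr]
      rw [hmax, hA r]
    · rw [hAA2]
      simp only [x0, Sum.elim_inl, Sum.elim_inr]
      rw [hmax]; ring
  have h2 : ∀ i j, |AA i j| ≤ 2 ^ P := by
    rintro (r | q) ((i | i) | (j | q'))
    · exact hAP r i
    · simpa [AA, rowR] using hAP r i
    · exact hA'P r j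
    · simp [AA, rowR]
    · exact hGP q i
    · simpa [AA, rowQ] using hGP q i
    · simp [AA, rowQ]
    · simp only [AA, rowQ, Sum.elim_inr, Pi.neg_apply, abs_neg, Pi.single_apply]
      split_ifs <;> simp; exact h2P
  have h3 : ∀ i, |(Sum.elim b h : R ⊕ Q → ℤ) i| ≤ 2 ^ P := by
    rintro (r | q)
    · exact hbP r
    · exact hhP q
  obtain ⟨z, hz, hAz, hzb⟩ := exists_small_nonneg_solution AA (Sum.elim b h) x0 h0 h1 P hP
    (by simpa using hrows) (by simp only [Fintype.card_sum]; omega) h2 h3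
  refine ⟨fun i => z (.inl (.inl i)) - z (.inl (.inr i)), fun j => z (.inr (.inl j)),
    fun j => hz _, fun r => ?_, fun q => ?_, fun i => ?_⟩
  · rw [← hAA1, hAz]; rfl
  · have := hAA2 z q
    rw [hAz] at this
    have h0 := hz (.inr (.inr q))
    simp only [Sum.elim_inr] at this
    omega
  · have h1 := hz (.inl (.inl i))
    have h2 := hz (.inl (.inr i))
    have h3 := hzb (.inl (.inl i))
    have h4 := hzb (.inl (.inr i))
    rw [abs_le]
    dsimp only
    constructor <;> omega

end SmallSolutions

end AFL

/-! ### Walks and pumping -/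

namespace AFL

open Finset

section Walks

variable {X κ : Type*} {S : ℕ → X}

/-- `Walk S x l y`: the list `l` of times is a walk from `x` to `y`, where the time `i` is an edge
from `S i` to `S (i + 1)`. -/
def Walk (S : ℕ → X) : X → List ℕ → X → Prop
  | x, [], y => x = y
  | x, i :: l, y => S i = x ∧ Walk S (S (i + 1)) l y

lemma walk_append {x z : X} {l₁ l₂ : List ℕ} :
    Walk S x (l₁ ++ l₂) z ↔ ∃ y, Walk S x l₁ y ∧ Walk S y l₂ z := by
  induction l₁ generalizing x with
  | nil => simp [Walk]
  | cons i l ih => simp [Walk, ih, and_assoc]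

lemma walk_range' (p k : ℕ) : Walk S (S p) (List.range' p k) (S (p + k)) := by
  induction k generalizing p with
  | zero => simp [Walk]
  | succ k ih =>
    rw [List.range'_succ]
    refine ⟨rfl, ?_⟩
    have := ih (p + 1)
    rwa [show p + (k + 1) = p + 1 + k by ring]

/-- A walk that is at least as long as the number of available vertices contains a closed walk. -/
lemma Walk.exists_closed [DecidableEq X] {x y : X} {l : List ℕ} (hl : Walk S x l y) (T : Finset X)
    (hx : x ∈ T) (hT : ∀ i ∈ l, S (i + 1) ∈ T) (hcard : #T ≤ l.length) :
    ∃ l₁ l₂ l₃ z, l = l₁ ++ l₂ ++ l₃ ∧ l₂ ≠ [] ∧ Walk S x l₁ z ∧ Walk S z l₂ z ∧ Walk S z l₃ y := by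
  induction l generalizing x T with
  | nil => exact absurd hx (by simp_all)
  | cons i l ih =>
    obtain ⟨hi, hl⟩ := hl
    by_cases hrev : ∃ k ∈ i :: l, S (k + 1) = x
    · obtain ⟨k, hk, hkx⟩ := hrev
      obtain ⟨l₁, l₂, h⟩ := List.append_of_mem hk
      have hw : Walk S x (l₁ ++ k :: l₂) y := by rw [← h]; exact ⟨hi, hl⟩
      obtain ⟨z, hz1, hz2, hz3⟩ := walk_append.mp hw
      refine ⟨[], l₁ ++ [k], l₂, x, by simp [h], by simp, rfl, ?_, hkx ▸ hz3⟩
      exact walk_append.mpr ⟨z, hz1, hz2, hkx⟩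
    · push Not at hrev
      obtain ⟨l₁, l₂, l₃, z, h1, h2, h3, h4, h5⟩ := ih hl (T.erase x)
        (Finset.mem_erase.mpr ⟨hrev i (by simp), hT i (by simp)⟩)
        (fun k hk => Finset.mem_erase.mpr ⟨hrev k (by simp [hk]), hT k (by simp [hk])⟩)
        (by rw [Finset.card_erase_of_mem hx]; simp at hcard; omega)
      exact ⟨i :: l₁, l₂, l₃, z, by simp [h1], h2, ⟨hi, h3⟩, h4, h5⟩

/-- The vector `v` is the total effect of a short closed walk at a vertex in `T` that uses times
in `D` only. -/
def IsCycleEffect (S : ℕ → X) (δ : ℕ → κ → ℤ) (D : Set ℕ) (n : ℕ) (T : Set X) (v : κ → ℤ) : Prop :=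
  ∃ z ∈ T, ∃ l, Walk S z l z ∧ (∀ i ∈ l, i ∈ D) ∧ l.length ≤ n ∧ (l.map δ).sum = v

lemma IsCycleEffect.mono {δ : ℕ → κ → ℤ} {D : Set ℕ} {n : ℕ} {T T' : Set X} {v : κ → ℤ}
    (h : IsCycleEffect S δ D n T v) (hT : T ⊆ T') : IsCycleEffect S δ D n T' v := by
  obtain ⟨z, hz, h⟩ := h
  exact ⟨z, hT hz, h⟩

/-- Loop erasure: a walk splits into a short walk and short closed walks. -/
lemma Walk.loop_erase [DecidableEq X] (δ : ℕ → κ → ℤ) (D : Set ℕ) (T : Finset X) {x y : X}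
    {l : List ℕ} (hl : Walk S x l y) (hD : ∀ i ∈ l, i ∈ D) (hx : x ∈ T)
    (hT : ∀ i ∈ l, S (i + 1) ∈ T) :
    ∃ (l₀ : List ℕ) (M : Multiset (κ → ℤ)), Walk S x l₀ y ∧ (∀ i ∈ l₀, i ∈ D) ∧ l₀.length ≤ #T ∧
      (∀ v ∈ M, IsCycleEffect S δ D #T T v) ∧ (l.map δ).sum = (l₀.map δ).sum + M.sum := by
  induction hn : l.length using Nat.strong_induction_on generalizing l with
  | _ n ih =>
  by_cases hlen : l.length ≤ #T
  · exact ⟨l, 0, hl, hD, hlen, by simp, by simp⟩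
  · have hsplit : Walk S x (l.take #T ++ l.drop #T) y := by rwa [List.take_append_drop]
    obtain ⟨w, hw1, hw2⟩ := walk_append.mp hsplit
    obtain ⟨l₁, l₂, l₃, z, h1, h2, h3, h4, h5⟩ := hw1.exists_closed T hx
      (fun i hi => hT i (List.mem_of_mem_take hi)) (by simp; omega)
    have hl' : l = l₁ ++ l₂ ++ l₃ ++ l.drop #T := by rw [← h1, List.take_append_drop]
    have hmem : ∀ i, i ∈ l₁ ++ l₂ ++ l₃ ++ l.drop #T → i ∈ l := fun i hi => hl' ▸ hi
    have hl2 : l₂.length ≤ #T := by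
      have := congrArg List.length h1
      simp at this
      omega
    have hzT : z ∈ T := by
      rcases List.eq_nil_or_concat l₁ with h | ⟨l', a, h⟩
      · subst h; exact h3 ▸ hx
      · subst h
        rw [List.concat_eq_append] at h3 hmem
        obtain ⟨u, _, _, h⟩ := walk_append.mp h3
        exact h ▸ hT a (hmem a (by simp))
    obtain ⟨l₀, M, hM1, hM2, hM3, hM4, hM5⟩ := ih (l₁ ++ (l₃ ++ l.drop #T)).length (by
        have h6 := congrArg List.length hl'
        have h7 := List.length_pos_of_ne_nil h2
        simp only [List.length_append] at h6 ⊢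
        omega)
      (walk_append.mpr ⟨z, h3, walk_append.mpr ⟨w, h5, hw2⟩⟩)
      (fun i hi => hD i (hmem i (by simp at hi ⊢; tauto)))
      (fun i hi => hT i (hmem i (by simp at hi ⊢; tauto))) rfl
    refine ⟨l₀, (l₂.map δ).sum ::ₘ M, hM1, hM2, hM3, fun v hv => ?_, ?_⟩
    · rcases Multiset.mem_cons.mp hv with rfl | hv
      · exact ⟨z, hzT, l₂, h4, fun i hi => hD i (hmem i (by simp [hi])), hl2, rfl⟩
      · exact hM4 v hv
    · conv_lhs => rw [hl']
      rw [Multiset.sum_cons]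
      simp only [List.map_append, List.sum_append] at hM5 ⊢
      rw [add_left_comm, ← hM5]
      abel

/-- A walk splits into a walk of quadratic length and short closed walks at its vertices. Every
time a vertex outside of the set `U` of the vertices seen so far is entered, the walk up to there
is loop-erased; this happens at most once for each vertex. -/
lemma Walk.exists_base [DecidableEq X] (δ : ℕ → κ → ℤ) (D : Set ℕ) (T : Finset X) (k : ℕ)
    (U : Finset X) (hU : U ⊆ T) (hk : #T ≤ #U + k) {x y : X}
    {l : List ℕ} (hl : Walk S x l y) (hD : ∀ i ∈ l, i ∈ D) (hx : x ∈ U)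
    (hT : ∀ i ∈ l, S (i + 1) ∈ T) :
    ∃ (l₀ : List ℕ) (M : Multiset (κ → ℤ)), Walk S x l₀ y ∧ (∀ i ∈ l₀, i ∈ D) ∧
      l₀.length ≤ (#T + 1) * (k + 1) ∧
      (∀ v ∈ M, IsCycleEffect S δ D #T (U ∪ {z | ∃ i ∈ l₀, S (i + 1) = z}) v) ∧
      (l.map δ).sum = (l₀.map δ).sum + M.sum := by
  induction k generalizing U x l with
  | zero =>
    have hUT : U = T := Finset.eq_of_subset_of_card_le hU (by omega)
    subst hUT
    obtain ⟨l₀, M, h1, h2, h3, h4, h5⟩ := hl.loop_erase δ D U hD hx hT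
    exact ⟨l₀, M, h1, h2, by omega, fun v hv => (h4 v hv).mono (by simp), h5⟩
  | succ k ih =>
    by_cases hnew : ∃ i ∈ l, S (i + 1) ∉ U
    · -- Split at the first step that leaves `U`.
      obtain ⟨l₁, i, l₂, rfl, hl₁, hi⟩ : ∃ l₁ i l₂, l = l₁ ++ i :: l₂ ∧ (∀ j ∈ l₁, S (j + 1) ∈ U) ∧
          S (i + 1) ∉ U := by
        clear hl hD hT
        induction l with
        | nil => simp at hnew
        | cons a l ih' =>
          by_cases ha : S (a + 1) ∈ U
          · obtain ⟨l₁, i, l₂, h1, h2, h3⟩ := ih' (by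
              obtain ⟨i, hi, hi'⟩ := hnew
              rcases List.mem_cons.mp hi with rfl | hi
              · exact absurd ha hi'
              · exact ⟨i, hi, hi'⟩)
            exact ⟨a :: l₁, i, l₂, by simp [h1], by simpa [ha] using h2, h3⟩
          · exact ⟨[], a, l, rfl, by simp, ha⟩
      obtain ⟨z, hz, hiz, hl₂⟩ := walk_append.mp hl
      obtain ⟨a, M, a1, a2, a3, a4, a5⟩ := hz.loop_erase δ D U
        (fun j hj => hD j (by simp [hj])) hx hl₁
      have hiT := hT i (by simp)
      obtain ⟨b, M', b1, b2, b3, b4, b5⟩ := ih (insert (S (i + 1)) U)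
        (Finset.insert_subset hiT hU)
        (by rw [Finset.card_insert_of_notMem hi]; omega) hl₂ (fun j hj => hD j (by simp [hj]))
        (by simp) (fun j hj => hT j (by simp [hj]))
      refine ⟨a ++ i :: b, M + M', walk_append.mpr ⟨z, a1, hiz, b1⟩, ?_, ?_, ?_, ?_⟩
      · intro j hj
        simp only [List.mem_append, List.mem_cons] at hj
        rcases hj with hj | rfl | hj
        · exact a2 j hj
        · exact hD j (by simp)
        · exact b2 j hj
      · have := Finset.card_le_card hU
        simp only [List.length_append, List.length_cons]
        nlinarith
      · intro v hv
        rcases Multiset.mem_add.mp hv with hv | hv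
        · obtain ⟨w, hw, l, h1, h2, h3, h4⟩ := a4 v hv
          exact ⟨w, Or.inl hw, l, h1, h2, h3.trans (Finset.card_le_card hU), h4⟩
        · refine (b4 v hv).mono ?_
          rintro w (hw | ⟨j, hj, rfl⟩)
          · rcases Finset.mem_insert.mp hw with rfl | hw
            · exact Or.inr ⟨i, by simp, rfl⟩
            · exact Or.inl hw
          · exact Or.inr ⟨j, by simp [hj], rfl⟩
      · simp only [List.map_append, List.map_cons, List.sum_append, List.sum_cons, a5, b5,
          Multiset.sum_add]
        abel
    · push Not at hnew
      obtain ⟨l₀, M, h1, h2, h3, h4, h5⟩ := hl.loop_erase δ D U hD hx hnew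
      refine ⟨l₀, M, h1, h2, ?_, fun v hv => ?_, h5⟩
      · have := Finset.card_le_card hU
        nlinarith
      · obtain ⟨w, hw, l, h1, h2, h3, h4⟩ := h4 v hv
        exact ⟨w, Or.inl hw, l, h1, h2, h3.trans (Finset.card_le_card hU), h4⟩

/-- Closed walks at vertices of a walk can be inserted into it. -/
lemma Walk.insert_cycles {δ : ℕ → κ → ℤ} {D : Set ℕ} {n : ℕ} {x y : X} {l : List ℕ}
    (hl : Walk S x l y) (hD : ∀ i ∈ l, i ∈ D) (M : Multiset (κ → ℤ))
    (hM : ∀ v ∈ M, IsCycleEffect S δ D n ({x} ∪ {z | ∃ i ∈ l, S (i + 1) = z}) v) :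
    ∃ l', Walk S x l' y ∧ (∀ i ∈ l', i ∈ D) ∧ (l'.map δ).sum = (l.map δ).sum + M.sum := by
  induction M using Multiset.induction generalizing l with
  | empty => exact ⟨l, hl, hD, by simp⟩
  | cons v M ih =>
    obtain ⟨z, hz, c, hc1, hc2, -, rfl⟩ := hM v (by simp)
    obtain ⟨l₁, l₂, rfl, h1, h2⟩ : ∃ l₁ l₂, l = l₁ ++ l₂ ∧ Walk S x l₁ z ∧ Walk S z l₂ y := by
      rcases hz with rfl | ⟨i, hi, rfl⟩
      · exact ⟨[], l, rfl, rfl, hl⟩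
      · obtain ⟨l₁, l₂, h⟩ := List.append_of_mem hi
        rw [h] at hl
        obtain ⟨w, h1, h2, h3⟩ := walk_append.mp hl
        exact ⟨l₁ ++ [i], l₂, by simp [h], walk_append.mpr ⟨w, h1, h2, rfl⟩, h3⟩
    obtain ⟨l', h3, h4, h5⟩ := ih (l := l₁ ++ (c ++ l₂))
      (walk_append.mpr ⟨z, h1, walk_append.mpr ⟨z, hc1, h2⟩⟩)
      (fun i hi => by
        simp only [List.mem_append] at hi
        rcases hi with hi | hi | hi
        · exact hD i (by simp [hi])
        · exact hc2 i hi
        · exact hD i (by simp [hi]))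
      (fun v hv => (hM v (by simp [hv])).mono (by
        rintro w (hw | ⟨i, hi, rfl⟩)
        · exact Or.inl hw
        · refine Or.inr ⟨i, ?_, rfl⟩
          simp only [List.mem_append] at hi ⊢
          tauto))
    refine ⟨l', h3, h4, ?_⟩
    rw [h5, Multiset.sum_cons]
    simp only [List.map_append, List.sum_append]
    abel

lemma abs_sum_effect_le {δ : ℕ → κ → ℤ} {Δ : ℤ} (k : κ) (l : List ℕ)
    (h : ∀ i ∈ l, |δ i k| ≤ Δ) : |(l.map δ).sum k| ≤ l.length * Δ := by
  induction l with
  | nil => simp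
  | cons i l ih =>
    have h1 := ih fun i hi => h i (by simp [hi])
    have h2 := h i (by simp)
    simp only [List.map_cons, List.sum_cons, Pi.add_apply, List.length_cons, Nat.cast_add,
      Nat.cast_one, add_mul, one_mul]
    exact (abs_add_le _ _).trans (by omega)

/-- **Pumping.** The effect of a run through finitely many states is a small vector plus a
nonnegative combination of small vectors, and every other combination of these vectors is the
effect of another walk with the same end points. -/
theorem exists_pumping (δ : ℕ → κ → ℤ) (T : Finset X) (p q : ℕ) (hpq : p ≤ q)
    (hT : ∀ i, p ≤ i → i ≤ q → S i ∈ T) (Δ : ℤ) (hΔ : 0 ≤ Δ)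
    (hδ : ∀ i, p ≤ i → i < q → ∀ k, |δ i k| ≤ Δ) :
    ∃ (base : κ → ℤ) (C : Finset (κ → ℤ)) (m : (κ → ℤ) → ℕ),
      (∀ k, |base k| ≤ (#T + 1) * (#T + 1) * Δ) ∧ (∀ v ∈ C, ∀ k, |v k| ≤ #T * Δ) ∧
      ∑ i ∈ Ico p q, δ i = base + ∑ v ∈ C, m v • v ∧
      ∀ m' : (κ → ℤ) → ℕ, ∃ l, Walk S (S p) l (S q) ∧ (∀ i ∈ l, p ≤ i ∧ i < q) ∧
        (l.map δ).sum = base + ∑ v ∈ C, m' v • v := by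
  classical
  have hp : S p ∈ T := hT p le_rfl hpq
  have hw := walk_range' (S := S) p (q - p)
  rw [Nat.add_sub_cancel' hpq] at hw
  have hmem : ∀ i, i ∈ List.range' p (q - p) ↔ p ≤ i ∧ i < q := by
    intro i; rw [List.mem_range'_1]; omega
  obtain ⟨l₀, M, h1, h2, h3, h4, h5⟩ := hw.exists_base δ {i | p ≤ i ∧ i < q} T (#T) {S p}
    (by simpa using hp) (by simp) (fun i hi => (hmem i).mp hi) (by simp)
    (fun i hi => hT _ (by have := (hmem i).mp hi; omega) (by have := (hmem i).mp hi; omega))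
  refine ⟨(l₀.map δ).sum, M.toFinset, fun v => M.count v, fun k => ?_, fun v hv k => ?_, ?_, ?_⟩
  · refine (abs_sum_effect_le k l₀ fun i hi => hδ i (h2 i hi).1 (h2 i hi).2 k).trans ?_
    exact mul_le_mul_of_nonneg_right (by exact_mod_cast h3) hΔ
  · obtain ⟨z, -, l, -, hl1, hl2, rfl⟩ := h4 v (by simpa using hv)
    refine (abs_sum_effect_le k l fun i hi => hδ i (hl1 i hi).1 (hl1 i hi).2 k).trans ?_
    exact mul_le_mul_of_nonneg_right (by exact_mod_cast hl2) hΔ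
  · rw [← Finset.sum_multiset_count, ← h5, Finset.sum_eq_multiset_sum]
    congr 1
  · intro m'
    obtain ⟨l, hl1, hl2, hl3⟩ := h1.insert_cycles h2 (∑ v ∈ M.toFinset, Multiset.replicate (m' v) v)
      (fun v hv => (h4 v (by
        obtain ⟨w, hw, hv⟩ := Multiset.mem_sum.mp hv
        rw [Multiset.eq_of_mem_replicate hv]
        simpa using hw)).mono (by simp))
    refine ⟨l, hl1, hl2, ?_⟩
    rw [hl3, Multiset.sum_sum]
    simp [Multiset.sum_replicate]

end Walks

end AFL

/-! ### Warps of a timeline -/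

namespace AFL

open Finset

section Warp

/-- The times at which the timeline `0, …, N` is cut: the letter at each time in `E` becomes a
segment of its own. -/
def cuts (N : ℕ) (E : Finset ℕ) : Finset ℕ := {0, N} ∪ E ∪ E.image (· + 1)

lemma zero_mem_cuts (N : ℕ) (E : Finset ℕ) : 0 ∈ cuts N E := by simp [cuts]

lemma self_mem_cuts (N : ℕ) (E : Finset ℕ) : N ∈ cuts N E := by simp [cuts]

lemma mem_cuts_of_mem {N : ℕ} {E : Finset ℕ} {i : ℕ} (h : i ∈ E) : i ∈ cuts N E := by
  simp [cuts, h]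

lemma succ_mem_cuts_of_mem {N : ℕ} {E : Finset ℕ} {i : ℕ} (h : i ∈ E) : i + 1 ∈ cuts N E := by
  simp [cuts, h]

lemma le_of_mem_cuts {N : ℕ} {E : Finset ℕ} (hE : ∀ i ∈ E, i < N) {p : ℕ} (hp : p ∈ cuts N E) :
    p ≤ N := by
  simp only [cuts, mem_union, mem_insert, mem_singleton, mem_image] at hp
  rcases hp with ((rfl | rfl) | h) | ⟨i, h, rfl⟩
  · exact Nat.zero_le _
  · exact le_rfl
  · exact (hE p h).le
  · exact hE i h

lemma card_cuts_le (N : ℕ) (E : Finset ℕ) : #(cuts N E) ≤ 2 * #E + 2 := by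
  have h1 := card_union_le ({0, N} ∪ E) (E.image (· + 1))
  have h2 := card_union_le {0, N} E
  have h3 : #(E.image (· + 1)) ≤ #E := card_image_le
  have h4 : #({0, N} : Finset ℕ) ≤ 2 := card_le_two
  unfold cuts
  omega

/-- `p` and `q` are consecutive elements of `K`. -/
def Consec (K : Finset ℕ) (p q : ℕ) : Prop :=
  p ∈ K ∧ q ∈ K ∧ p < q ∧ ∀ r ∈ K, r ≤ p ∨ q ≤ r

lemma exists_consec_right {K : Finset ℕ} {N p : ℕ} (hN : N ∈ K) (hp : p ∈ K) (h : p < N) :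
    ∃ q, Consec K p q := by
  have hne : (K.filter (p < ·)).Nonempty := ⟨N, by simp [hN, h]⟩
  have hmem := (K.filter (p < ·)).min'_mem hne
  simp only [mem_filter] at hmem
  refine ⟨_, hp, hmem.1, hmem.2, fun r hr => ?_⟩
  by_contra! hc
  exact absurd ((K.filter (p < ·)).min'_le r (by simp [hr, hc.1])) (by omega)

lemma exists_consec_left {K : Finset ℕ} {q : ℕ} (h0 : 0 ∈ K) (hq : q ∈ K) (h : 0 < q) :
    ∃ p, Consec K p q := by
  have hne : (K.filter (· < q)).Nonempty := ⟨0, by simp [h0, h]⟩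
  have hmem := (K.filter (· < q)).max'_mem hne
  simp only [mem_filter] at hmem
  refine ⟨_, hmem.1, hq, hmem.2, fun r hr => ?_⟩
  by_contra! hc
  exact absurd ((K.filter (· < q)).le_max' r (by simp [hr, hc.2])) (by omega)

/-- Every time before `N` lies between two consecutive elements of `K`. -/
lemma exists_consec_of_lt {K : Finset ℕ} {N i : ℕ} (h0 : 0 ∈ K) (hN : N ∈ K) (h : i < N) :
    ∃ p q, Consec K p q ∧ p ≤ i ∧ i < q := by
  have hne : (K.filter (· ≤ i)).Nonempty := ⟨0, by simp [h0]⟩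
  have hmem := (K.filter (· ≤ i)).max'_mem hne
  simp only [mem_filter] at hmem
  obtain ⟨q, hq⟩ := exists_consec_right hN hmem.1 (by omega)
  refine ⟨_, q, hq, hmem.2, ?_⟩
  by_contra! hc
  have := (K.filter (· ≤ i)).le_max' q (by simp [hq.2.1, hc])
  have := hq.2.2.1
  omega

/-- An order embedding of a finite set of integers that keeps gaps of length at least two extends
to all integers such that comparisons with elements of the set are preserved. -/
lemma exists_extension (W : Finset ℤ) (θ : ℤ → ℤ) (B : ℤ)
    (hgap : ∀ u ∈ W, ∀ v ∈ W, u < v → min 2 (v - u) ≤ θ v - θ u) (hB : ∀ w ∈ W, |θ w| ≤ B)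
    (hB0 : 0 ≤ B) :
    ∃ g : ℤ → ℤ, (∀ w ∈ W, g w = θ w) ∧
      (∀ w ∈ W, ∀ e, (e < w → g e < g w) ∧ (w < e → g w < g e)) ∧ ∀ e, |g e| ≤ B + 1 := by
  classical
  -- An integer outside of `W` is sent to the successor of the image of the next smaller element
  -- of `W`; below all of `W`, the value `-(B + 1)` is used.
  let F : ℤ → Finset ℤ := fun e =>
    insert (-(B + 1)) ((W.filter (· ≤ e)).image fun w => θ w + min 1 (e - w))
  have hF : ∀ e, (F e).Nonempty := fun e => insert_nonempty _ _
  let g : ℤ → ℤ := fun e => (F e).max' (hF e)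
  have hcases : ∀ e, g e = -(B + 1) ∨ ∃ w ∈ W, w ≤ e ∧ g e = θ w + min 1 (e - w) := by
    intro e
    have := (F e).max'_mem (hF e)
    simp only [F, mem_insert, mem_image, mem_filter] at this
    rcases this with h | ⟨w, ⟨h1, h2⟩, h3⟩
    · exact Or.inl h
    · exact Or.inr ⟨w, h1, h2, h3.symm⟩
  have hle : ∀ e, ∀ w ∈ W, w ≤ e → θ w + min 1 (e - w) ≤ g e := fun e w hw hwe =>
    (F e).le_max' _ (by
      simp only [F, mem_insert, mem_image, mem_filter]
      exact Or.inr ⟨w, ⟨hw, hwe⟩, rfl⟩)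
  have hlow : ∀ e, -(B + 1) ≤ g e := fun e => (F e).le_max' _ (by simp [F])
  have hg : ∀ w ∈ W, g w = θ w := by
    intro w hw
    have h1 := hle w w hw le_rfl
    have hb := abs_le.mp (hB w hw)
    rcases hcases w with h | ⟨u, hu, huw, h⟩
    · omega
    · rcases huw.eq_or_lt with rfl | hlt
      · omega
      · have := hgap u hu w hw hlt
        omega
  refine ⟨g, hg, fun w hw e => ⟨fun h => ?_, fun h => ?_⟩, fun e => ?_⟩
  · rw [hg w hw]
    have hb := abs_le.mp (hB w hw)
    rcases hcases e with h' | ⟨u, hu, hue, h'⟩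
    · omega
    · have := hgap u hu w hw (by omega)
      omega
  · rw [hg w hw]
    have := hle e w hw h.le
    omega
  · have hl := hlow e
    rw [abs_le]
    refine ⟨hl, ?_⟩
    rcases hcases e with h' | ⟨u, hu, hue, h'⟩
    · omega
    · have hb := abs_le.mp (hB u hu)
      omega

lemma sum_map_eq_sum_range {α : Type*} [AddCommMonoid α] (f : ℕ → α) (l : List ℕ) :
    (l.map f).sum = ∑ i ∈ range l.length, f (l.getD i 0) := by
  induction l with
  | nil => simp
  | cons a l ih => simp [Finset.sum_range_succ', ih, add_comm]

lemma Walk.getD_zero {X : Type*} {S : ℕ → X} {x y : X} {l : List ℕ} (h : Walk S x l y)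
    (hl : 0 < l.length) : S (l.getD 0 0) = x := by
  cases l with
  | nil => simp at hl
  | cons a l => exact h.1

lemma Walk.getD_succ {X : Type*} {S : ℕ → X} {x y : X} {l : List ℕ} (h : Walk S x l y) {i : ℕ}
    (hi : i < l.length) :
    S (l.getD i 0 + 1) = if i + 1 < l.length then S (l.getD (i + 1) 0) else y := by
  induction l generalizing x i with
  | nil => simp at hi
  | cons a l ih =>
    cases i with
    | zero =>
      cases l with
      | nil => simpa [Walk] using h.2
      | cons b l => simpa using h.2.1.symm
    | succ i => simpa using ih h.2 (i := i) (by simpa using hi)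

/-- Concatenating walks along consecutive cuts. The function `o` gives the origin in the old
timeline of each time of the new one. -/
lemma exists_origin {X : Type*} (S : ℕ → X) (K : Finset ℕ) (N : ℕ) (h0 : 0 ∈ K) (hN : N ∈ K)
    (hKN : ∀ p ∈ K, p ≤ N) (γ : ℕ → ℕ) (hγ0 : γ 0 = 0)
    (hγ : ∀ p ∈ K, ∀ q ∈ K, p < q → γ p < γ q) (L : ℕ → List ℕ)
    (hL : ∀ p q, Consec K p q → Walk S (S p) (L p) (S q) ∧ (∀ i ∈ L p, p ≤ i ∧ i < q) ∧
      γ q = γ p + (L p).length) :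
    ∃ o : ℕ → ℕ, S (o 0) = S 0 ∧ (∀ j < γ N, S (o j + 1) = S (o (j + 1))) ∧
      (∀ p ∈ K, ∀ j < γ N, γ p ≤ j ↔ p ≤ o j) ∧
      ∀ p q, Consec K p q → ∀ i < (L p).length, o (γ p + i) = (L p).getD i 0 := by
  classical
  have hmono : ∀ p ∈ K, ∀ q ∈ K, p ≤ q → γ p ≤ γ q := fun p hp q hq hpq => by
    rcases hpq.eq_or_lt with rfl | h
    · exact le_rfl
    · exact (hγ p hp q hq h).le
  let o : ℕ → ℕ := fun j => if j < γ N then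
      let p := Nat.findGreatest (fun p => p ∈ K ∧ γ p ≤ j) N
      (L p).getD (j - γ p) 0
    else N
  have ho : ∀ p q, Consec K p q → ∀ i < (L p).length, o (γ p + i) = (L p).getD i 0 := by
    intro p q hpq i hi
    obtain ⟨-, -, hlen⟩ := hL p q hpq
    obtain ⟨hp, hq, hlt, hc⟩ := hpq
    have hqN := hmono q hq N hN (hKN q hq)
    have hfg : Nat.findGreatest (fun r => r ∈ K ∧ γ r ≤ γ p + i) N = p := by
      rw [Nat.findGreatest_eq_iff]
      refine ⟨hKN p hp, fun _ => ⟨hp, by omega⟩, fun r hr _ hrK => ?_⟩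
      rcases hc r hrK.1 with h | h
      · omega
      · have := hmono q hq r hrK.1 h
        omega
    simp only [o]
    rw [if_pos (by omega), hfg, Nat.add_sub_cancel_left]
  have hoN : o (γ N) = N := by simp [o]
  have hloc : ∀ j < γ N, ∃ p q i, Consec K p q ∧ j = γ p + i ∧ i < (L p).length := by
    intro j hj
    have hne : (K.filter (γ · ≤ j)).Nonempty := ⟨0, by simp [h0, hγ0]⟩
    have hmem := (K.filter (γ · ≤ j)).max'_mem hne
    set p := (K.filter (γ · ≤ j)).max' hne
    simp only [mem_filter] at hmem
    have hpN : p < N := lt_of_le_of_ne (hKN p hmem.1) fun h => by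
      rw [h] at hmem; omega
    obtain ⟨q, hq⟩ := exists_consec_right hN hmem.1 hpN
    refine ⟨p, q, j - γ p, hq, by omega, ?_⟩
    have hlen := (hL p q hq).2.2
    by_contra! hc
    have := (K.filter (γ · ≤ j)).le_max' q (by
      simp only [mem_filter]; exact ⟨hq.2.1, by omega⟩)
    have := hq.2.2.1
    omega
  have hpos : ∀ p q, Consec K p q → 0 < (L p).length := fun p q hpq => by
    have := hγ p hpq.1 q hpq.2.1 hpq.2.2.1
    have := (hL p q hpq).2.2
    omega
  have hstart : ∀ p ∈ K, S (o (γ p)) = S p := by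
    intro p hp
    rcases (hKN p hp).eq_or_lt with rfl | h
    · rw [hoN]
    · obtain ⟨q, hq⟩ := exists_consec_right hN hp h
      have := ho p q hq 0 (hpos p q hq)
      rw [Nat.add_zero] at this
      rw [this, (hL p q hq).1.getD_zero (hpos p q hq)]
  refine ⟨o, by simpa [hγ0] using hstart 0 h0, fun j hj => ?_, fun r hr j hj => ?_, ho⟩
  · obtain ⟨p, q, i, hpq, rfl, hi⟩ := hloc j hj
    obtain ⟨hw, -, hlen⟩ := hL p q hpq
    rw [ho p q hpq i hi, hw.getD_succ hi]
    split_ifs with h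
    · rw [add_assoc, ho p q hpq (i + 1) h]
    · rw [show γ p + i + 1 = γ q by omega, hstart q hpq.2.1]
  · obtain ⟨p, q, i, hpq, rfl, hi⟩ := hloc j hj
    obtain ⟨-, hmem, hlen⟩ := hL p q hpq
    rw [ho p q hpq i hi]
    have := hmem ((L p).getD i 0) (by rw [List.getD_eq_getElem _ _ hi]; exact List.getElem_mem hi)
    rcases hpq.2.2.2 r hr with h | h
    · have := hmono r hr p hpq.1 h
      constructor <;> intro <;> omega
    · have := hmono q hpq.2.1 r hr h
      constructor <;> intro <;> omega

/-- A *warp* of the timeline `0, …, N`: a map `g` of values and a map `o` that assigns to each new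
time an old one. Here `S i` and `c i` are the state and the counters at time `i`, and the letters
at the times in `E` may not be repeated. The map `g` respects order and addition on `W`, fixes the
small elements of `W`, and sends each old cut to the corresponding new time and each counter
value there to the value obtained by adding up the old increments along `o`. -/
structure Warp {X κ : Type*} (N : ℕ) (S : ℕ → X) (c : ℕ → κ → ℤ) (E : Finset ℕ) (W : Finset ℤ)
    (D B : ℤ) (g : ℤ → ℤ) (o : ℕ → ℕ) : Prop where
  zero_mem : 0 ∈ W
  one_mem : 1 ∈ W
  cut_mem : ∀ p ∈ cuts N E, (p : ℤ) ∈ W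
  counter_mem : ∀ p ∈ cuts N E, ∀ k, c p k ∈ W
  map_add : ∀ u ∈ W, ∀ v ∈ W, u + v ∈ W → g (u + v) = g u + g v
  map_small : ∀ w ∈ W, |w| ≤ D → g w = w
  lt_of_lt : ∀ w ∈ W, ∀ e, e < w → g e < g w
  lt_of_gt : ∀ w ∈ W, ∀ e, w < e → g w < g e
  bound : ∀ e, |g e| ≤ B
  origin_zero : S (o 0) = S 0
  origin_succ : ∀ j : ℕ, (j : ℤ) < g N → S (o j + 1) = S (o (j + 1))
  cut_le_iff : ∀ p ∈ cuts N E, ∀ j : ℕ, (j : ℤ) < g N → (g p ≤ j ↔ p ≤ o j)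
  map_counter : ∀ p ∈ cuts N E, ∀ k,
    g (c p k) = g (c 0 k) + ∑ j ∈ range (g p).toNat, (c (o j + 1) k - c (o j) k)

end Warp

end AFL

/-! ### Existence of small warps -/

namespace AFL

open Finset Matrix

section WarpExistence

/-- The numerical bounds behind `exists_warp`. -/
lemma warp_bounds {P cutN W T D κ : ℕ} (hP : 2 ≤ P) (hcut : cutN ≤ 2 * P + 2)
    (hκ : κ ≤ P + 1) (hW : W ≤ P + 2 + cutN * κ) (hT : T ≤ 2 ^ P) (hD : D = T * 2 ^ P) :
    (W * W + W + cutN * κ) + W * W ≤ P ^ 12 ∧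
    2 * W + cutN * (2 * D + 1) ^ κ + W * W ≤ 2 ^ (P ^ 12) ∧
    (T + 1) * (T + 1) * 2 ^ P ≤ 2 ^ (P ^ 12) ∧ D ≤ 2 ^ (P ^ 12) ∧ 2 ^ P ≤ 2 ^ (P ^ 12) ∧
    12 * (P ^ 12) ^ 3 + 1 ≤ P ^ 40 := by
  have hc : cutN ≤ 3 * P := by omega
  have hck : cutN * κ ≤ 3 * P * (P + 1) := Nat.mul_le_mul hc hκ
  have hP2 : 2 * P ≤ P ^ 2 := by nlinarith
  have hW' : W ≤ 6 * P ^ 2 := by nlinarith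
  have hWW : W * W ≤ 36 * P ^ 4 := by
    calc W * W ≤ (6 * P ^ 2) * (6 * P ^ 2) := Nat.mul_le_mul hW' hW'
      _ = _ := by ring
  have hpow : ∀ a b, 2 ^ a * P ^ b ≤ P ^ (a + b) := fun a b => by
    rw [pow_add]; exact Nat.mul_le_mul_right _ (Nat.pow_le_pow_left hP a)
  have hmono : ∀ {a b}, a ≤ b → P ^ a ≤ P ^ b := fun h => Nat.pow_le_pow_right (by omega) h
  have h24 : P ^ 2 ≤ P ^ 4 := hmono (by norm_num)
  have hP12 : P ≤ 2 ^ P := (Nat.lt_two_pow_self).le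
  have hexp : 2 * P ^ 2 + 5 * P + 8 ≤ P ^ 12 := by
    have h1 := hpow 3 2
    have h2 : P ^ 5 ≤ P ^ 12 := hmono (by norm_num)
    have h3 : 8 ≤ 2 * P ^ 2 := by nlinarith
    norm_num at h1
    nlinarith
  have h2mono : ∀ {a b : ℕ}, a ≤ b → 2 ^ a ≤ 2 ^ b := fun h => Nat.pow_le_pow_right (by norm_num) h
  have hD' : D ≤ 2 ^ (2 * P) := by
    rw [hD, two_mul, pow_add]; exact Nat.mul_le_mul_right _ hT
  refine ⟨?_, ?_, ?_, ?_, ?_, ?_⟩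
  · have h1 := hpow 7 4
    have h2 : P ^ 11 ≤ P ^ 12 := hmono (by norm_num)
    norm_num at h1
    nlinarith
  · set t := 2 * P ^ 2 + 5 * P + 6
    have e1 : 2 * W ≤ 2 ^ t := by
      calc 2 * W ≤ 2 ^ 4 * (2 ^ P) ^ 2 := by
            have := Nat.pow_le_pow_left hP12 2
            nlinarith
        _ = 2 ^ (4 + P * 2) := by rw [← pow_mul, ← pow_add]
        _ ≤ _ := h2mono (by omega)
    have e2 : W * W ≤ 2 ^ t := by
      calc W * W ≤ 2 ^ 6 * (2 ^ P) ^ 4 := by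
            have := Nat.pow_le_pow_left hP12 4
            nlinarith
        _ = 2 ^ (6 + P * 4) := by rw [← pow_mul, ← pow_add]
        _ ≤ _ := h2mono (by omega)
    have e3 : cutN * (2 * D + 1) ^ κ ≤ 2 ^ t := by
      have h1 : 2 * D + 1 ≤ 2 ^ (2 * P + 2) := by
        have : 1 ≤ 2 ^ (2 * P) := Nat.one_le_two_pow
        rw [pow_add]; omega
      calc cutN * (2 * D + 1) ^ κ ≤ (2 ^ 2 * 2 ^ P) * (2 ^ (2 * P + 2)) ^ (P + 1) := by
            refine Nat.mul_le_mul (by omega) ?_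
            exact (Nat.pow_le_pow_left h1 κ).trans (Nat.pow_le_pow_right (by positivity) hκ)
        _ = 2 ^ (2 + P + (2 * P + 2) * (P + 1)) := by rw [← pow_mul, ← pow_add, ← pow_add]
        _ ≤ _ := h2mono (by simp only [t]; nlinarith)
    calc 2 * W + cutN * (2 * D + 1) ^ κ + W * W ≤ 2 ^ t * 2 ^ 2 := by omega
      _ = 2 ^ (t + 2) := (pow_add _ _ _).symm
      _ ≤ _ := h2mono (by omega)
  · have h1 : T + 1 ≤ 2 ^ (P + 1) := by
      have : 1 ≤ 2 ^ P := Nat.one_le_two_pow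
      rw [pow_succ]; omega
    calc (T + 1) * (T + 1) * 2 ^ P ≤ 2 ^ (P + 1) * 2 ^ (P + 1) * 2 ^ P := by gcongr
      _ = 2 ^ (P + 1 + (P + 1) + P) := by rw [← pow_add, ← pow_add]
      _ ≤ _ := h2mono (by omega)
  · exact hD'.trans (h2mono (by omega))
  · exact h2mono (by omega)
  · have h1 := hpow 4 36
    have h2 : 1 ≤ P ^ 36 := Nat.one_le_pow _ _ (by omega)
    norm_num at h1
    rw [← pow_mul]
    norm_num
    omega

lemma abs_single_le {I : Type*} [DecidableEq I] (u i : I) :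
    |(Pi.single u 1 : I → ℤ) i| ≤ 1 ∧ 0 ≤ (Pi.single u 1 : I → ℤ) i := by
  rw [Pi.single_apply]
  split_ifs <;> simp

/-- **Existence of small warps.** If the numbers of events, values and counters are at most `P`
and the numbers of states and the increments are at most `2 ^ P`, there is a warp whose values
are bounded by `2 ^ P ^ 40`. The conditions on a warp are a system of linear equations and
inequalities for the new values and the multiplicities of the closed walks, with few equations;
the identity is a solution. -/
theorem exists_warp {X κ : Type*} [Fintype κ] (N : ℕ) (S : ℕ → X) (c : ℕ → κ → ℤ) (E : Finset ℕ)
    (V : Finset ℤ) (T : Finset X) (P : ℕ) (hP : 2 ≤ P) (hE : ∀ i ∈ E, i < N) (hEP : #E ≤ P)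
    (hVP : #V ≤ P) (hκP : Fintype.card κ ≤ P) (hTP : #T ≤ 2 ^ P) (hT : ∀ i ≤ N, S i ∈ T)
    (hc : ∀ i < N, ∀ k, |c (i + 1) k - c i k| ≤ 2 ^ P) :
    ∃ (W : Finset ℤ) (g : ℤ → ℤ) (o : ℕ → ℕ), V ⊆ W ∧
      Warp N S c E W (2 ^ P) (2 ^ P ^ 40) g o := by
  classical
  set K := cuts N E with hK
  have h0K : 0 ∈ K := zero_mem_cuts N E
  have hNK : N ∈ K := self_mem_cuts N E
  have hKN : ∀ p ∈ K, p ≤ N := fun p hp => le_of_mem_cuts hE hp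
  -- The time itself is treated as a further counter.
  let cc : ℕ → Option κ → ℤ := fun i k => k.elim (i : ℤ) (c i)
  let δ : ℕ → Option κ → ℤ := fun i => cc (i + 1) - cc i
  have hδ : ∀ i < N, ∀ k, |δ i k| ≤ 2 ^ P := by
    rintro i hi (_ | k)
    · simp only [δ, cc, Pi.sub_apply, Option.elim_none]
      push_cast
      rw [add_sub_cancel_left, abs_one]
      exact one_le_pow₀ (by norm_num)
    · exact hc i hi k
  set Dn : ℕ := #T * 2 ^ P with hDn
  -- The base vector, the cycle vectors and their multiplicities between a cut and the next one.
  have hpump : ∀ p : ℕ, ∃ (q : ℕ) (base : Option κ → ℤ) (C : Finset (Option κ → ℤ))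
      (m : (Option κ → ℤ) → ℕ), p ∈ K → p < N → Consec K p q ∧
      (∀ k, |base k| ≤ (#T + 1) * (#T + 1) * 2 ^ P) ∧ (∀ v ∈ C, ∀ k, |v k| ≤ (Dn : ℤ)) ∧
      cc q - cc p = base + ∑ v ∈ C, m v • v ∧
      ∀ m' : (Option κ → ℤ) → ℕ, ∃ l, Walk S (S p) l (S q) ∧ (∀ i ∈ l, p ≤ i ∧ i < q) ∧
        (l.map δ).sum = base + ∑ v ∈ C, m' v • v := by
    intro p
    by_cases h : p ∈ K ∧ p < N
    · obtain ⟨q, hq⟩ := exists_consec_right hNK h.1 h.2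
      have hqN := hKN q hq.2.1
      obtain ⟨base, C, m, h1, h2, h3, h4⟩ := exists_pumping (S := S) δ T p q hq.2.2.1.le
        (fun i _ hi => hT i (hi.trans hqN)) (2 ^ P) (by positivity)
        (fun i _ hi => hδ i (hi.trans_le hqN))
      refine ⟨q, base, C, m, fun _ _ => ⟨hq, h1, ?_, ?_, h4⟩⟩
      · intro v hv k
        rw [hDn]; push_cast; exact h2 v hv k
      · rw [← h3]
        exact (Finset.sum_Ico_sub cc hq.2.2.1.le).symm
    · exact ⟨0, 0, ∅, 0, fun h1 h2 => absurd ⟨h1, h2⟩ h⟩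
  choose nx base C m hpump using hpump
  -- The unknowns are the new values of the elements of `W` and, for each segment between cuts, a
  -- multiplicity for every vector in `box`. The equations are additivity on `W`, invariance of its
  -- small elements, and the pumping equations; the inequalities keep the order on `W` and gaps of
  -- length at least two, which is what an extension of the new values to all integers requires.
  let W : Finset ℤ := V ∪ {0, 1} ∪ (K ×ˢ (univ : Finset (Option κ))).image fun x => cc x.1 x.2
  have hccW : ∀ p ∈ K, ∀ k, cc p k ∈ W := fun p hp k => by
    refine mem_union_right _ (mem_image.mpr ⟨(p, k), by simp [hp], rfl⟩)
  let Seg := {p // p ∈ K.filter (· < N)}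
  have hSegK : ∀ p : Seg, p.1 ∈ K := fun p => (mem_filter.mp p.2).1
  have hSegN : ∀ p : Seg, p.1 < N := fun p => (mem_filter.mp p.2).2
  have hSeg := fun p : Seg => hpump p.1 (hSegK p) (hSegN p)
  have hnxK : ∀ p : Seg, nx p.1 ∈ K := fun p => (hSeg p).1.2.1
  let box : Finset (Option κ → ℤ) := Fintype.piFinset fun _ => Icc (-(Dn : ℤ)) Dn
  have hCbox : ∀ p : Seg, C p.1 ⊆ box := fun p v hv => by
    rw [Fintype.mem_piFinset]
    intro k
    rw [mem_Icc]
    exact abs_le.mp ((hSeg p).2.2.1 v hv k)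
  let at' : ∀ p : Seg, Option κ → W := fun p k => ⟨cc p.1 k, hccW _ (hSegK p) k⟩
  let atn : ∀ p : Seg, Option κ → W := fun p k => ⟨cc (nx p.1) k, hccW _ (hnxK p) k⟩
  let A : (W × W) ⊕ W ⊕ (Seg × Option κ) → W → ℤ := Sum.elim
    (fun uv => if h : uv.1.1 + uv.2.1 ∈ W then
      Pi.single uv.1 1 + Pi.single uv.2 1 - Pi.single ⟨_, h⟩ 1 else 0)
    (Sum.elim (fun w => if |w.1| ≤ 2 ^ P then Pi.single w 1 else 0)
      (fun pk => Pi.single (atn pk.1 pk.2) 1 - Pi.single (at' pk.1 pk.2) 1))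
  let A' : (W × W) ⊕ W ⊕ (Seg × Option κ) → Seg × box → ℤ := Sum.elim 0 (Sum.elim 0
    (fun pk pv => if pk.1 = pv.1 ∧ pv.2.1 ∈ C pk.1.1 then -pv.2.1 pk.2 else 0))
  let b : (W × W) ⊕ W ⊕ (Seg × Option κ) → ℤ := Sum.elim 0 (Sum.elim
    (fun w => if |w.1| ≤ 2 ^ P then w.1 else 0) (fun pk => base pk.1.1 pk.2))
  let G : W × W → W → ℤ := fun uv => if uv.1.1 < uv.2.1 then
    Pi.single uv.2 1 - Pi.single uv.1 1 else 0
  let h : W × W → ℤ := fun uv => if uv.1.1 < uv.2.1 then min 2 (uv.2.1 - uv.1.1) else 0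
  -- In the equations of a segment, only its own cycle vectors have nonzero coefficients.
  have hA' : ∀ (x : Seg × box → ℤ) (p : Seg) (k : Option κ) (f : (Option κ → ℤ) → ℤ),
      (∀ v : box, x (p, v) = f v) →
      A' (Sum.inr (Sum.inr (p, k))) ⬝ᵥ x = -∑ v ∈ C p.1, f v * v k := by
    intro x p k f hf
    simp only [dotProduct, A', Sum.elim_inr, Fintype.sum_prod_type, ite_mul, zero_mul]
    rw [Finset.sum_eq_single p (fun p' _ hp' => by
      refine Finset.sum_eq_zero fun v _ => ?_
      rw [if_neg fun h => hp' h.1.symm]) (fun h => absurd (mem_univ _) h)]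
    simp only [true_and, hf]
    rw [Finset.sum_coe_sort box (fun v => if v ∈ C p.1 then -v k * f v else 0),
      ← Finset.sum_filter, Finset.filter_mem_eq_inter,
      Finset.inter_eq_right.mpr (hCbox p), ← Finset.sum_neg_distrib]
    exact Finset.sum_congr rfl fun v _ => by ring
  have hcardK : #K ≤ 2 * P + 2 := (card_cuts_le N E).trans (by omega)
  have hcardO : Fintype.card (Option κ) ≤ P + 1 := by
    rw [Fintype.card_option]; omega
  have hcardW : #W ≤ P + 2 + #K * Fintype.card (Option κ) := by
    refine (card_union_le _ _).trans (add_le_add ((card_union_le _ _).trans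
      (add_le_add hVP card_le_two)) (card_image_le.trans ?_))
    rw [card_product, card_univ]
  have hcardSeg : Fintype.card Seg ≤ #K := by
    rw [Fintype.card_coe]; exact card_filter_le _ _
  have hcardbox : #box = (2 * Dn + 1) ^ Fintype.card (Option κ) := by
    simp only [box, Fintype.card_piFinset, Int.card_Icc, prod_const, card_univ]
    congr 1
    omega
  obtain ⟨hb1, hb2, hb3, hb4, hb5, hb6⟩ := warp_bounds hP hcardK hcardO hcardW hTP hDn
  have hSK : Fintype.card Seg * Fintype.card (Option κ) ≤ #K * Fintype.card (Option κ) :=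
    Nat.mul_le_mul_right _ hcardSeg
  have hSB : Fintype.card Seg * #box ≤ #K * (2 * Dn + 1) ^ Fintype.card (Option κ) := by
    rw [hcardbox]; exact Nat.mul_le_mul_right _ hcardSeg
  set Z := P ^ 12 with hZ
  have hZ1 : 1 ≤ Z := Nat.one_le_pow _ _ (by omega)
  have h2Z : (2 : ℤ) ≤ 2 ^ Z := by
    calc (2 : ℤ) = 2 ^ 1 := (pow_one _).symm
      _ ≤ 2 ^ Z := pow_le_pow_right₀ (by norm_num) hZ1
  have hb5' : (2 : ℤ) ^ P ≤ 2 ^ Z := by exact_mod_cast hb5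
  have hb4' : (Dn : ℤ) ≤ 2 ^ Z := by exact_mod_cast hb4
  have hb3' : ((#T : ℤ) + 1) * (#T + 1) * 2 ^ P ≤ 2 ^ Z := by exact_mod_cast hb3
  -- The old values and multiplicities solve the system, so it has a small solution.
  obtain ⟨θ, x', hx', hAθ, hGθ, hθ⟩ := exists_small_mixed_solution A A' b G h
    (fun w => w.1) (fun pv => (m pv.1.1 pv.2.1 : ℤ)) (fun _ => by positivity)
    (by
      rintro (⟨u, v⟩ | w | ⟨p, k⟩)
      · simp only [A, A', b, Sum.elim_inl, Pi.zero_apply, zero_dotProduct, add_zero]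
        split_ifs
        · simp [sub_dotProduct, add_dotProduct]
        · simp
      · simp only [A, A', b, Sum.elim_inl, Sum.elim_inr, Pi.zero_apply, zero_dotProduct, add_zero]
        split_ifs <;> simp
      · rw [hA' _ p k (fun v => (m p.1 v : ℤ)) fun _ => rfl]
        have h1 := congrFun (hSeg p).2.2.2.1 k
        simp only [Pi.sub_apply, Pi.add_apply, Finset.sum_apply, Pi.smul_apply] at h1
        simp only [nsmul_eq_mul] at h1
        simp only [A, b, Sum.elim_inr, sub_dotProduct, single_one_dotProduct, atn, at']
        linarith)
    (by
      rintro ⟨u, v⟩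
      simp only [G, h]
      split_ifs <;> simp [sub_dotProduct])
    Z hZ1
    (by
      simp only [Fintype.card_sum, Fintype.card_prod, Fintype.card_coe] at hSK ⊢
      omega)
    (by
      simp only [Fintype.card_prod, Fintype.card_coe] at hSB ⊢
      omega)
    (by
      rintro (⟨u, v⟩ | w | ⟨p, k⟩) i
      · simp only [A, Sum.elim_inl]
        split_ifs with huv
        · have h1 := abs_single_le u i
          have h2 := abs_single_le v i
          have h3 := abs_single_le (⟨u.1 + v.1, huv⟩ : W) i
          rw [abs_of_nonneg h1.2, abs_of_nonneg h2.2, abs_of_nonneg h3.2] at *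
          simp only [Pi.sub_apply, Pi.add_apply]
          rw [abs_le]; constructor <;> omega
        · simp
      · simp only [A, Sum.elim_inl, Sum.elim_inr]
        split_ifs
        · exact (abs_single_le w i).1.trans (by omega)
        · simp
      · simp only [A, Sum.elim_inr, Pi.sub_apply]
        have h1 := abs_single_le (atn p k) i
        have h2 := abs_single_le (at' p k) i
        rw [abs_of_nonneg h1.2, abs_of_nonneg h2.2] at *
        rw [abs_le]; constructor <;> omega)
    (by
      rintro (⟨u, v⟩ | w | ⟨p, k⟩) ⟨p', v'⟩
      · simp [A']
      · simp [A']
      · simp only [A', Sum.elim_inr]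
        split_ifs with hv
        · rw [abs_neg]
          exact ((hSeg p).2.2.1 _ hv.2 k).trans hb4'
        · simp)
    (by
      rintro (⟨u, v⟩ | w | ⟨p, k⟩)
      · simp [b]
      · simp only [b, Sum.elim_inl, Sum.elim_inr]
        split_ifs with hw
        · exact hw.trans hb5'
        · simp
      · exact ((hSeg p).2.1 k).trans hb3')
    (by
      rintro ⟨u, v⟩ i
      simp only [G]
      split_ifs
      · have h1 := abs_single_le u i
        have h2 := abs_single_le v i
        rw [abs_of_nonneg h1.2, abs_of_nonneg h2.2] at *
        simp only [Pi.sub_apply]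
        rw [abs_le]; constructor <;> omega
      · simp)
    (by
      rintro ⟨u, v⟩
      simp only [h]
      split_ifs with huv
      · rw [abs_of_nonneg (by omega)]; omega
      · simp)
  obtain ⟨g, hgW, hglt, hgB⟩ := exists_extension W (fun w => if hw : w ∈ W then θ ⟨w, hw⟩ else 0)
    (2 ^ (12 * Z ^ 3))
    (by
      intro u hu v hv huv
      have h1 := hGθ (⟨u, hu⟩, ⟨v, hv⟩)
      simp only [h, G, huv, if_true, sub_dotProduct, single_one_dotProduct] at h1
      simpa [hu, hv] using h1)
    (by
      intro w hw
      simpa [hw] using hθ ⟨w, hw⟩)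
    (by positivity)
  have hgθ : ∀ w : W, g w.1 = θ w := fun w => by simp [hgW w.1 w.2]
  have h0W : (0 : ℤ) ∈ W := by simp [W]
  have h1W : (1 : ℤ) ∈ W := by simp [W]
  have hKW : ∀ p ∈ K, (p : ℤ) ∈ W := fun p hp => hccW p hp none
  have hsmall : ∀ w ∈ W, |w| ≤ 2 ^ P → g w = w := by
    intro w hw hwP
    have h1 := hAθ (Sum.inr (Sum.inl ⟨w, hw⟩))
    simp only [A, A', b, Sum.elim_inl, Sum.elim_inr, hwP, if_true, Pi.zero_apply, zero_dotProduct,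
      add_zero, single_one_dotProduct] at h1
    rw [hgθ ⟨w, hw⟩, h1]
  have hg0 : g 0 = 0 := hsmall 0 h0W (by simp)
  have hmonoK : ∀ p ∈ K, ∀ q ∈ K, p < q → g p < g q := fun p hp q hq hpq =>
    (hglt q (hKW q hq) p).1 (by exact_mod_cast hpq)
  have hnonneg : ∀ p ∈ K, 0 ≤ g p := by
    intro p hp
    rcases Nat.eq_zero_or_pos p with rfl | h
    · simp [hg0]
    · have := hmonoK 0 h0K p hp h
      simp only [Nat.cast_zero, hg0] at this
      exact this.le
  -- The new multiplicities give new walks, whose effects are the differences of the new values.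
  have hwalk : ∀ p : ℕ, ∃ l : List ℕ, ∀ q, Consec K p q → Walk S (S p) l (S q) ∧
      (∀ i ∈ l, p ≤ i ∧ i < q) ∧ (l.map δ).sum = fun k => g (cc q k) - g (cc p k) := by
    intro p
    by_cases hp : p ∈ K ∧ p < N
    · let s : Seg := ⟨p, by simp [hp]⟩
      obtain ⟨hcon, -, -, -, hm⟩ := hSeg s
      obtain ⟨l, hl1, hl2, hl3⟩ := hm fun v =>
        if hv : v ∈ box then (x' (s, ⟨v, hv⟩)).toNat else 0
      refine ⟨l, fun q hq => ?_⟩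
      have hqnx : q = nx p := by
        have h1 := hq.2.2.2 _ hcon.2.1
        have h2 := hcon.2.2.2 _ hq.2.1
        have h3 := hq.2.2.1
        have h4 := hcon.2.2.1
        simp only [s] at h1 h2 h4
        omega
      subst hqnx
      refine ⟨hl1, hl2, ?_⟩
      rw [hl3]
      ext k
      have h1 := hAθ (Sum.inr (Sum.inr (s, k)))
      rw [hA' x' s k (fun v => if hv : v ∈ box then x' (s, ⟨v, hv⟩) else 0)
        fun v => by simp [v.2]] at h1
      simp only [A, b, Sum.elim_inr, sub_dotProduct, single_one_dotProduct] at h1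
      rw [← hgθ, ← hgθ] at h1
      simp only [atn, at', s] at h1
      simp only [Pi.add_apply, Finset.sum_apply, Pi.smul_apply, s]
      rw [← h1, add_assoc, add_eq_left, neg_add_eq_zero]
      refine Finset.sum_congr rfl fun v _ => ?_
      by_cases hv : v ∈ box
      · simp only [hv, dif_pos, nsmul_eq_mul]
        rw [Int.toNat_of_nonneg (hx' _)]
      · simp [hv]
    · refine ⟨[], fun q hq => absurd ⟨hq.1, ?_⟩ hp⟩
      have := hKN q hq.2.1
      have := hq.2.2.1
      omega
  choose L hL using hwalk
  have hlen : ∀ p q, Consec K p q → ((L p).length : ℤ) = g q - g p := by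
    intro p q hpq
    have h1 := congrFun (hL p q hpq).2.2 none
    have h2 : ∀ l : List ℕ, (l.map δ).sum none = l.length := by
      intro l
      induction l with
      | nil => simp
      | cons i l ih =>
        simp only [List.map_cons, List.sum_cons, Pi.add_apply, ih, List.length_cons]
        simp only [δ, cc, Pi.sub_apply, Option.elim_none]
        push_cast; ring
    rw [h2] at h1
    simpa [cc] using h1
  obtain ⟨o, ho1, ho2, ho3, ho4⟩ := exists_origin S K N h0K hNK hKN (fun p => (g p).toNat)
    (by simp [hg0])
    (fun p hp q hq hpq => by
      have h1 := hmonoK p hp q hq hpq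
      have h2 := hnonneg p hp
      omega) L
    (fun p q hpq => ⟨(hL p q hpq).1, (hL p q hpq).2.1, by
      have h1 := hlen p q hpq
      have h2 := hnonneg p hpq.1
      have h3 := hnonneg q hpq.2.1
      omega⟩)
  refine ⟨W, g, o, fun v hv => by simp [W, hv], h0W, h1W, hKW, fun p hp k => hccW p hp (some k),
    ?_, hsmall, fun w hw e => (hglt w hw e).1, fun w hw e => (hglt w hw e).2, ?_, ho1, ?_, ?_, ?_⟩
  · intro u hu v hv huv
    have h1 := hAθ (Sum.inl (⟨u, hu⟩, ⟨v, hv⟩))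
    simp only [A, A', b, Sum.elim_inl, huv, dif_pos, Pi.zero_apply, zero_dotProduct,
      add_zero, sub_dotProduct, add_dotProduct, single_one_dotProduct] at h1
    rw [hgθ ⟨u, hu⟩, hgθ ⟨v, hv⟩, hgθ ⟨u + v, huv⟩]
    omega
  · intro e
    refine (hgB e).trans ?_
    calc (2 : ℤ) ^ (12 * Z ^ 3) + 1 ≤ 2 ^ (12 * Z ^ 3) + 2 ^ (12 * Z ^ 3) := by
          gcongr; exact one_le_pow₀ (by norm_num)
      _ = 2 ^ (12 * Z ^ 3 + 1) := by ring
      _ ≤ _ := pow_le_pow_right₀ (by norm_num) hb6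
  · intro j hj
    exact ho2 j (by omega)
  · intro p hp j hj
    rw [← ho3 p hp j (by omega)]
    have := hnonneg p hp
    omega
  · intro p hp k
    induction p using Nat.strong_induction_on with
    | _ p ih =>
    rcases Nat.eq_zero_or_pos p with rfl | hpos
    · simp [hg0]
    · obtain ⟨r, hr⟩ := exists_consec_left h0K hp hpos
      have h1 := ih r hr.2.2.1 hr.1
      have h2 := congrFun (hL r p hr).2.2 (some k)
      have h3 := hlen r p hr
      have h4 := hnonneg r hr.1
      have h5 := hnonneg p hp
      have h6 : (g p).toNat = (g r).toNat + (L r).length := by omega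
      rw [h6, Finset.sum_range_add, ← add_assoc, ← h1]
      rw [sum_map_eq_sum_range, Finset.sum_apply] at h2
      have h7 : ∀ i ∈ range (L r).length, c (o ((g r).toNat + i) + 1) k - c (o ((g r).toNat + i)) k
          = δ ((L r).getD i 0) (some k) := by
        intro i hi
        rw [ho4 r p hr i (by simpa using hi)]
        simp [δ, cc]
      rw [Finset.sum_congr rfl h7, h2]
      simp [cc]

end WarpExistence

end AFL

/-! ### Folds along a timeline: trajectories, phases and events -/

namespace AFL

open Finset

section Trajectories

variable {k : ℕ}

/-- The vector that a branch adds to the index and the counters. -/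
def Branch.delta (b : Branch k) : Fin (k + 1) → ℤ :=
  Fin.cons 1 fun j => (b.increments j).head?.getD 0

lemma Branch.nextVec_eq (b : Branch k) (v : Fin (k + 1) → ℤ) : b.nextVec v = v + b.delta := by
  ext j
  refine Fin.cases ?_ (fun j => ?_) j <;> simp [Branch.nextVec, Branch.delta]

/-- The branch that is executed, if any. -/
def FoldFun.select (f : FoldFun k) (σ : Interp) (e : ℤ) (v : Fin (k + 1) → ℤ) (s : ℤ) :
    Option (Branch k) :=
  (f.branches.find? fun b => b.holds σ e v s).filter fun b => !b.breaks

lemma FoldFun.step_eq (f : FoldFun k) (σ : Interp) (e : ℤ) (v : Fin (k + 1) → ℤ) (s : ℤ) :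
    f.step σ e v s = (f.select σ e v s).map fun b => (v + b.delta, b.nextState s) := by
  unfold FoldFun.step FoldFun.select
  cases h : f.branches.find? fun b => b.holds σ e v s with
  | none => simp
  | some b => cases hb : b.breaks <;> simp [hb, Branch.nextVec_eq]

lemma FoldFun.select_eq_some {f : FoldFun k} {σ : Interp} {e : ℤ} {v : Fin (k + 1) → ℤ} {s : ℤ}
    {b : Branch k} (h : f.select σ e v s = some b) : b ∈ f.branches ∧ b.holds σ e v s = true := by
  unfold FoldFun.select at h
  rw [Option.filter_eq_some_iff] at h
  exact ⟨List.mem_of_find?_eq_some h.1,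
    List.find?_some (p := fun b => Branch.holds b σ e v s) h.1⟩

/-- One step on the common timeline: at time `i`, the fold processes the element `i` of `a` if its
index equals `i`; otherwise it has not started yet or has already stopped. -/
def FoldFun.next (f : FoldFun k) (σ : Interp) (a : List ℤ) (i : ℕ) (c : (Fin (k + 1) → ℤ) × ℤ) :
    (Fin (k + 1) → ℤ) × ℤ :=
  if c.1 0 = i ∧ i < a.length then (f.step σ (a.getD i 0) c.1 c.2).getD c else c

/-- The index, the counters and the state of the fold of `f` over `a` from `v` at time `i`. -/
def FoldFun.traj (f : FoldFun k) (σ : Interp) (a : List ℤ) (v : Fin (k + 1) → ℤ) :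
    ℕ → (Fin (k + 1) → ℤ) × ℤ
  | 0 => (v, 0)
  | i + 1 => f.next σ a i (f.traj σ a v i)

variable (f : FoldFun k) (σ : Interp) (a : List ℤ) (v : Fin (k + 1) → ℤ)

lemma FoldFun.traj_const_of_stopped {i : ℕ} (h : (f.traj σ a v i).1 0 < i) {m : ℕ} (hm : i ≤ m) :
    f.traj σ a v m = f.traj σ a v i := by
  induction m, hm using Nat.le_induction with
  | base => rfl
  | succ m hm ih =>
    rw [FoldFun.traj, FoldFun.next, ih, if_neg]
    omega

lemma FoldFun.traj_const_of_length_le {i : ℕ} (h : a.length ≤ i) {m : ℕ} (hm : i ≤ m) :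
    f.traj σ a v m = f.traj σ a v i := by
  induction m, hm using Nat.le_induction with
  | base => rfl
  | succ m hm ih =>
    rw [FoldFun.traj, FoldFun.next, ih, if_neg]
    omega

lemma FoldFun.traj_of_le_start {i : ℕ} (h : (i : ℤ) ≤ v 0) : f.traj σ a v i = (v, 0) := by
  induction i with
  | zero => rfl
  | succ i ih =>
    rw [FoldFun.traj, ih (by omega), FoldFun.next, if_neg]
    push_cast at h
    simp only
    omega

lemma FoldFun.run_traj {N : ℕ} (hN : a.length ≤ N) (l : List ℤ) (i : ℕ) (hl : a.drop i = l)
    (hiN : i ≤ N) (h : (f.traj σ a v i).1 0 = i) :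
    f.run σ l (f.traj σ a v i).1 (f.traj σ a v i).2 = (f.traj σ a v N).1 := by
  induction l generalizing i with
  | nil =>
    rw [f.traj_const_of_length_le σ a v (List.drop_eq_nil_iff.mp hl) hiN]
    rfl
  | cons e l ih =>
    have hi : i < a.length := by
      by_contra hc
      rw [List.drop_eq_nil_of_le (by omega)] at hl
      simp at hl
    have hcons := List.drop_eq_getElem_cons hi
    rw [hl, List.cons.injEq] at hcons
    have he : a.getD i 0 = e := by rw [List.getD_eq_getElem _ _ hi, hcons.1]
    have hnext : f.traj σ a v (i + 1) =
        (f.step σ e (f.traj σ a v i).1 (f.traj σ a v i).2).getD (f.traj σ a v i) := by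
      rw [FoldFun.traj, FoldFun.next, if_pos ⟨h, hi⟩, he]
    rw [FoldFun.run]
    cases hs : f.step σ e (f.traj σ a v i).1 (f.traj σ a v i).2 with
    | none =>
      rw [hs, Option.getD_none] at hnext
      rcases hiN.eq_or_lt with rfl | hlt
      · rfl
      · have := f.traj_const_of_stopped σ a v (i := i + 1) (by rw [hnext, h]; push_cast; omega) hlt
        rw [this, hnext]
    | some c =>
      obtain ⟨v', s'⟩ := c
      rw [hs, Option.getD_some] at hnext
      have := ih (i + 1) hcons.2.symm (by omega) (by
        rw [FoldFun.step_eq] at hs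
        obtain ⟨b, -, hb⟩ := Option.map_eq_some_iff.mp hs
        rw [hnext]
        simp only [Prod.mk.injEq] at hb
        rw [← hb.1]
        simp [Branch.delta, h])
      rw [hnext] at this
      exact this

/-- The value of a fold is read off at the end of the timeline. -/
lemma FoldFun.eval_eq_traj {N : ℕ} (hN : a.length ≤ N) : f.eval σ a v = (f.traj σ a v N).1 := by
  unfold FoldFun.eval
  split_ifs with h
  · rw [f.traj_const_of_stopped σ a v (i := 0) (by simpa [FoldFun.traj] using h) (Nat.zero_le N)]
    rfl
  · have hv : ((v 0).toNat : ℤ) = v 0 := Int.toNat_of_nonneg (by omega)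
    have h1 := f.traj_of_le_start σ a v hv.le
    rcases le_or_gt (v 0).toNat N with h2 | h2
    · have := f.run_traj σ a v hN _ (v 0).toNat rfl h2 (by rw [h1, hv])
      rw [h1] at this
      exact this
    · rw [List.drop_eq_nil_of_le (by omega), f.traj_of_le_start σ a v (by omega)]
      rfl

/-- The fold either does not move or executes a branch. -/
lemma FoldFun.traj_succ_cases (i : ℕ) :
    f.traj σ a v (i + 1) = f.traj σ a v i ∨
      ∃ b ∈ f.branches, (f.traj σ a v i).1 0 = i ∧
        b.holds σ (a.getD i 0) (f.traj σ a v i).1 (f.traj σ a v i).2 = true ∧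
        f.traj σ a v (i + 1) = ((f.traj σ a v i).1 + b.delta, b.nextState (f.traj σ a v i).2) := by
  rw [FoldFun.traj, FoldFun.next]
  split_ifs with h
  · rw [FoldFun.step_eq]
    cases hs : f.select σ (a.getD i 0) (f.traj σ a v i).1 (f.traj σ a v i).2 with
    | none => simp
    | some b =>
      obtain ⟨h1, h2⟩ := FoldFun.select_eq_some hs
      exact Or.inr ⟨b, h1, h.1, h2, by simp⟩
  · exact Or.inl rfl

end Trajectories

section Phases

variable {k : ℕ}

/-- The vertices of the control flow graph. -/
def FoldFun.stateSet (f : FoldFun k) : Finset ℤ :=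
  insert 0 (f.branches.flatMap Branch.stateUpdates).toFinset

lemma FoldFun.mem_stateSet (f : FoldFun k) (s : ℤ) : s ∈ f.stateSet ↔ s ∈ states f.branches := by
  simp [FoldFun.stateSet, states]

lemma Branch.nextState_mem {br : List (Branch k)} {b : Branch k} (hb : b ∈ br) {s : ℤ}
    (hs : s ∈ states br) : b.nextState s ∈ states br := by
  unfold Branch.nextState
  cases h : b.stateUpdates.head? with
  | none => simpa using hs
  | some n => exact Or.inr ⟨b, hb, List.mem_of_head? h⟩

lemma Branch.admitsState_of_holds {b : Branch k} {σ : Interp} {e : ℤ} {v : Fin (k + 1) → ℤ} {s : ℤ}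
    (h : b.holds σ e v s = true) : b.admitsState s := by
  intro op n hmem
  exact List.all_eq_true.mp h _ hmem

open Classical in
/-- The number of states that can be reached from `s`; it decreases when a strongly connected
component is left. -/
noncomputable def FoldFun.rank (f : FoldFun k) (s : ℤ) : ℕ :=
  #{t ∈ f.stateSet | Relation.ReflTransGen (Edge f.branches) s t}

lemma FoldFun.rank_le_of_reach (f : FoldFun k) {s t : ℤ}
    (h : Relation.ReflTransGen (Edge f.branches) s t) : f.rank t ≤ f.rank s := by
  classical
  refine card_le_card fun u hu => ?_
  simp only [mem_filter] at hu ⊢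
  exact ⟨hu.1, h.trans hu.2⟩

lemma FoldFun.sameSCC_of_rank_eq (f : FoldFun k) {s t : ℤ} (hs : s ∈ states f.branches)
    (h : Relation.ReflTransGen (Edge f.branches) s t) (hr : f.rank t = f.rank s) :
    SameSCC f.branches s t := by
  classical
  refine ⟨h, ?_⟩
  have heq := eq_of_subset_of_card_le (s := {u ∈ f.stateSet |
    Relation.ReflTransGen (Edge f.branches) t u}) (t := {u ∈ f.stateSet |
    Relation.ReflTransGen (Edge f.branches) s u}) (fun u hu => by
      simp only [mem_filter] at hu ⊢
      exact ⟨hu.1, h.trans hu.2⟩) hr.ge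
  have hmem : s ∈ ({u ∈ f.stateSet | Relation.ReflTransGen (Edge f.branches) s u} : Finset ℤ) := by
    simp [FoldFun.mem_stateSet, hs, Relation.ReflTransGen.refl]
  rw [← heq] at hmem
  exact (mem_filter.mp hmem).2

variable (f : FoldFun k) (σ : Interp) (a : List ℤ) (v : Fin (k + 1) → ℤ)

lemma FoldFun.traj_state_mem (i : ℕ) : (f.traj σ a v i).2 ∈ states f.branches := by
  induction i with
  | zero => exact Or.inl rfl
  | succ i ih =>
    rcases f.traj_succ_cases σ a v i with h | ⟨b, hb, -, -, h⟩
    · rwa [h]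
    · rw [h]; exact Branch.nextState_mem hb ih

lemma FoldFun.edgeVia_of_holds {i : ℕ} {b : Branch k} (hb : b ∈ f.branches)
    (hh : b.holds σ (a.getD i 0) (f.traj σ a v i).1 (f.traj σ a v i).2 = true) :
    EdgeVia f.branches b (f.traj σ a v i).2 (b.nextState (f.traj σ a v i).2) :=
  ⟨hb, f.traj_state_mem σ a v i, Branch.admitsState_of_holds hh, rfl⟩

lemma FoldFun.traj_reach {i m : ℕ} (h : i ≤ m) :
    Relation.ReflTransGen (Edge f.branches) (f.traj σ a v i).2 (f.traj σ a v m).2 := by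
  induction m, h using Nat.le_induction with
  | base => exact .refl
  | succ m _ ih =>
    rcases f.traj_succ_cases σ a v m with h | ⟨b, hb, -, hh, h⟩
    · rwa [h]
    · rw [h]; exact ih.tail ⟨b, f.edgeVia_of_holds σ a v hb hh⟩

/-- `2` before the fold starts, `1` while it is running, `0` after it has stopped. -/
def FoldFun.mode (i : ℕ) : ℕ :=
  if (f.traj σ a v i).1 0 < i then 0 else if (f.traj σ a v i).1 0 = i then 1 else 2

lemma FoldFun.mode_le (i : ℕ) : f.mode σ a v i ≤ 2 := by
  unfold FoldFun.mode; split_ifs <;> omega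

lemma FoldFun.mode_succ_le (i : ℕ) : f.mode σ a v (i + 1) ≤ f.mode σ a v i := by
  rcases f.traj_succ_cases σ a v i with h | ⟨b, -, h0, -, h⟩
  · unfold FoldFun.mode
    rw [h]
    push_cast
    split_ifs <;> omega
  · have h1 : (f.traj σ a v (i + 1)).1 0 = i + 1 := by rw [h]; simp [Branch.delta, h0]
    unfold FoldFun.mode
    simp [h1, h0]

/-- The phase of the fold at time `i`. It decreases over time; while it is constant, the fold
neither starts nor stops nor leaves its strongly connected component. -/
noncomputable def FoldFun.phase (i : ℕ) : ℕ := f.rank (f.traj σ a v i).2 + f.mode σ a v i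

lemma FoldFun.phase_antitone : Antitone (f.phase σ a v) := by
  refine antitone_nat_of_succ_le fun i => ?_
  exact add_le_add (f.rank_le_of_reach (f.traj_reach σ a v (Nat.le_succ i)))
    (f.mode_succ_le σ a v i)

lemma FoldFun.mode_antitone : Antitone (f.mode σ a v) :=
  antitone_nat_of_succ_le fun i => f.mode_succ_le σ a v i

lemma FoldFun.phase_le (i : ℕ) : f.phase σ a v i ≤ #f.stateSet + 2 :=
  add_le_add (by classical unfold FoldFun.rank; exact card_filter_le _ _) (f.mode_le σ a v i)

lemma FoldFun.of_phase_eq {i m : ℕ} (him : i ≤ m) (h : f.phase σ a v i = f.phase σ a v m) :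
    SameSCC f.branches (f.traj σ a v i).2 (f.traj σ a v m).2 ∧
      f.mode σ a v i = f.mode σ a v m := by
  have h1 := f.rank_le_of_reach (f.traj_reach σ a v him)
  have h2 := f.mode_antitone σ a v him
  unfold FoldFun.phase at h
  exact ⟨f.sameSCC_of_rank_eq (f.traj_state_mem σ a v i) (f.traj_reach σ a v him) (by omega),
    by omega⟩

/-- Within a phase, the index and each counter are monotone. -/
lemma FoldFun.phase_monotone (ρ : ℕ) (j : Fin (k + 1)) :
    (∀ i, f.phase σ a v i = ρ → f.phase σ a v (i + 1) = ρ →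
      (f.traj σ a v i).1 j ≤ (f.traj σ a v (i + 1)).1 j) ∨
    (∀ i, f.phase σ a v i = ρ → f.phase σ a v (i + 1) = ρ →
      (f.traj σ a v (i + 1)).1 j ≤ (f.traj σ a v i).1 j) := by
  classical
  refine Fin.cases ?_ (fun j => ?_) j
  · left
    intro i _ _
    rcases f.traj_succ_cases σ a v i with h | ⟨b, -, -, -, h⟩
    · rw [h]
    · rw [h]; simp [Branch.delta]
  by_cases hex : ∃ i, f.phase σ a v i = ρ
  swap
  · left
    intro i hi
    exact absurd ⟨i, hi⟩ hex
  have hscc : ∀ i, f.phase σ a v i = ρ →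
      SameSCC f.branches (f.traj σ a v (Nat.find hex)).2 (f.traj σ a v i).2 := fun i hi =>
    (f.of_phase_eq σ a v (Nat.find_min' hex hi) ((Nat.find_spec hex).trans hi.symm)).1
  have hdelta : ∀ b : Branch k, ∀ p : ℤ → Prop, p 0 → (∀ n ∈ b.increments j, p n) →
      p (b.delta j.succ) := by
    intro b p h0 hp
    simp only [Branch.delta, Fin.cons_succ]
    cases h : (b.increments j).head? with
    | none => simpa using h0
    | some n => simpa using hp n (List.mem_of_head? h)
  rcases f.monotone _ (f.traj_state_mem σ a v (Nat.find hex)) j with hm | hm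
  · left
    intro i h1 h2
    rcases f.traj_succ_cases σ a v i with h | ⟨b, hb, -, hh, h⟩
    · rw [h]
    · have hs := hscc (i + 1) h2
      rw [h] at hs ⊢
      have := hdelta b (0 ≤ ·) le_rfl (hm b _ _ (f.edgeVia_of_holds σ a v hb hh) (hscc i h1) hs)
      simpa using this
  · right
    intro i h1 h2
    rcases f.traj_succ_cases σ a v i with h | ⟨b, hb, -, hh, h⟩
    · rw [h]
    · have hs := hscc (i + 1) h2
      rw [h] at hs ⊢
      have := hdelta b (· ≤ 0) le_rfl (hm b _ _ (f.edgeVia_of_holds σ a v hb hh) (hscc i h1) hs)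
      simpa using this

/-- While the phase is constant, the index keeps its relation to the time. -/
lemma FoldFun.index_of_phase_eq {i : ℕ} (h : f.phase σ a v i = f.phase σ a v (i + 1)) :
    ((f.traj σ a v i).1 0 = i ∧ (f.traj σ a v (i + 1)).1 0 = i + 1) ∨
      ((f.traj σ a v i).1 0 ≠ i ∧ (f.traj σ a v (i + 1)).1 0 = (f.traj σ a v i).1 0) := by
  have hm := (f.of_phase_eq σ a v (Nat.le_succ i) h).2
  rcases f.traj_succ_cases σ a v i with h | ⟨b, -, h0, -, h⟩
  · right
    refine ⟨fun h0 => ?_, by rw [h]⟩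
    unfold FoldFun.mode at hm
    rw [h, h0] at hm
    simp at hm
  · left
    refine ⟨h0, ?_⟩
    rw [h]; simp [Branch.delta, h0]

end Phases

section Events

/-- The position of `x` relative to the elements of `V`, as a number that is monotone in `x`. -/
def cls (V : Finset ℤ) (x : ℤ) : ℕ := #{t ∈ V | t < x} + #{t ∈ V | t ≤ x}

lemma cls_mono (V : Finset ℤ) : Monotone (cls V) := fun x y h =>
  add_le_add (card_le_card fun t ht => by simp only [mem_filter] at ht ⊢; exact ⟨ht.1, by omega⟩)
    (card_le_card fun t ht => by simp only [mem_filter] at ht ⊢; exact ⟨ht.1, by omega⟩)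

lemma cls_le (V : Finset ℤ) (x : ℤ) : cls V x ≤ 2 * #V := by
  have h1 := card_filter_le V (· < x)
  have h2 := card_filter_le V (· ≤ x)
  unfold cls
  omega

lemma lt_iff_of_cls_eq {V : Finset ℤ} {x y : ℤ} (h : cls V x = cls V y) {t : ℤ} (ht : t ∈ V) :
    (t < x ↔ t < y) ∧ (x < t ↔ y < t) := by
  wlog hxy : x ≤ y generalizing x y
  · have := this h.symm (by omega)
    exact ⟨this.1.symm, this.2.symm⟩
  have s1 : ({t ∈ V | t < x} : Finset ℤ) ⊆ {t ∈ V | t < y} := fun t ht => by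
    simp only [mem_filter] at ht ⊢; exact ⟨ht.1, by omega⟩
  have s2 : ({t ∈ V | t ≤ x} : Finset ℤ) ⊆ {t ∈ V | t ≤ y} := fun t ht => by
    simp only [mem_filter] at ht ⊢; exact ⟨ht.1, by omega⟩
  have c1 := card_le_card s1
  have c2 := card_le_card s2
  unfold cls at h
  have e1 := eq_of_subset_of_card_le s1 (by omega)
  have e2 := eq_of_subset_of_card_le s2 (by omega)
  have m1 := Finset.ext_iff.mp e1 t
  have m2 := Finset.ext_iff.mp e2 t
  simp only [mem_filter, ht, true_and] at m1 m2
  exact ⟨m1, by omega⟩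

/-- A sequence that is monotone in every phase of a decreasing sequence changes rarely. -/
lemma card_changes_le (N : ℕ) (r c : ℕ → ℕ) (R C : ℕ) (hr : Antitone r) (hR : ∀ i, r i < R)
    (hC : ∀ i, c i < C) (hmono : ∀ ρ, (∀ i, r i = ρ → r (i + 1) = ρ → c i ≤ c (i + 1)) ∨
      (∀ i, r i = ρ → r (i + 1) = ρ → c (i + 1) ≤ c i)) :
    #{i ∈ range N | r i ≠ r (i + 1) ∨ c i ≠ c (i + 1)} ≤ R * C := by
  have hinj : ∀ i m, i < m → (r i ≠ r (i + 1) ∨ c i ≠ c (i + 1)) → r i = r m → c i ≠ c m := by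
    intro i m him hch hrm hcm
    have hconst : ∀ n, i ≤ n → n ≤ m → r n = r i := fun n h1 h2 =>
      le_antisymm (hr h1) (hrm ▸ hr h2)
    have hci : c i ≠ c (i + 1) := by
      rcases hch with h | h
      · exact absurd (hconst (i + 1) (by omega) him).symm h
      · exact h
    rcases hmono (r i) with h | h
    · have h1 := h i rfl (hconst _ (by omega) him)
      have h2 : ∀ n, i + 1 ≤ n → n ≤ m → c (i + 1) ≤ c n := by
        intro n hn
        induction n, hn using Nat.le_induction with
        | base => intro; exact le_rfl
        | succ n hn ih =>
          intro hnm
          exact (ih (by omega)).trans (h n (hconst n (by omega) (by omega))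
            (hconst _ (by omega) hnm))
      have := h2 m him le_rfl
      omega
    · have h1 := h i rfl (hconst _ (by omega) him)
      have h2 : ∀ n, i + 1 ≤ n → n ≤ m → c n ≤ c (i + 1) := by
        intro n hn
        induction n, hn using Nat.le_induction with
        | base => intro; exact le_rfl
        | succ n hn ih =>
          intro hnm
          exact (h n (hconst n (by omega) (by omega)) (hconst _ (by omega) hnm)).trans
            (ih (by omega))
      have := h2 m him le_rfl
      omega
  calc #{i ∈ range N | r i ≠ r (i + 1) ∨ c i ≠ c (i + 1)} ≤ #(range R ×ˢ range C) := by
        refine card_le_card_of_injOn (fun i => (r i, c i)) (fun i _ => by simp [hR, hC]) ?_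
        intro i hi m hm h
        simp only [coe_filter, mem_range, Set.mem_ofPred_eq, Prod.mk.injEq] at hi hm h
        rcases lt_trichotomy i m with hlt | heq | hlt
        · exact absurd h.2 (hinj i m hlt hi.2 h.1)
        · exact heq
        · exact absurd h.2.symm (hinj m i hlt hm.2 h.1.symm)
    _ = R * C := by simp

end Events

end AFL

/-! ### Simulation of a fold along a warp -/

namespace AFL

open Finset

section Simulation

lemma CmpOp.eval_congr (op : CmpOp) {x y x' y' : ℤ} (h1 : x' < y' ↔ x < y) (h2 : y' < x' ↔ y < x) :
    op.eval x' y' = op.eval x y := by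
  have h3 : x' = y' ↔ x = y := by omega
  cases op <;> simp [CmpOp.eval, h1, h2, h3]

/-- The sequence `l` transported along a warp. -/
def pull (g : ℤ → ℤ) (o : ℕ → ℕ) (l : List ℤ) : List ℤ :=
  (List.range (g l.length).toNat).map fun j => g (l.getD (o j) 0)

lemma length_pull (g : ℤ → ℤ) (o : ℕ → ℕ) (l : List ℤ) :
    (pull g o l).length = (g l.length).toNat := by simp [pull]

lemma getD_pull (g : ℤ → ℤ) (o : ℕ → ℕ) (l : List ℤ) {j : ℕ} (hj : j < (g l.length).toNat) :
    (pull g o l).getD j 0 = g (l.getD (o j) 0) := by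
  rw [List.getD_eq_getElem _ _ (by rwa [length_pull])]
  simp [pull]

/-- The term `t` takes a value in `V` under `σ`, and `g` of this value under `σ'`. -/
def IntTerm.Transfers (σ σ' : Interp) (V : Finset ℤ) (g : ℤ → ℤ) (t : IntTerm) : Prop :=
  t.eval σ ∈ V ∧ t.eval σ' = g (t.eval σ)

/-- The terms of an atomic guard are transferred. -/
def AtomicGuard.Transfers {k : ℕ} (σ σ' : Interp) (V : Finset ℤ) (g : ℤ → ℤ) :
    AtomicGuard k → Prop
  | .elem _ t => t.Transfers σ σ' V g
  | .index _ t => t.Transfers σ σ' V g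
  | .counter _ _ t => t.Transfers σ σ' V g
  | .state _ _ => True

/-- All guards of the function are transferred. -/
def FoldFun.Transfers {k : ℕ} (σ σ' : Interp) (V : Finset ℤ) (g : ℤ → ℤ) (f : FoldFun k) : Prop :=
  ∀ b ∈ f.branches, ∀ gd ∈ b.guard, gd.Transfers σ σ' V g

/-- The same branch is selected if all compared values keep their position relative to `V`. -/
lemma FoldFun.select_congr {k : ℕ} {f : FoldFun k} {σ σ' : Interp} {V : Finset ℤ} {g : ℤ → ℤ}
    (hf : f.Transfers σ σ' V g) {e e' s : ℤ} {v v' : Fin (k + 1) → ℤ}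
    (he : ∀ t ∈ V, (e' < g t ↔ e < t) ∧ (g t < e' ↔ t < e))
    (hv : ∀ j, ∀ t ∈ V, (v' j < g t ↔ v j < t) ∧ (g t < v' j ↔ t < v j)) :
    f.select σ' e' v' s = f.select σ e v s := by
  unfold FoldFun.select
  congr 1
  have : ∀ b ∈ f.branches, b.holds σ' e' v' s = b.holds σ e v s := by
    intro b hb
    unfold Branch.holds
    rw [Bool.eq_iff_iff, List.all_eq_true, List.all_eq_true]
    refine forall₂_congr fun gd hgd => ?_
    have ht := hf b hb gd hgd
    suffices h : AtomicGuard.eval σ' e' v' s gd = AtomicGuard.eval σ e v s gd by rw [h]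
    cases gd with
    | elem op t =>
      simp only [AtomicGuard.eval, ht.2]
      exact op.eval_congr (he _ ht.1).1 (he _ ht.1).2
    | index op t =>
      simp only [AtomicGuard.eval, ht.2]
      exact op.eval_congr (hv _ _ ht.1).1 (hv _ _ ht.1).2
    | counter j op t =>
      simp only [AtomicGuard.eval, ht.2]
      exact op.eval_congr (hv _ _ ht.1).1 (hv _ _ ht.1).2
    | state op n => rfl
  generalize f.branches = br at this
  induction br with
  | nil => rfl
  | cons b br ih =>
    rw [List.find?_cons, List.find?_cons, this b (by simp), ih fun b hb => this b (by simp [hb])]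

namespace Warp

variable {X κ : Type*} {N : ℕ} {S : ℕ → X} {c : ℕ → κ → ℤ} {E : Finset ℕ} {W : Finset ℤ}
  {D B : ℤ} {g : ℤ → ℤ} {o : ℕ → ℕ}

lemma map_zero (w : Warp N S c E W D B g o) : g 0 = 0 := by
  have := w.map_add 0 w.zero_mem 0 w.zero_mem (by simpa using w.zero_mem)
  simp at this
  exact this

lemma lt_iff (w : Warp N S c E W D B g o) {t : ℤ} (ht : t ∈ W) (e : ℤ) :
    (g e < g t ↔ e < t) ∧ (g t < g e ↔ t < e) := by
  rcases lt_trichotomy e t with h | h | h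
  · have := w.lt_of_lt t ht e h
    constructor <;> constructor <;> intro <;> omega
  · subst h; simp
  · have := w.lt_of_gt t ht e h
    constructor <;> constructor <;> intro <;> omega

lemma eq_iff (w : Warp N S c E W D B g o) {t : ℤ} (ht : t ∈ W) (e : ℤ) : g e = g t ↔ e = t := by
  have := w.lt_iff ht e
  omega

lemma cut_nonneg (w : Warp N S c E W D B g o) {p : ℕ} (hp : p ∈ cuts N E) : 0 ≤ g p := by
  rcases Nat.eq_zero_or_pos p with rfl | h
  · simp [w.map_zero]
  · have := w.lt_of_gt 0 w.zero_mem p (by exact_mod_cast h)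
    rw [w.map_zero] at this
    exact this.le

lemma map_event_succ (w : Warp N S c E W D B g o) (hD : 1 ≤ D) {i : ℕ} (hi : i ∈ E) :
    g ((i + 1 : ℕ) : ℤ) = g i + 1 := by
  have h1 := w.cut_mem _ (succ_mem_cuts_of_mem hi)
  have h2 := w.cut_mem _ (mem_cuts_of_mem (N := N) hi)
  push_cast at h1 ⊢
  rw [w.map_add _ h2 _ w.one_mem h1, w.map_small 1 w.one_mem (by simpa using hD)]

lemma origin_eq_iff (w : Warp N S c E W D B g o) (hD : 1 ≤ D) {i : ℕ} (hi : i ∈ E) {j : ℕ}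
    (hj : (j : ℤ) < g N) : o j = i ↔ (j : ℤ) = g i := by
  have h1 := w.cut_le_iff _ (mem_cuts_of_mem (N := N) hi) j hj
  have h2 := w.cut_le_iff _ (succ_mem_cuts_of_mem (N := N) hi) j hj
  rw [w.map_event_succ hD hi] at h2
  omega

lemma origin_lt (w : Warp N S c E W D B g o) {j : ℕ} (hj : (j : ℤ) < g N) : o j < N := by
  have := w.cut_le_iff _ (self_mem_cuts N E) j hj
  omega

/-- The value of the counter `k` at the new time `j`. -/
def newCounter (c : ℕ → κ → ℤ) (g : ℤ → ℤ) (o : ℕ → ℕ) (j : ℕ) (k : κ) : ℤ :=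
  g (c 0 k) + ∑ j' ∈ range j, (c (o j' + 1) k - c (o j') k)

lemma newCounter_cut (w : Warp N S c E W D B g o) {p : ℕ} (hp : p ∈ cuts N E) (k : κ) :
    newCounter c g o (g p).toNat k = g (c p k) := (w.map_counter p hp k).symm

lemma newCounter_sub {j j' : ℕ} (h : j ≤ j') (k : κ) :
    newCounter c g o j' k = newCounter c g o j k +
      ∑ m ∈ Ico j j', (c (o m + 1) k - c (o m) k) := by
  unfold newCounter
  rw [Finset.sum_Ico_eq_sub _ h]
  ring

/-- The new time `j` lies in the image of the segment that contains its origin. -/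
lemma exists_segment (w : Warp N S c E W D B g o) {j : ℕ} (hj : (j : ℤ) < g N) :
    ∃ p q, Consec (cuts N E) p q ∧ p ≤ o j ∧ o j < q ∧ (g p).toNat ≤ j ∧ j < (g q).toNat ∧
      ∀ m, (g p).toNat ≤ m → m < (g q).toNat → p ≤ o m ∧ o m < q := by
  obtain ⟨p, q, hpq, h1, h2⟩ := exists_consec_of_lt (zero_mem_cuts N E) (self_mem_cuts N E)
    (w.origin_lt hj)
  have hp0 := w.cut_nonneg hpq.1
  have hq0 := w.cut_nonneg hpq.2.1
  have h3 := w.cut_le_iff p hpq.1 j hj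
  have h4 := w.cut_le_iff q hpq.2.1 j hj
  refine ⟨p, q, hpq, h1, h2, by omega, by omega, fun m hm1 hm2 => ?_⟩
  have hqN : g q ≤ g N := by
    by_contra hc
    have := (w.lt_iff (w.cut_mem _ (self_mem_cuts N E)) q).2.mp (by omega)
    have h5 := hpq.2.2.2 N (self_mem_cuts N E)
    have h6 := w.origin_lt hj
    omega
  have h3 := w.cut_le_iff p hpq.1 m (by omega)
  have h4 := w.cut_le_iff q hpq.2.1 m (by omega)
  omega

/-- Counters whose position relative to `V` is constant on event-free segments, and which are
monotone there, keep this position under the warp. -/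
lemma newCounter_lt_iff (w : Warp N S c E W D B g o) (hD : 1 ≤ D) {V : Finset ℤ} (hVW : V ⊆ W)
    (k : κ) (hcls : ∀ i < N, i ∉ E → cls V (c i k) = cls V (c (i + 1) k))
    (hmono : ∀ p q, p ≤ q → q ≤ N → (∀ i, p ≤ i → i < q → i ∉ E) →
      (∀ i, p ≤ i → i < q → c i k ≤ c (i + 1) k) ∨ (∀ i, p ≤ i → i < q → c (i + 1) k ≤ c i k))
    (hE : ∀ i ∈ E, i < N) {j : ℕ} (hj : (j : ℤ) < g N) {t : ℤ} (ht : t ∈ V) :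
    (newCounter c g o j k < g t ↔ c (o j) k < t) ∧
      (g t < newCounter c g o j k ↔ t < c (o j) k) := by
  by_cases hiE : o j ∈ E
  · have hji := (w.origin_eq_iff hD hiE hj).mp rfl
    have h1 := w.newCounter_cut (mem_cuts_of_mem (N := N) hiE) k
    rw [← hji, Int.toNat_natCast] at h1
    rw [h1]
    exact w.lt_iff (hVW ht) _
  obtain ⟨p, q, hpq, hp, hq, hjp, hjq, hseg⟩ := w.exists_segment hj
  have hqN : q ≤ N := le_of_mem_cuts hE hpq.2.1
  have hfree : ∀ i, p ≤ i → i < q → i ∉ E := by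
    intro i h1 h2 hi
    have h3 := hpq.2.2.2 i (mem_cuts_of_mem hi)
    have h4 := hpq.2.2.2 (i + 1) (succ_mem_cuts_of_mem hi)
    exact hiE (by rwa [show o j = i by omega])
  have hclsp : ∀ i, p ≤ i → i ≤ q → cls V (c i k) = cls V (c p k) := by
    intro i hi
    induction i, hi using Nat.le_induction with
    | base => intro; rfl
    | succ i hi ih =>
      intro hiq
      rw [← hcls i (by omega) (hfree i hi hiq), ih (by omega)]
  have e1 := lt_iff_of_cls_eq (hclsp (o j) hp hq.le) ht
  have e2 := lt_iff_of_cls_eq (hclsp q hpq.2.2.1.le le_rfl) ht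
  have n1 := newCounter_sub (c := c) (g := g) (o := o) hjp k
  have n2 := newCounter_sub (c := c) (g := g) (o := o) hjq.le k
  rw [w.newCounter_cut hpq.1] at n1
  rw [w.newCounter_cut hpq.2.1] at n2
  have l1 := w.lt_iff (hVW ht) (c p k)
  have l2 := w.lt_iff (hVW ht) (c q k)
  rcases hmono p q hpq.2.2.1.le hqN hfree with hm | hm
  · have s1 : 0 ≤ ∑ m ∈ Ico (g p).toNat j, (c (o m + 1) k - c (o m) k) :=
      Finset.sum_nonneg fun m hm' => by
        rw [mem_Ico] at hm'
        have := hseg m hm'.1 (by omega)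
        exact sub_nonneg.mpr (hm _ this.1 this.2)
    have s2 : 0 ≤ ∑ m ∈ Ico j (g q).toNat, (c (o m + 1) k - c (o m) k) :=
      Finset.sum_nonneg fun m hm' => by
        rw [mem_Ico] at hm'
        have := hseg m (by omega) hm'.2
        exact sub_nonneg.mpr (hm _ this.1 this.2)
    constructor <;> omega
  · have s1 : ∑ m ∈ Ico (g p).toNat j, (c (o m + 1) k - c (o m) k) ≤ 0 :=
      Finset.sum_nonpos fun m hm' => by
        rw [mem_Ico] at hm'
        have := hseg m hm'.1 (by omega)
        exact sub_nonpos.mpr (hm _ this.1 this.2)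
    have s2 : ∑ m ∈ Ico j (g q).toNat, (c (o m + 1) k - c (o m) k) ≤ 0 :=
      Finset.sum_nonpos fun m hm' => by
        rw [mem_Ico] at hm'
        have := hseg m (by omega) hm'.2
        exact sub_nonpos.mpr (hm _ this.1 this.2)
    constructor <;> omega

/-- An index that, on event-free segments, either moves along with the time or rests, keeps its
relation to the time. -/
lemma newCounter_eq_iff (w : Warp N S c E W D B g o) (hD : 1 ≤ D) (k : κ)
    (hidx : ∀ i < N, i ∉ E → (c i k = i ∧ c (i + 1) k = i + 1) ∨ (c i k ≠ i ∧ c (i + 1) k = c i k ∧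
      c (i + 1) k ≠ i + 1))
    (hE : ∀ i ∈ E, i < N) {j : ℕ} (hj : (j : ℤ) < g N) :
    newCounter c g o j k = j ↔ c (o j) k = o j := by
  by_cases hiE : o j ∈ E
  · have hji := (w.origin_eq_iff hD hiE hj).mp rfl
    have h1 := w.newCounter_cut (mem_cuts_of_mem (N := N) hiE) k
    rw [← hji, Int.toNat_natCast] at h1
    rw [h1, hji]
    exact w.eq_iff (w.cut_mem _ (mem_cuts_of_mem hiE)) _
  obtain ⟨p, q, hpq, hp, hq, hjp, hjq, hseg⟩ := w.exists_segment hj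
  have hqN : q ≤ N := le_of_mem_cuts hE hpq.2.1
  have hp0 := w.cut_nonneg hpq.1
  have hq0 := w.cut_nonneg hpq.2.1
  have hfree : ∀ i, p ≤ i → i < q → i ∉ E := by
    intro i h1 h2 hi
    have h3 := hpq.2.2.2 i (mem_cuts_of_mem hi)
    have h4 := hpq.2.2.2 (i + 1) (succ_mem_cuts_of_mem hi)
    exact hiE (by rwa [show o j = i by omega])
  have n1 := newCounter_sub (c := c) (g := g) (o := o) hjp k
  rw [w.newCounter_cut hpq.1] at n1
  by_cases hrun : c p k = p
  · have hall : ∀ i, p ≤ i → i ≤ q → c i k = i := by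
      intro i hi
      induction i, hi using Nat.le_induction with
      | base => intro; exact hrun
      | succ i hi ih =>
        intro hiq
        have := hidx i (by omega) (hfree i hi hiq)
        have := ih (by omega)
        push_cast
        omega
    have hsum : ∑ m ∈ Ico (g p).toNat j, (c (o m + 1) k - c (o m) k) = (j - (g p).toNat : ℕ) := by
      rw [Finset.sum_congr rfl (g := fun _ => (1 : ℤ)) fun m hm => by
        rw [mem_Ico] at hm
        have := hseg m hm.1 (by omega)
        rw [hall _ this.1 this.2.le, hall (o m + 1) (by omega) (by omega)]
        push_cast; ring]
      simp
    rw [hrun, hsum] at n1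
    have := hall (o j) hp hq.le
    constructor <;> intro <;> omega
  · have hall : ∀ i, p ≤ i → i ≤ q → c i k ≠ i ∧ c i k = c p k := by
      intro i hi
      induction i, hi using Nat.le_induction with
      | base => intro; exact ⟨hrun, rfl⟩
      | succ i hi ih =>
        intro hiq
        have := hidx i (by omega) (hfree i hi hiq)
        have := ih (by omega)
        push_cast
        omega
    have hsum : ∑ m ∈ Ico (g p).toNat j, (c (o m + 1) k - c (o m) k) = 0 := by
      refine Finset.sum_eq_zero fun m hm => ?_
      rw [mem_Ico] at hm
      have := hseg m hm.1 (by omega)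
      rw [(hall _ this.1 this.2.le).2, (hall (o m + 1) (by omega) (by omega)).2, sub_self]
    have hside : c p k < p ∨ (q : ℤ) < c p k := by
      by_contra! hc
      obtain ⟨n, hn⟩ := Int.eq_ofNat_of_zero_le (show 0 ≤ c p k by omega)
      have := hall n (by omega) (by omega)
      omega
    have h1 := (hall (o j) hp hq.le).1
    rcases hside with h | h
    · have := (w.lt_iff (w.cut_mem p hpq.1) (c p k)).1.mpr h
      constructor <;> intro <;> omega
    · have := (w.lt_iff (w.cut_mem q hpq.2.1) (c p k)).2.mpr h
      constructor <;> intro <;> omega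

/-- Positions inside of a sequence of tracked length correspond. -/
lemma lt_length_iff (w : Warp N S c E W D B g o) {V : Finset ℤ}
    (hVE : ∀ i : ℕ, (i : ℤ) ∈ V → i < N → i ∈ E)
    {n : ℕ} (hn : n ≤ N) (hnV : (n : ℤ) ∈ V) {j : ℕ} (hj : (j : ℤ) < g N) :
    j < (g n).toNat ↔ o j < n := by
  have hcut : n ∈ cuts N E := by
    rcases hn.eq_or_lt with rfl | h
    · exact self_mem_cuts _ _
    · exact mem_cuts_of_mem (hVE n hnV h)
  have h1 := w.cut_le_iff n hcut j hj
  have h2 := w.cut_nonneg hcut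
  omega

lemma toNat_map_le (w : Warp N S c E W D B g o) {n : ℕ} (hn : n ≤ N) :
    (g n).toNat ≤ (g N).toNat := by
  have := (w.lt_iff (w.cut_mem _ (self_mem_cuts N E)) n).2
  have h0 := w.cut_nonneg (self_mem_cuts N E)
  omega

end Warp

/-- **Simulation.** Under a warp whose events include all changes of phase and of the position of
a counter relative to `V`, the value of a fold is transported by `g`. -/
theorem FoldFun.eval_warp {X κ : Type*} {N : ℕ} {S : ℕ → X} {c : ℕ → κ → ℤ} {E : Finset ℕ}
    {W : Finset ℤ} {D B : ℤ} {g : ℤ → ℤ} {o : ℕ → ℕ} (w : Warp N S c E W D B g o) (hD : 1 ≤ D)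
    {V : Finset ℤ} (hVW : V ⊆ W) (hE : ∀ i ∈ E, i < N)
    (hVE : ∀ i : ℕ, (i : ℤ) ∈ V → i < N → i ∈ E) {k : ℕ} (f : FoldFun k) {σ σ' : Interp}
    (hf : f.Transfers σ σ' V g) (a : List ℤ) (haN : a.length ≤ N) (haV : (a.length : ℤ) ∈ V)
    (v : Fin (k + 1) → ℤ)
    (hS : ∀ i m, S i = S m → (f.traj σ a v i).2 = (f.traj σ a v m).2)
    (e : Fin (k + 1) → κ) (hc : ∀ i j, c i (e j) = (f.traj σ a v i).1 j)
    (hevent : ∀ i < N, i ∉ E → ∀ j, f.phase σ a v i = f.phase σ a v (i + 1) ∧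
      cls V ((f.traj σ a v i).1 j) = cls V ((f.traj σ a v (i + 1)).1 j)) :
    f.eval σ' (pull g o a) (fun j => g (v j)) = fun j => g (f.eval σ a v j) := by
  have hphase : ∀ p q, (∀ i, p ≤ i → i < q → i < N ∧ i ∉ E) → ∀ i, p ≤ i → i ≤ q →
      f.phase σ a v i = f.phase σ a v p := by
    intro p q h i hi
    induction i, hi using Nat.le_induction with
    | base => intro; rfl
    | succ i hi ih =>
      intro hiq
      have := h i hi hiq
      rw [← (hevent i this.1 this.2 0).1, ih (by omega)]
  have key : ∀ j : ℕ, (j : ℤ) ≤ g N → f.traj σ' (pull g o a) (fun j => g (v j)) j =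
      (fun k => Warp.newCounter c g o j (e k), (f.traj σ a v (o j)).2) := by
    intro j
    induction j with
    | zero =>
      intro _
      have := hS _ _ w.origin_zero
      rw [this]
      ext
      · simp [FoldFun.traj, Warp.newCounter, hc]
      · simp [FoldFun.traj]
    | succ j ih =>
      intro hj
      have hj' : (j : ℤ) < g N := by push_cast at hj; omega
      have hstate := hS _ _ (w.origin_succ j hj')
      have hnew : ∀ k, Warp.newCounter c g o (j + 1) k = Warp.newCounter c g o j k +
          (c (o j + 1) k - c (o j) k) := fun k => by
        unfold Warp.newCounter
        rw [Finset.sum_range_succ, add_assoc]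
      have hpos := w.lt_length_iff hVE haN haV hj'
      have hcmp : ∀ m, ∀ t ∈ V,
          (Warp.newCounter c g o j (e m) < g t ↔ (f.traj σ a v (o j)).1 m < t) ∧
          (g t < Warp.newCounter c g o j (e m) ↔ t < (f.traj σ a v (o j)).1 m) := by
        intro m t ht
        rw [← hc]
        refine w.newCounter_lt_iff hD hVW (e m) (fun i hi hiE => ?_) (fun p q hpq hqN hfree => ?_)
          hE hj' ht
        · rw [hc, hc]; exact (hevent i hi hiE m).2
        · have hph := hphase p q fun i h1 h2 => ⟨by omega, hfree i h1 h2⟩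
          simp only [hc]
          refine (f.phase_monotone σ a v (f.phase σ a v p) m).imp (fun h i h1 h2 => ?_)
            fun h i h1 h2 => ?_
          · exact h i (hph i h1 h2.le) (hph (i + 1) (by omega) h2)
          · exact h i (hph i h1 h2.le) (hph (i + 1) (by omega) h2)
      have hidx : Warp.newCounter c g o j (e 0) = j ↔ (f.traj σ a v (o j)).1 0 = o j := by
        rw [← hc]
        refine w.newCounter_eq_iff hD (e 0) (fun i hi hiE => ?_) hE hj'
        have hph := (hevent i hi hiE 0).1
        have hmode := (f.of_phase_eq σ a v (Nat.le_succ i) hph).2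
        rw [hc, hc]
        rcases f.index_of_phase_eq σ a v hph with h | h
        · exact Or.inl h
        · refine Or.inr ⟨h.1, h.2, fun h' => ?_⟩
          unfold FoldFun.mode at hmode
          rw [h'] at hmode
          simp only [Nat.succ_eq_add_one, Nat.cast_add, Nat.cast_one, lt_irrefl, if_false,
            if_true] at hmode
          have := h.1
          split_ifs at hmode
          omega
      have hstep : f.traj σ' (pull g o a) (fun j => g (v j)) (j + 1) =
          f.next σ' (pull g o a) j
            (fun k => Warp.newCounter c g o j (e k), (f.traj σ a v (o j)).2) := by
        rw [FoldFun.traj, ih hj'.le]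
      have hold : f.traj σ a v (o j + 1) = f.next σ a (o j) (f.traj σ a v (o j)) := rfl
      rw [hstep, ← hstate]
      simp only [hnew, hc]
      rw [hold]
      unfold FoldFun.next
      simp only [hidx, length_pull, hpos]
      split_ifs with hrun
      · rw [getD_pull g o a (hpos.mpr hrun.2), FoldFun.step_eq, FoldFun.step_eq,
          FoldFun.select_congr hf (e := a.getD (o j) 0) (v := (f.traj σ a v (o j)).1)
            (fun t ht => w.lt_iff (hVW ht) _) hcmp]
        cases f.select σ (a.getD (o j) 0) (f.traj σ a v (o j)).1 (f.traj σ a v (o j)).2 with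
        | none => simp
        | some b => simp; rfl
      · simp
  have hN0 := w.cut_nonneg (self_mem_cuts N E)
  rw [f.eval_eq_traj σ' (pull g o a) _ (N := (g N).toNat)
      (by rw [length_pull]; exact w.toNat_map_le haN), key _ (by omega),
    f.eval_eq_traj σ a v haN]
  ext j
  simp only
  rw [w.newCounter_cut (self_mem_cuts N E), hc]

end Simulation

end AFL

/-! ### Values and folds that occur in a formula -/

namespace AFL

open Finset

section Values

mutual
/-- The values of the subterms of an integer term, including the lengths of the arrays. -/
def IntTerm.vals (σ : Interp) : IntTerm → List ℤ
  | .const n => [n]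
  | .var x => [σ.int x]
  | .add t u => (t.eval σ + u.eval σ) :: (t.vals σ ++ u.vals σ)
  | .read a t => readAt (a.eval σ) (t.eval σ) :: (a.vals σ ++ t.vals σ)
  | .length a => a.vals σ
/-- The values of the integer subterms of an array term, including its length. -/
def ArrTerm.vals (σ : Interp) : ArrTerm → List ℤ
  | .var a => [((σ.arr a).length : ℤ)]
  | .write a t u => a.vals σ ++ t.vals σ ++ u.vals σ
end

mutual
lemma IntTerm.length_vals_le (σ : Interp) : ∀ t : IntTerm, (t.vals σ).length ≤ t.size
  | .const n => by simp [IntTerm.vals, IntTerm.size, constSize]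
  | .var x => by simp [IntTerm.vals, IntTerm.size]
  | .add t u => by
      have := t.length_vals_le σ
      have := u.length_vals_le σ
      simp [IntTerm.vals, IntTerm.size]; omega
  | .read a t => by
      have := a.length_vals_le σ
      have := t.length_vals_le σ
      simp [IntTerm.vals, IntTerm.size]; omega
  | .length a => by
      have := a.length_vals_le σ
      simp [IntTerm.vals, IntTerm.size]; omega
lemma ArrTerm.length_vals_le (σ : Interp) : ∀ a : ArrTerm, (a.vals σ).length ≤ a.size
  | .var a => by simp [ArrTerm.vals, ArrTerm.size]
  | .write a t u => by
      have := a.length_vals_le σ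
      have := t.length_vals_le σ
      have := u.length_vals_le σ
      simp [ArrTerm.vals, ArrTerm.size]; omega
end

/-- The values of the subterms of an atomic guard. -/
def AtomicGuard.vals {k : ℕ} (σ : Interp) : AtomicGuard k → List ℤ
  | .elem _ t => t.vals σ
  | .index _ t => t.vals σ
  | .counter _ _ t => t.vals σ
  | .state _ _ => []

/-- The values of the terms in the guards of a function. -/
def FoldFun.vals {k : ℕ} (σ : Interp) (f : FoldFun k) : List ℤ :=
  f.branches.flatMap fun b => b.guard.flatMap (AtomicGuard.vals σ)

/-- The values of the integer terms in a vector term. -/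
def VecTerm.vals {k : ℕ} (σ : Interp) : VecTerm k → List ℤ
  | .tuple t => (List.finRange (k + 1)).flatMap fun j => (t j).vals σ
  | .fold a v f => a.vals σ ++ v.vals σ ++ f.vals σ

/-- The first position at which two sequences differ (`0` if there is none). -/
noncomputable def diffAt (l l' : List ℤ) : ℕ := sInf {i | l.getD i 0 ≠ l'.getD i 0}

lemma getD_diffAt_ne {l l' : List ℤ} (hlen : l.length = l'.length) (h : l ≠ l') :
    diffAt l l' < l.length ∧ l.getD (diffAt l l') 0 ≠ l'.getD (diffAt l l') 0 := by
  have hne : {i | l.getD i 0 ≠ l'.getD i 0}.Nonempty := by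
    by_contra hc
    refine h (List.ext_getElem hlen fun i h1 h2 => ?_)
    have : ¬ l.getD i 0 ≠ l'.getD i 0 := fun hi => hc ⟨i, hi⟩
    rw [not_not, List.getD_eq_getElem _ _ h1, List.getD_eq_getElem _ _ h2] at this
    exact this
  have hmem : l.getD (diffAt l l') 0 ≠ l'.getD (diffAt l l') 0 := Nat.sInf_mem hne
  refine ⟨?_, hmem⟩
  by_contra! hc
  rw [List.getD_eq_default _ _ hc, List.getD_eq_default _ _ (hlen ▸ hc)] at hmem
  exact hmem rfl

/-- The values of the integer terms in a formula, and for each array equation a position that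
witnesses that it is false, together with an entry there. -/
noncomputable def Formula.vals (σ : Interp) : Formula → List ℤ
  | .arrEq a b => (diffAt (a.eval σ) (b.eval σ) : ℤ) ::
      (a.eval σ).getD (diffAt (a.eval σ) (b.eval σ)) 0 :: (a.vals σ ++ b.vals σ)
  | .intEq t u => t.vals σ ++ u.vals σ
  | .intLt t u => t.vals σ ++ u.vals σ
  | .vecEq u v => u.vals σ ++ v.vals σ
  | .neg φ => φ.vals σ
  | .conj φ ψ => φ.vals σ ++ ψ.vals σ

lemma length_flatMap_le {α β : Type*} (l : List α) (f : α → List β) (s : α → ℕ)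
    (h : ∀ x ∈ l, (f x).length ≤ s x) : (l.flatMap f).length ≤ (l.map s).sum := by
  rw [List.length_flatMap]
  exact List.sum_le_sum h

lemma FoldFun.length_vals_le {k : ℕ} (σ : Interp) (f : FoldFun k) : (f.vals σ).length ≤ f.size := by
  unfold FoldFun.vals FoldFun.size
  refine (length_flatMap_le _ _ Branch.size fun b _ => ?_).trans (Nat.le_add_left _ _)
  unfold Branch.size
  refine (length_flatMap_le _ _ AtomicGuard.size fun gd _ => ?_).trans (by omega)
  cases gd with
  | elem op t => exact (t.length_vals_le σ).trans (by simp [AtomicGuard.size])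
  | index op t => exact (t.length_vals_le σ).trans (by simp [AtomicGuard.size])
  | counter j op t => exact (t.length_vals_le σ).trans (by simp [AtomicGuard.size])
  | state op n => simp [AtomicGuard.vals]

lemma VecTerm.length_vals_le {k : ℕ} (σ : Interp) (v : VecTerm k) : (v.vals σ).length ≤ v.size := by
  induction v with
  | tuple t =>
    unfold VecTerm.vals VecTerm.size
    refine (length_flatMap_le _ _ (fun j => (t j).size) fun j _ => (t j).length_vals_le σ).trans ?_
    rw [← List.ofFn_eq_map, List.sum_ofFn]
    omega
  | fold a v f ih =>
    have := a.length_vals_le σ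
    have := f.length_vals_le σ
    simp only [VecTerm.vals, VecTerm.size, List.length_append]
    omega

lemma Formula.length_vals_le (σ : Interp) (φ : Formula) : (φ.vals σ).length ≤ 2 * φ.size := by
  induction φ with
  | arrEq a b =>
    have := a.length_vals_le σ
    have := b.length_vals_le σ
    simp only [Formula.vals, Formula.size, List.length_append, List.length_cons]
    omega
  | intEq t u =>
    have := t.length_vals_le σ
    have := u.length_vals_le σ
    simp only [Formula.vals, Formula.size, List.length_append]
    omega
  | intLt t u =>
    have := t.length_vals_le σ
    have := u.length_vals_le σ
    simp only [Formula.vals, Formula.size, List.length_append]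
    omega
  | vecEq u v =>
    have := u.length_vals_le σ
    have := v.length_vals_le σ
    simp only [Formula.vals, Formula.size, List.length_append]
    omega
  | neg φ ih =>
    simp only [Formula.vals, Formula.size]
    omega
  | conj φ ψ ih1 ih2 =>
    simp only [Formula.vals, Formula.size, List.length_append]
    omega

end Values

section Folds

/-- An occurrence of a fold in a formula. -/
structure FoldOcc : Type where
  k : ℕ
  arr : ArrTerm
  start : VecTerm k
  fn : FoldFun k

/-- The folds that occur in a vector term. -/
def VecTerm.folds {k : ℕ} : VecTerm k → List FoldOcc
  | .tuple _ => []
  | .fold a v f => ⟨k, a, v, f⟩ :: v.folds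

/-- The folds that occur in a formula. -/
def Formula.folds : Formula → List FoldOcc
  | .arrEq _ _ => []
  | .intEq _ _ => []
  | .intLt _ _ => []
  | .vecEq u v => u.folds ++ v.folds
  | .neg φ => φ.folds
  | .conj φ ψ => φ.folds ++ ψ.folds

mutual
lemma IntTerm.size_pos : ∀ t : IntTerm, 1 ≤ t.size
  | .const n => by simp [IntTerm.size, constSize]
  | .var x => by simp [IntTerm.size]
  | .add t u => by simp [IntTerm.size]; omega
  | .read a t => by simp [IntTerm.size]; omega
  | .length a => by simp [IntTerm.size]
lemma ArrTerm.size_pos : ∀ a : ArrTerm, 1 ≤ a.size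
  | .var a => by simp [ArrTerm.size]
  | .write a t u => by simp [ArrTerm.size]; omega
end

lemma VecTerm.lt_size {k : ℕ} (v : VecTerm k) : k + 1 ≤ v.size := by
  induction v with
  | tuple t =>
    have : ∑ _j : Fin (_ + 1), 1 ≤ ∑ j, (t j).size := Finset.sum_le_sum fun j _ => (t j).size_pos
    simp at this
    simp only [VecTerm.size]
    omega
  | fold a v f ih => simp only [VecTerm.size]; omega

lemma VecTerm.length_folds_le {k : ℕ} (v : VecTerm k) : v.folds.length ≤ v.size := by
  induction v with
  | tuple t => simp [VecTerm.folds]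
  | fold a v f ih => simp only [VecTerm.folds, VecTerm.size, List.length_cons]; omega

lemma Formula.length_folds_le (φ : Formula) : φ.folds.length ≤ φ.size := by
  induction φ with
  | arrEq a b => simp [Formula.folds]
  | intEq t u => simp [Formula.folds]
  | intLt t u => simp [Formula.folds]
  | vecEq u v =>
    have := u.length_folds_le
    have := v.length_folds_le
    simp only [Formula.folds, Formula.size, List.length_append]; omega
  | neg φ ih => simp only [Formula.folds, Formula.size]; omega
  | conj φ ψ ih1 ih2 => simp only [Formula.folds, Formula.size, List.length_append]; omega

/-- The fold `I` belongs to an expression with the values `l` and the size `s`. -/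
def FoldOcc.Within (σ : Interp) (I : FoldOcc) (l : List ℤ) (s : ℕ) : Prop :=
  I.arr.vals σ ⊆ l ∧ I.fn.vals σ ⊆ l ∧ I.arr.size ≤ s ∧ I.fn.size ≤ s ∧ I.k + 1 ≤ s

lemma FoldOcc.Within.mono {σ : Interp} {I : FoldOcc} {l l' : List ℤ} {s s' : ℕ}
    (h : I.Within σ l s) (hl : l ⊆ l') (hs : s ≤ s') : I.Within σ l' s' :=
  ⟨List.Subset.trans h.1 hl, List.Subset.trans h.2.1 hl, h.2.2.1.trans hs,
    h.2.2.2.1.trans hs, h.2.2.2.2.trans hs⟩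

lemma VecTerm.within_of_mem {k : ℕ} (σ : Interp) (v : VecTerm k) {I : FoldOcc} (h : I ∈ v.folds) :
    I.Within σ (v.vals σ) v.size := by
  induction v with
  | tuple t => simp [VecTerm.folds] at h
  | fold a v f ih =>
    rcases List.mem_cons.mp h with rfl | h
    · have := v.lt_size
      refine ⟨?_, ?_, ?_, ?_, ?_⟩ <;> simp only [VecTerm.vals, VecTerm.size] <;>
        first | omega | intro x hx; simp [hx]
    · exact (ih h).mono (fun x hx => by simp [VecTerm.vals, hx]) (by simp [VecTerm.size]; omega)

lemma Formula.within_of_mem (σ : Interp) (φ : Formula) {I : FoldOcc} (h : I ∈ φ.folds) :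
    I.Within σ (φ.vals σ) φ.size := by
  induction φ with
  | arrEq a b => simp [Formula.folds] at h
  | intEq t u => simp [Formula.folds] at h
  | intLt t u => simp [Formula.folds] at h
  | vecEq u v =>
    rcases List.mem_append.mp h with h | h
    · exact (u.within_of_mem σ h).mono (fun x hx => by simp [Formula.vals, hx])
        (by simp [Formula.size]; omega)
    · exact (v.within_of_mem σ h).mono (fun x hx => by simp [Formula.vals, hx])
        (by simp [Formula.size])
  | neg φ ih =>
    exact (ih h).mono (fun x hx => by simp [Formula.vals, hx]) (by simp [Formula.size])
  | conj φ ψ ih1 ih2 =>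
    rcases List.mem_append.mp h with h | h
    · exact (ih1 h).mono (fun x hx => by simp [Formula.vals, hx])
        (by simp [Formula.size]; omega)
    · exact (ih2 h).mono (fun x hx => by simp [Formula.vals, hx])
        (by simp [Formula.size])

lemma FoldFun.branch_size_le {k : ℕ} (f : FoldFun k) {b : Branch k} (hb : b ∈ f.branches) :
    b.size ≤ f.size := by
  have := List.le_sum_of_mem (List.mem_map_of_mem (f := Branch.size) hb)
  unfold FoldFun.size
  omega

lemma Branch.guard_size_le {k : ℕ} (b : Branch k) {gd : AtomicGuard k} (h : gd ∈ b.guard) :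
    gd.size ≤ b.size := by
  have := List.le_sum_of_mem (List.mem_map_of_mem (f := AtomicGuard.size) h)
  unfold Branch.size
  omega

lemma Branch.upd_size_le {k : ℕ} (b : Branch k) {u : AtomicUpdate k} (h : u ∈ b.upd) :
    u.size ≤ b.size := by
  have := List.le_sum_of_mem (List.mem_map_of_mem (f := AtomicUpdate.size) h)
  unfold Branch.size
  omega

lemma abs_le_two_pow_of_constSize_le {n : ℤ} {s : ℕ} (h : constSize n ≤ s) : |n| ≤ 2 ^ s := by
  have h1 := Nat.lt_size_self n.natAbs
  have h2 : 2 ^ n.natAbs.size ≤ 2 ^ s :=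
    Nat.pow_le_pow_right (by norm_num) (by unfold constSize at h; omega)
  rw [Int.abs_eq_natAbs]
  exact_mod_cast (h1.trans_le h2).le

lemma FoldFun.abs_delta_le {k : ℕ} (f : FoldFun k) {b : Branch k} (hb : b ∈ f.branches) {s : ℕ}
    (hs : f.size ≤ s) (j : Fin (k + 1)) : |b.delta j| ≤ 2 ^ s := by
  have h1 : (1 : ℤ) ≤ 2 ^ s := one_le_pow₀ (by norm_num)
  refine Fin.cases ?_ (fun j => ?_) j
  · simpa [Branch.delta] using h1
  · simp only [Branch.delta, Fin.cons_succ]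
    cases h : (b.increments j).head? with
    | none => simp
    | some n =>
      have hn := List.mem_of_head? h
      unfold Branch.increments at hn
      obtain ⟨u, hu, hun⟩ := List.mem_filterMap.mp hn
      have hsize := (b.upd_size_le hu).trans ((f.branch_size_le hb).trans hs)
      cases u with
      | incr j' n' =>
        simp only at hun
        split_ifs at hun
        rw [Option.some.injEq] at hun
        subst hun
        simp only [AtomicUpdate.size] at hsize
        rw [Option.getD_some]
        exact abs_le_two_pow_of_constSize_le (by omega)
      | setState n => simp at hun
      | skip => simp at hun
      | brk => simp at hun

lemma FoldFun.card_stateSet_le {k : ℕ} (f : FoldFun k) : #f.stateSet ≤ f.size := by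
  unfold FoldFun.stateSet FoldFun.size
  refine (card_insert_le _ _).trans ?_
  rw [add_comm]
  refine Nat.add_le_add_left ((List.toFinset_card_le _).trans ?_) 1
  refine length_flatMap_le _ _ Branch.size fun b _ => ?_
  have h1 : (b.upd.map fun _ => 1).sum ≤ (b.upd.map AtomicUpdate.size).sum :=
    List.sum_le_sum fun u _ => by cases u <;> simp [AtomicUpdate.size] <;> omega
  have h2 : b.stateUpdates.length ≤ b.upd.length := List.length_filterMap_le _ _
  simp at h1
  unfold Branch.size
  omega

end Folds

end AFL

/-! ### Transport of a formula along a warp, and small models -/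

namespace AFL

open Finset

section Transfer

/-- The interpretation transported along a warp: `g` is applied to all integers, and the entry at
the new position `j` comes from the old position `o j`. -/
def Interp.warp (σ : Interp) (g : ℤ → ℤ) (o : ℕ → ℕ) : Interp where
  int x := g (σ.int x)
  arr a := pull g o (σ.arr a)

variable {X κ : Type*} {N : ℕ} {S : ℕ → X} {c : ℕ → κ → ℤ} {E : Finset ℕ} {W : Finset ℤ}
  {P : ℕ} {B : ℤ} {g : ℤ → ℤ} {o : ℕ → ℕ}

lemma length_writeAt (a : List ℤ) (i x : ℤ) : (writeAt a i x).length = a.length := by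
  unfold writeAt; split_ifs <;> simp

/-- `V` is a set of tracked values for the warp: its elements are values on which the map of the
warp is controlled, its nonnegative elements do not exceed `N`, and as times they are events. -/
structure Tracks (N : ℕ) (E : Finset ℕ) (W V : Finset ℤ) : Prop where
  subset : V ⊆ W
  event : ∀ i : ℕ, (i : ℤ) ∈ V → i < N → i ∈ E
  le : ∀ i : ℕ, (i : ℤ) ∈ V → i ≤ N

variable {V : Finset ℤ}

lemma one_le_two_pow_int (P : ℕ) : (1 : ℤ) ≤ 2 ^ P := one_le_pow₀ (by norm_num)

/-- A tracked position inside of a tracked sequence is the origin of exactly one new position. -/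
lemma Tracks.origin_eq_iff (h : Tracks N E W V) (w : Warp N S c E W (2 ^ P) B g o) {n i : ℕ}
    (hnV : (n : ℤ) ∈ V) (hiV : (i : ℤ) ∈ V) (hin : i < n) {j : ℕ} (hj : j < (g n).toNat) :
    o j = i ↔ j = (g i).toNat := by
  have hnN := h.le n hnV
  have hE := h.event i hiV (by omega)
  have h1 := w.toNat_map_le hnN
  have h2 := w.origin_eq_iff (one_le_two_pow_int P) hE (j := j) (by omega)
  have h3 := w.cut_nonneg (mem_cuts_of_mem (N := N) hE)
  omega

lemma Tracks.toNat_lt (h : Tracks N E W V) (w : Warp N S c E W (2 ^ P) B g o) {n i : ℕ}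
    (hnV : (n : ℤ) ∈ V) (hiV : (i : ℤ) ∈ V) (hin : i < n) :
    (g i).toNat < (g n).toNat ∧ ((g i).toNat : ℤ) = g i := by
  have hE := h.event i hiV (by have := h.le n hnV; omega)
  have h3 := w.cut_nonneg (mem_cuts_of_mem (N := N) hE)
  have h4 := w.lt_of_lt n (h.subset hnV) i (by omega)
  omega

lemma Tracks.readAt_pull (h : Tracks N E W V) (w : Warp N S c E W (2 ^ P) B g o) (l : List ℤ)
    (i : ℤ) (hl : (l.length : ℤ) ∈ V) (hi : i ∈ V) :
    readAt (pull g o l) (g i) = g (readAt l i) := by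
  have h0 := w.lt_iff w.zero_mem i
  rw [w.map_zero] at h0
  unfold readAt
  by_cases hneg : i < 0
  · rw [if_pos hneg, if_pos (h0.1.mpr hneg), w.map_zero]
  · rw [if_neg hneg, if_neg (fun hc => hneg (h0.1.mp hc))]
    obtain ⟨n, rfl⟩ := Int.eq_ofNat_of_zero_le (not_lt.mp hneg)
    rw [Int.toNat_natCast]
    by_cases hlen : n < l.length
    · obtain ⟨h1, -⟩ := h.toNat_lt w hl hi hlen
      rw [getD_pull g o l h1, (h.origin_eq_iff w hl hi hlen h1).mpr rfl]
    · have h1 : g l.length ≤ g n := by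
        have := w.lt_iff (h.subset hi) l.length
        omega
      rw [List.getD_eq_default _ _ (not_lt.mp hlen), w.map_zero,
        List.getD_eq_default _ _ (by rw [length_pull]; omega)]

lemma Tracks.writeAt_pull (h : Tracks N E W V) (w : Warp N S c E W (2 ^ P) B g o) (l : List ℤ)
    (i x : ℤ) (hl : (l.length : ℤ) ∈ V) (hi : i ∈ V) :
    writeAt (pull g o l) (g i) (g x) = pull g o (writeAt l i x) := by
  have h0 := w.lt_iff w.zero_mem i
  rw [w.map_zero] at h0
  unfold writeAt
  by_cases hneg : i < 0
  · rw [if_pos hneg, if_pos (h0.1.mpr hneg)]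
  · rw [if_neg hneg, if_neg (fun hc => hneg (h0.1.mp hc))]
    obtain ⟨n, rfl⟩ := Int.eq_ofNat_of_zero_le (not_lt.mp hneg)
    rw [Int.toNat_natCast]
    by_cases hlen : n < l.length
    · obtain ⟨h1, -⟩ := h.toNat_lt w hl hi hlen
      refine List.ext_getElem (by simp [length_pull]) fun j hj1 hj2 => ?_
      rw [List.length_set, length_pull] at hj1
      have hiff := h.origin_eq_iff w hl hi hlen hj1
      rw [List.getElem_set]
      simp only [pull, List.getElem_map, List.getElem_range]
      have hoN : o j < l.length := (w.lt_length_iff h.event (h.le _ hl) hl (by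
        have := w.toNat_map_le (h.le _ hl); omega)).mp hj1
      rw [List.getD_eq_getElem _ _ hoN, List.getD_eq_getElem _ _ (by rwa [List.length_set]),
        List.getElem_set]
      by_cases hjn : o j = n
      · rw [if_pos (hiff.mp hjn).symm, if_pos hjn.symm]
      · rw [if_neg (fun hc => hjn (hiff.mpr hc.symm)), if_neg (fun hc => hjn hc.symm)]
    · have h1 : g l.length ≤ g n := by
        have := w.lt_iff (h.subset hi) l.length
        omega
      rw [List.set_eq_of_length_le (by rw [length_pull]; omega),
        List.set_eq_of_length_le (not_lt.mp hlen)]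

mutual
lemma IntTerm.transfers_of_vals (h : Tracks N E W V) (w : Warp N S c E W (2 ^ P) B g o)
    (σ : Interp) : ∀ t : IntTerm, (∀ x ∈ t.vals σ, x ∈ V) → t.size ≤ P →
      t.Transfers σ (σ.warp g o) V g
  | .const n, hV, hP => by
      have hn : n ∈ V := hV n (by simp [IntTerm.vals])
      refine ⟨by simpa [IntTerm.eval] using hn, ?_⟩
      simp only [IntTerm.eval]
      exact (w.map_small n (h.subset hn)
        (abs_le_two_pow_of_constSize_le (by simpa [IntTerm.size] using hP))).symm
  | .var x, hV, hP => by
      exact ⟨hV _ (by simp [IntTerm.vals, IntTerm.eval]), by simp [IntTerm.eval, Interp.warp]⟩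
  | .add t u, hV, hP => by
      simp only [IntTerm.size] at hP
      obtain ⟨t1, t2⟩ := t.transfers_of_vals h w σ
        (fun x hx => hV x (by simp [IntTerm.vals, hx])) (by omega)
      obtain ⟨u1, u2⟩ := u.transfers_of_vals h w σ
        (fun x hx => hV x (by simp [IntTerm.vals, hx])) (by omega)
      have hsum : t.eval σ + u.eval σ ∈ V := hV _ (by simp [IntTerm.vals])
      refine ⟨by simpa [IntTerm.eval] using hsum, ?_⟩
      simp only [IntTerm.eval]
      rw [t2, u2, w.map_add _ (h.subset t1) _ (h.subset u1) (h.subset hsum)]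
  | .read a t, hV, hP => by
      simp only [IntTerm.size] at hP
      obtain ⟨t1, t2⟩ := t.transfers_of_vals h w σ
        (fun x hx => hV x (by simp [IntTerm.vals, hx])) (by omega)
      obtain ⟨a1, a2⟩ := a.transfers_of_vals h w σ
        (fun x hx => hV x (by simp [IntTerm.vals, hx])) (by omega)
      refine ⟨hV _ (by simp [IntTerm.vals, IntTerm.eval]), ?_⟩
      simp only [IntTerm.eval]
      rw [t2, a2, h.readAt_pull w _ _ a1 t1]
  | .length a, hV, hP => by
      simp only [IntTerm.size] at hP
      obtain ⟨a1, a2⟩ := a.transfers_of_vals h w σ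
        (fun x hx => hV x (by simp [IntTerm.vals, hx])) (by omega)
      refine ⟨by simpa [IntTerm.eval] using a1, ?_⟩
      simp only [IntTerm.eval]
      rw [a2, length_pull, Int.toNat_of_nonneg]
      have h0 := w.lt_iff w.zero_mem (a.eval σ).length
      rw [w.map_zero] at h0
      omega
lemma ArrTerm.transfers_of_vals (h : Tracks N E W V) (w : Warp N S c E W (2 ^ P) B g o)
    (σ : Interp) : ∀ a : ArrTerm, (∀ x ∈ a.vals σ, x ∈ V) → a.size ≤ P →
      ((a.eval σ).length : ℤ) ∈ V ∧ a.eval (σ.warp g o) = pull g o (a.eval σ)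
  | .var a, hV, hP => by
      exact ⟨hV _ (by simp [ArrTerm.vals, ArrTerm.eval]), by simp [ArrTerm.eval, Interp.warp]⟩
  | .write a t u, hV, hP => by
      simp only [ArrTerm.size] at hP
      obtain ⟨a1, a2⟩ := a.transfers_of_vals h w σ
        (fun x hx => hV x (by simp [ArrTerm.vals, hx])) (by omega)
      obtain ⟨t1, t2⟩ := t.transfers_of_vals h w σ
        (fun x hx => hV x (by simp [ArrTerm.vals, hx])) (by omega)
      obtain ⟨u1, u2⟩ := u.transfers_of_vals h w σ
        (fun x hx => hV x (by simp [ArrTerm.vals, hx])) (by omega)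
      simp only [ArrTerm.eval]
      rw [length_writeAt, a2, t2, u2, h.writeAt_pull w _ _ _ a1 t1]
      exact ⟨a1, rfl⟩
end

lemma FoldFun.transfers_of_vals (h : Tracks N E W V) (w : Warp N S c E W (2 ^ P) B g o)
    (σ : Interp) {k : ℕ} (f : FoldFun k) (hV : ∀ x ∈ f.vals σ, x ∈ V) (hP : f.size ≤ P) :
    f.Transfers σ (σ.warp g o) V g := by
  intro b hb gd hgd
  have h1 := b.guard_size_le hgd
  have h2 := f.branch_size_le hb
  have h3 : ∀ x ∈ gd.vals σ, x ∈ V := fun x hx => hV x (by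
    simp only [FoldFun.vals, List.mem_flatMap]
    exact ⟨b, hb, gd, hgd, hx⟩)
  cases gd with
  | elem op t =>
    exact t.transfers_of_vals h w σ h3 (by simp only [AtomicGuard.size] at h1; omega)
  | index op t =>
    exact t.transfers_of_vals h w σ h3 (by simp only [AtomicGuard.size] at h1; omega)
  | counter j op t =>
    exact t.transfers_of_vals h w σ h3 (by simp only [AtomicGuard.size] at h1; omega)
  | state op n => trivial

/-- The value of the fold `I` is transported by the warp if its initial vector is. -/
def FoldOcc.Simulated (σ : Interp) (W : Finset ℤ) (g : ℤ → ℤ) (o : ℕ → ℕ) (I : FoldOcc) : Prop :=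
  I.fn.eval (σ.warp g o) (pull g o (I.arr.eval σ)) (fun j => g (I.start.eval σ j)) =
      (fun j => g (I.fn.eval σ (I.arr.eval σ) (I.start.eval σ) j)) ∧
    ∀ j, I.fn.eval σ (I.arr.eval σ) (I.start.eval σ) j ∈ W

/-- The start of a fold may itself be a fold, so its value has to be in `W`, not just in `V`. -/
lemma VecTerm.eval_warp (h : Tracks N E W V) (w : Warp N S c E W (2 ^ P) B g o) (σ : Interp)
    {k : ℕ} (v : VecTerm k) (hV : ∀ x ∈ v.vals σ, x ∈ V) (hP : v.size ≤ P)
    (hfold : ∀ I ∈ v.folds, I.Simulated σ W g o) :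
    v.eval (σ.warp g o) = (fun j => g (v.eval σ j)) ∧ ∀ j, v.eval σ j ∈ W := by
  induction v with
  | tuple t =>
    have ht : ∀ j, (t j).Transfers σ (σ.warp g o) V g := fun j =>
      (t j).transfers_of_vals h w σ (fun x hx => hV x (by
        simp only [VecTerm.vals, List.mem_flatMap]
        exact ⟨j, List.mem_finRange j, hx⟩)) (by
        have := Finset.single_le_sum (f := fun j => (t j).size) (fun _ _ => Nat.zero_le _)
          (Finset.mem_univ j)
        simp only [VecTerm.size] at hP
        omega)
    exact ⟨funext fun j => (ht j).2, fun j => h.subset (ht j).1⟩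
  | fold a v f ih =>
    simp only [VecTerm.size] at hP
    obtain ⟨h1, -⟩ := ih (fun x hx => hV x (by simp [VecTerm.vals, hx])) (by omega)
      fun I hI => hfold I (by simp [VecTerm.folds, hI])
    obtain ⟨-, h2⟩ := a.transfers_of_vals h w σ (fun x hx => hV x (by simp [VecTerm.vals, hx]))
      (by omega)
    obtain ⟨h3, h4⟩ := hfold ⟨_, a, v, f⟩ (by simp [VecTerm.folds])
    refine ⟨?_, h4⟩
    simp only [VecTerm.eval]
    rw [h1, h2]
    exact h3

/-- A warp that transports the values of all folds of `φ` preserves the truth of `φ`. A false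
array equation stays false because a position where the arrays differ is tracked, together with
the entry of one of them. -/
lemma Formula.sat_warp (h : Tracks N E W V) (w : Warp N S c E W (2 ^ P) B g o) (σ : Interp)
    (φ : Formula) (hV : ∀ x ∈ φ.vals σ, x ∈ V) (hP : φ.size ≤ P)
    (hfold : ∀ I ∈ φ.folds, I.Simulated σ W g o) : φ.Sat (σ.warp g o) ↔ φ.Sat σ := by
  induction φ with
  | arrEq a b =>
    simp only [Formula.size] at hP
    obtain ⟨a1, a2⟩ := a.transfers_of_vals h w σ (fun x hx => hV x (by simp [Formula.vals, hx]))
      (by omega)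
    obtain ⟨b1, b2⟩ := b.transfers_of_vals h w σ (fun x hx => hV x (by simp [Formula.vals, hx]))
      (by omega)
    simp only [Formula.Sat]
    rw [a2, b2]
    refine ⟨fun heq => ?_, fun heq => by rw [heq]⟩
    by_contra hne
    have hlen : (a.eval σ).length = (b.eval σ).length := by
      have h1 := congrArg List.length heq
      rw [length_pull, length_pull] at h1
      have h2 := w.lt_iff (h.subset a1) (b.eval σ).length
      have h3 := w.lt_iff w.zero_mem (a.eval σ).length
      have h4 := w.lt_iff w.zero_mem (b.eval σ).length
      rw [w.map_zero] at h3 h4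
      omega
    obtain ⟨hi, hd⟩ := getD_diffAt_ne hlen hne
    have hiV : (diffAt (a.eval σ) (b.eval σ) : ℤ) ∈ V := hV _ (by simp [Formula.vals])
    have hxV : (a.eval σ).getD (diffAt (a.eval σ) (b.eval σ)) 0 ∈ V :=
      hV _ (by simp [Formula.vals])
    obtain ⟨h1, -⟩ := h.toNat_lt w a1 hiV hi
    have ho := (h.origin_eq_iff w a1 hiV hi h1).mpr rfl
    have h2 := congrArg (fun l => l.getD (g (diffAt (a.eval σ) (b.eval σ) : ℤ)).toNat 0) heq
    rw [getD_pull g o _ h1, getD_pull g o _ (hlen ▸ h1), ho] at h2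
    exact hd ((w.eq_iff (h.subset hxV) _).mp h2.symm).symm
  | intEq t u =>
    simp only [Formula.size] at hP
    obtain ⟨t1, t2⟩ := t.transfers_of_vals h w σ (fun x hx => hV x (by simp [Formula.vals, hx]))
      (by omega)
    obtain ⟨u1, u2⟩ := u.transfers_of_vals h w σ (fun x hx => hV x (by simp [Formula.vals, hx]))
      (by omega)
    simp only [Formula.Sat]
    rw [t2, u2, w.eq_iff (h.subset u1)]
  | intLt t u =>
    simp only [Formula.size] at hP
    obtain ⟨t1, t2⟩ := t.transfers_of_vals h w σ (fun x hx => hV x (by simp [Formula.vals, hx]))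
      (by omega)
    obtain ⟨u1, u2⟩ := u.transfers_of_vals h w σ (fun x hx => hV x (by simp [Formula.vals, hx]))
      (by omega)
    simp only [Formula.Sat]
    rw [t2, u2, (w.lt_iff (h.subset u1) _).1]
  | vecEq u v =>
    simp only [Formula.size] at hP
    obtain ⟨u1, u2⟩ := u.eval_warp h w σ (fun x hx => hV x (by simp [Formula.vals, hx]))
      (by omega) fun I hI => hfold I (by simp [Formula.folds, hI])
    obtain ⟨v1, v2⟩ := v.eval_warp h w σ (fun x hx => hV x (by simp [Formula.vals, hx]))
      (by omega) fun I hI => hfold I (by simp [Formula.folds, hI])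
    simp only [Formula.Sat]
    rw [u1, v1, funext_iff, funext_iff]
    exact forall_congr' fun j => w.eq_iff (v2 j) _
  | neg φ ih =>
    simp only [Formula.size] at hP
    simp only [Formula.Sat]
    rw [ih hV (by omega) hfold]
  | conj φ ψ ih1 ih2 =>
    simp only [Formula.size] at hP
    simp only [Formula.Sat]
    rw [ih1 (fun x hx => hV x (by simp [Formula.vals, hx])) (by omega)
        fun I hI => hfold I (by simp [Formula.folds, hI]),
      ih2 (fun x hx => hV x (by simp [Formula.vals, hx])) (by omega)
        fun I hI => hfold I (by simp [Formula.folds, hI])]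

end Transfer

section SmallModel

/-- The trajectory of an occurrence of a fold in the model `σ`. -/
def FoldOcc.traj (σ : Interp) (I : FoldOcc) : ℕ → (Fin (I.k + 1) → ℤ) × ℤ :=
  I.fn.traj σ (I.arr.eval σ) (I.start.eval σ)

/-- The phases of an occurrence of a fold in the model `σ`. -/
noncomputable def FoldOcc.phase (σ : Interp) (I : FoldOcc) : ℕ → ℕ :=
  I.fn.phase σ (I.arr.eval σ) (I.start.eval σ)

/-- The index and the counters of all folds of `φ`. -/
abbrev Formula.Counter (φ : Formula) : Type :=
  (q : Fin φ.folds.length) × Fin ((φ.folds.get q).k + 1)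

/-- The values of the index and the counters of all folds of `φ` at time `i`. -/
def Formula.counters (φ : Formula) (σ : Interp) (i : ℕ) (x : φ.Counter) : ℤ :=
  ((φ.folds.get x.1).traj σ i).1 x.2

/-- The states of all folds of `φ` at time `i`. -/
def Formula.foldStates (φ : Formula) (σ : Interp) (i : ℕ) (q : Fin φ.folds.length) : ℤ :=
  ((φ.folds.get q).traj σ i).2

/-- The times before `N` which are elements of `V`, or after which the phase of a fold or the
position of a counter relative to `V` changes. -/
noncomputable def Formula.events (φ : Formula) (σ : Interp) (V : Finset ℤ) (N : ℕ) : Finset ℕ :=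
  {i ∈ range N | (i : ℤ) ∈ V} ∪ univ.biUnion fun x : φ.Counter =>
    {i ∈ range N | (φ.folds.get x.1).phase σ i ≠ (φ.folds.get x.1).phase σ (i + 1) ∨
      cls V (φ.counters σ i x) ≠ cls V (φ.counters σ (i + 1) x)}

lemma Formula.card_counter_le (φ : Formula) : Fintype.card φ.Counter ≤ φ.size * φ.size := by
  rw [Fintype.card_sigma]
  calc ∑ q, Fintype.card (Fin ((φ.folds.get q).k + 1)) ≤ ∑ _q : Fin φ.folds.length, φ.size :=
        Finset.sum_le_sum fun q _ => by
          rw [Fintype.card_fin]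
          exact (φ.within_of_mem ⟨fun _ => 0, fun _ => []⟩ (List.get_mem _ q)).2.2.2.2
    _ = φ.folds.length * φ.size := by simp
    _ ≤ _ := Nat.mul_le_mul_right _ φ.length_folds_le

/-- The number of events is polynomial: there are few phases, and within a phase each counter
passes each element of `V` at most once. -/
lemma Formula.card_events_le (φ : Formula) (σ : Interp) (V : Finset ℤ) (N : ℕ) :
    #(φ.events σ V N) ≤ #V + φ.size * φ.size * ((φ.size + 3) * (2 * #V + 1)) := by
  refine (card_union_le _ _).trans (add_le_add ?_ ?_)
  · refine card_le_card_of_injOn (fun i : ℕ => (i : ℤ)) (fun i hi => ?_)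
      (fun i _ j _ h => by simpa using h)
    simp only [coe_filter, Set.mem_ofPred_eq] at hi
    exact hi.2
  · refine card_biUnion_le.trans ((Finset.sum_le_card_nsmul _ _ _ fun x _ => ?_).trans
      (by rw [smul_eq_mul]; exact Nat.mul_le_mul_right _ φ.card_counter_le))
    set I := φ.folds.get x.1 with hI
    have hsize : I.fn.size ≤ φ.size := (φ.within_of_mem σ (List.get_mem _ x.1)).2.2.2.1
    refine card_changes_le N _ _ _ _ (I.fn.phase_antitone σ _ _) (fun i => ?_) (fun i => ?_)
      fun ρ => ?_
    · have h1 : I.phase σ i ≤ _ := I.fn.phase_le σ (I.arr.eval σ) (I.start.eval σ) i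
      have h2 := I.fn.card_stateSet_le
      omega
    · have := cls_le V (φ.counters σ i x)
      omega
    · exact (I.fn.phase_monotone σ (I.arr.eval σ) (I.start.eval σ) ρ x.2).imp
        (fun h i h1 h2 => cls_mono V (h i h1 h2)) fun h i h1 h2 => cls_mono V (h i h1 h2)

lemma Formula.simulated (φ : Formula) {σ : Interp} {V W : Finset ℤ} {N P : ℕ} {B : ℤ} {g : ℤ → ℤ}
    {o : ℕ → ℕ} (h : Tracks N (φ.events σ V N) W V)
    (w : Warp N (φ.foldStates σ) (φ.counters σ) (φ.events σ V N) W (2 ^ P) B g o)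
    (hV : ∀ x ∈ φ.vals σ, x ∈ V) (hP : φ.size ≤ P) {I : FoldOcc} (hI : I ∈ φ.folds) :
    I.Simulated σ W g o := by
  obtain ⟨q, rfl⟩ := List.mem_iff_get.mp hI
  obtain ⟨h1, h2, h3, h4, -⟩ := φ.within_of_mem σ hI
  set I := φ.folds.get q with hIq
  obtain ⟨a1, -⟩ := I.arr.transfers_of_vals h w σ (fun x hx => hV x (h1 hx)) (h3.trans hP)
  have haN := h.le _ a1
  have hlt : ∀ i ∈ φ.events σ V N, i < N := by
    intro i hi
    simp only [Formula.events, mem_union, mem_filter, mem_range, mem_biUnion] at hi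
    rcases hi with hi | ⟨x, -, hi⟩ <;> exact hi.1
  constructor
  · refine I.fn.eval_warp w (one_le_two_pow_int P) h.subset hlt h.event
      (I.fn.transfers_of_vals h w σ (fun x hx => hV x (h2 hx)) (h4.trans hP)) (I.arr.eval σ) haN a1
      (I.start.eval σ) (fun i m him => congrFun him q) (fun j => ⟨q, j⟩) (fun i j => rfl) ?_
    intro i hi hiE j
    by_contra hc
    refine hiE (mem_union_right _ (mem_biUnion.mpr ⟨⟨q, j⟩, mem_univ _, ?_⟩))
    simp only [mem_filter, mem_range]
    exact ⟨hi, by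
      by_contra hc'
      push Not at hc'
      exact hc hc'⟩
  · intro j
    rw [I.fn.eval_eq_traj σ _ _ haN]
    exact w.counter_mem N (self_mem_cuts _ _) ⟨q, j⟩

lemma FoldOcc.abs_traj_sub_le (σ : Interp) (I : FoldOcc) {P : ℕ} (hP : I.fn.size ≤ P) (i : ℕ)
    (j : Fin (I.k + 1)) : |(I.traj σ (i + 1)).1 j - (I.traj σ i).1 j| ≤ 2 ^ P := by
  have h2 : (0 : ℤ) ≤ 2 ^ P := by positivity
  unfold FoldOcc.traj
  rcases I.fn.traj_succ_cases σ (I.arr.eval σ) (I.start.eval σ) i with h | ⟨b, hb, -, -, h⟩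
  · rwa [h, sub_self, abs_zero]
  · rw [h]
    simpa using I.fn.abs_delta_le hb hP j

lemma Formula.two_le_size (φ : Formula) : 2 ≤ φ.size := by
  induction φ with
  | arrEq a b => have := a.size_pos; simp only [Formula.size]; omega
  | intEq t u => have := t.size_pos; simp only [Formula.size]; omega
  | intLt t u => have := t.size_pos; simp only [Formula.size]; omega
  | vecEq u v => have := u.lt_size; simp only [Formula.size]; omega
  | neg φ ih => simp only [Formula.size]; omega
  | conj φ ψ ih1 ih2 => simp only [Formula.size]; omega

/-- Every model can be replaced by a small one. -/
theorem Formula.exists_small_model (φ : Formula) (σ : Interp) (hσ : φ.Sat σ) :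
    ∃ σ' : Interp, φ.Sat σ' ∧ (∀ x, |σ'.int x| ≤ 2 ^ φ.size ^ (8 * 40)) ∧
      ∀ a, (σ'.arr a).length ≤ 2 ^ φ.size ^ (8 * 40) ∧
        ∀ z ∈ σ'.arr a, |z| ≤ 2 ^ φ.size ^ (8 * 40) := by
  classical
  set s := φ.size with hs
  have hs2 : 2 ≤ s := φ.two_le_size
  set V := (φ.vals σ).toFinset with hV
  -- The timeline is long enough for all arrays of `φ`, as their lengths belong to `V`.
  set N := V.sup Int.toNat with hN
  set E := φ.events σ V N with hE
  have hVcard : #V ≤ 2 * s := (List.toFinset_card_le _).trans (φ.length_vals_le σ)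
  have hVN : ∀ i : ℕ, (i : ℤ) ∈ V → i ≤ N := fun i hi => by
    simpa using Finset.le_sup (f := Int.toNat) hi
  have hlt : ∀ i ∈ E, i < N := by
    intro i hi
    simp only [hE, Formula.events, mem_union, mem_filter, mem_range, mem_biUnion] at hi
    rcases hi with hi | ⟨x, -, hi⟩ <;> exact hi.1
  have hmono : ∀ {a b}, a ≤ b → s ^ a ≤ s ^ b := fun h => Nat.pow_le_pow_right (by omega) h
  have hs1 : s ≤ s ^ 8 := Nat.le_self_pow (by norm_num) s
  have hs22 : 2 * s ≤ s ^ 2 := by nlinarith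
  have hEcard : #E ≤ s ^ 8 := by
    have h1 : #E ≤ _ := φ.card_events_le σ V N
    rw [← hs] at h1
    have h2 : s * s * ((s + 3) * (2 * #V + 1)) ≤ s * s * ((3 * s) * (5 * s)) := by
      gcongr <;> omega
    have h3 : 2 ^ 4 * s ^ 4 ≤ s ^ 4 * s ^ 4 := Nat.mul_le_mul_right _ (Nat.pow_le_pow_left hs2 4)
    have h4 : s ^ 2 ≤ s ^ 4 := hmono (by norm_num)
    calc #E ≤ 2 * s + s * s * ((3 * s) * (5 * s)) := by omega
      _ = 2 * s + 15 * s ^ 4 := by ring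
      _ ≤ 2 ^ 4 * s ^ 4 := by omega
      _ ≤ s ^ 4 * s ^ 4 := h3
      _ = s ^ 8 := by ring
  -- The product states of all folds: exponentially many, which the warp allows.
  let T : Finset (Fin φ.folds.length → ℤ) :=
    Fintype.piFinset fun q => (φ.folds.get q).fn.stateSet
  have hTcard : #T ≤ 2 ^ s ^ 8 := by
    calc #T = ∏ q, #(φ.folds.get q).fn.stateSet := Fintype.card_piFinset _
      _ ≤ ∏ _q : Fin φ.folds.length, s := Finset.prod_le_prod' fun q _ =>
          (FoldFun.card_stateSet_le _).trans (φ.within_of_mem σ (List.get_mem _ q)).2.2.2.1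
      _ = s ^ φ.folds.length := by simp
      _ ≤ s ^ s := Nat.pow_le_pow_right (by omega) φ.length_folds_le
      _ ≤ (2 ^ s) ^ s := Nat.pow_le_pow_left (Nat.lt_two_pow_self).le s
      _ = 2 ^ s ^ 2 := by rw [← pow_mul, sq]
      _ ≤ _ := Nat.pow_le_pow_right (by norm_num) (hmono (by norm_num))
  obtain ⟨W, g, o, hVW, w⟩ := exists_warp N (φ.foldStates σ) (φ.counters σ) E V T (s ^ 8)
    (by omega) hlt hEcard (hVcard.trans (hs22.trans (hmono (by norm_num))))
    (φ.card_counter_le.trans (by rw [← hs, ← sq]; exact hmono (by norm_num))) hTcard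
    (fun i _ => by
      rw [Fintype.mem_piFinset]
      intro q
      rw [FoldFun.mem_stateSet]
      exact FoldFun.traj_state_mem _ σ _ _ i)
    (fun i _ x => by
      exact FoldOcc.abs_traj_sub_le σ _ ((φ.within_of_mem σ (List.get_mem _ x.1)).2.2.2.1.trans hs1)
        i x.2)
  have htr : Tracks N E W V := ⟨hVW, fun i hi hiN => mem_union_left _ (by simp [hi, hiN]), hVN⟩
  have hvals : ∀ x ∈ φ.vals σ, x ∈ V := fun x hx => by simpa [hV] using hx
  have hbound : ∀ e, |g e| ≤ 2 ^ s ^ (8 * 40) := fun e => by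
    have := w.bound e
    rwa [← pow_mul] at this
  refine ⟨σ.warp g o, (φ.sat_warp htr w σ hvals hs1 fun I hI =>
    φ.simulated htr w hvals hs1 hI).mpr hσ, fun x => hbound _, fun a => ⟨?_, fun z hz => ?_⟩⟩
  · have h1 := (abs_le.mp (hbound (σ.arr a).length)).2
    simp only [Interp.warp, length_pull]
    rw [Int.toNat_le, Nat.cast_pow, Nat.cast_ofNat]
    exact h1
  · simp only [Interp.warp, pull, List.mem_map] at hz
    obtain ⟨j, -, rfl⟩ := hz
    exact hbound _

end SmallModel

end AFL

theorem mainTheorem2 :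
    ∃ c : ℕ, ∀ φ : AFL.Formula,
      φ.Satisfiable ↔
        ∃ σ : AFL.Interp, φ.Sat σ ∧
          (∀ x : ℕ, Sum.inl x ∈ φ.vars → |σ.int x| ≤ 2 ^ (φ.size ^ c)) ∧
          (∀ a : ℕ, Sum.inr a ∈ φ.vars →
            (σ.arr a).length ≤ 2 ^ (φ.size ^ c) ∧
            ∀ z ∈ σ.arr a, |z| ≤ 2 ^ (φ.size ^ c)) := by
  refine ⟨8 * 40, fun φ => ⟨fun ⟨σ, hσ⟩ => ?_, fun ⟨σ, hσ, _⟩ => ⟨σ, hσ⟩⟩⟩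
  obtain ⟨σ', h1, h2, h3⟩ := φ.exists_small_model σ hσ
  exact ⟨σ', h1, fun x _ => h2 x, fun a _ => h3 a⟩
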